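/- An \emph{abstract tropical curve} is a finite connected graph, possibly with loops and multiple edges, whose edges carry lengths in $(0,\infty]$; every edge of infinite length ends at a degree-$1$ vertex, called an infinite vertex. A \emph{tropical modification} of $\Gamma$ is any curve obtained from $\Gamma$ by finitely many subdivisions of edges, reverse subdivisions, and attachments of an infinite edge at a finite vertex. A \emph{smooth} (resp. \emph{nodal}) \emph{tropical curve} in $\mathbb R^2$ is a finite union of segments and rays which near each of its points agrees, up to translation and $\mathrm{GL}_2(\mathbb Z)$, with a standard smooth model, that is, the rays $\mathbb R_{\ge 0}e_1\cup\mathbb R_{\ge 0}(-e_1)$ or the rays $\mathbb R_{\ge 0}e_1\cup\mathbb R_{\ge 0}e_2\cup\mathbb R_{\ge 0}(-e_1-e_2)$ (resp. with a standard smooth model or with a node, the union of two distinct lines of rational slope through the origin). Such a curve determines an abstract tropical curve: its segments and rays are the edges, a vertex at infinity is added to each ray, a segment with endpoints differing by $\alpha v$, with $\alpha>0$ and $v\in\mathbb Z^2$ primitive, has length $\alpha$, and each node is resolved into two vertices, one on each line. A \emph{planar embedding} (resp. \emph{planar immersion}) of $\Gamma$ is a smooth (resp. nodal) tropical curve in $\mathbb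 R^2$ whose abstract tropical curve is a tropical modification of $\Gamma$. A node whose lines have primitive integral direction vectors $u,v$ has multiplicity $|\det(u,v)|$, and the \emph{tropical crossing number} of $\Gamma$ is the minimal number of nodes, counted with multiplicity, of a planar immersion of $\Gamma$. \textbf{Proposition.} Let $\Gamma$ be an abstract tropical curve of genus (first Betti number) $2$ which is stable, i.e. every vertex has degree $3$. If $\Gamma$ is not a theta graph (two vertices joined by three edges) with all three edge lengths equal, then $\Gamma$ has tropical crossing number $0$, and in particular $\Gamma$ has a planar embedding. If $\Gamma$ is the theta graph with all edge lengths equal, then $\Gamma$ has tropical crossing number $1$. -/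

import Mathlib

open scoped ENNReal Topology

/-- An abstract tropical curve: a finite connected multigraph (loops and parallel edges allowed)
whose edges carry lengths in `(0, ∞]`.  Every edge of infinite length ends at an infinite vertex;
infinite vertices have degree one (a loop counts twice) and only meet edges of infinite length. -/
structure AbstractTropicalCurve where
  V : Type
  E : Type
  finite_V : Finite V
  finite_E : Finite E
  ends : E → Sym2 V
  length : E → ℝ≥0∞
  infVerts : Set V
  connected : (SimpleGraph.fromRel fun u v : V => ∃ e, ends e = s(u, v)).Connected
  length_pos : ∀ e, 0 < length e
  exists_infVert : ∀ e, length e = ∞ → ∃ v ∈ ends e, v ∈ infVerts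
  infVert_degree : ∀ v ∈ infVerts,
    {e | v ∈ ends e}.ncard + {e | ends e = s(v, v)}.ncard = 1
  infVert_length : ∀ v ∈ infVerts, ∀ e, v ∈ ends e → length e = ∞

namespace AbstractTropicalCurve

attribute [instance] finite_V finite_E

/-- The degree (valence) of a vertex; loops count twice. -/
noncomputable def degree (Γ : AbstractTropicalCurve) (v : Γ.V) : ℕ :=
  {e | v ∈ Γ.ends e}.ncard + {e | Γ.ends e = s(v, v)}.ncard

/-- The genus: first Betti number of the underlying connected graph. -/
noncomputable def genus (Γ : AbstractTropicalCurve) : ℤ :=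
  (Nat.card Γ.E : ℤ) - (Nat.card Γ.V : ℤ) + 1

/-- A stable tropical curve: every vertex has degree three. -/
def IsStable (Γ : AbstractTropicalCurve) : Prop :=
  ∀ v, Γ.degree v = 3

/-- The underlying graph is the theta graph: two distinct vertices joined by three edges. -/
def IsTheta (Γ : AbstractTropicalCurve) : Prop :=
  ∃ u v : Γ.V, u ≠ v ∧ (∀ w, w = u ∨ w = v) ∧ Nat.card Γ.E = 3 ∧ ∀ e, Γ.ends e = s(u, v)

/-- All edges have the same length. -/
def IsEquilateral (Γ : AbstractTropicalCurve) : Prop :=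
  ∀ e e', Γ.length e = Γ.length e'

/-- Isomorphism of abstract tropical curves. -/
def IsIso (Γ Γ' : AbstractTropicalCurve) : Prop :=
  ∃ (f : Γ.V ≃ Γ'.V) (g : Γ.E ≃ Γ'.E),
    (∀ e, Γ'.ends (g e) = (Γ.ends e).map f) ∧
    (∀ e, Γ'.length (g e) = Γ.length e) ∧
    (∀ v, f v ∈ Γ'.infVerts ↔ v ∈ Γ.infVerts)

/-- `Γ'` is (up to isomorphism) obtained from `Γ` by subdividing one edge `e` with ends `u`, `v`:
there is a new finite vertex `f none`, the edge `e` is replaced by the edge `g (some e)` from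
`u` to the new vertex and the edge `g none` from the new vertex to `v`, and the lengths
of these two add up to the length of `e`.  (If `v` is an infinite vertex then
`g none` has infinite length, by the axioms for `Γ'`.) -/
def IsSubdivision (Γ Γ' : AbstractTropicalCurve) : Prop :=
  ∃ (e : Γ.E) (u v : Γ.V) (f : Option Γ.V ≃ Γ'.V) (g : Option Γ.E ≃ Γ'.E),
    Γ.ends e = s(u, v) ∧
    Γ'.ends (g (some e)) = s(f (some u), f none) ∧
    Γ'.ends (g none) = s(f none, f (some v)) ∧
    Γ'.length (g (some e)) + Γ'.length (g none) = Γ.length e ∧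
    (∀ e', e' ≠ e → Γ'.ends (g (some e')) = (Γ.ends e').map (fun w => f (some w))) ∧
    (∀ e', e' ≠ e → Γ'.length (g (some e')) = Γ.length e') ∧
    (∀ w, f (some w) ∈ Γ'.infVerts ↔ w ∈ Γ.infVerts) ∧
    f none ∉ Γ'.infVerts

/-- `Γ'` is (up to isomorphism) obtained from `Γ` by attaching one infinite edge `g none`,
with a new infinite vertex `f none`, at a finite vertex `v`. -/
def IsElementaryModification (Γ Γ' : AbstractTropicalCurve) : Prop :=
  ∃ (v : Γ.V) (f : Option Γ.V ≃ Γ'.V) (g : Option Γ.E ≃ Γ'.E),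
    v ∉ Γ.infVerts ∧
    Γ'.ends (g none) = s(f (some v), f none) ∧
    Γ'.length (g none) = ∞ ∧
    (∀ e, Γ'.ends (g (some e)) = (Γ.ends e).map (fun w => f (some w))) ∧
    (∀ e, Γ'.length (g (some e)) = Γ.length e) ∧
    (∀ w, f (some w) ∈ Γ'.infVerts ↔ w ∈ Γ.infVerts) ∧
    f none ∈ Γ'.infVerts

/-- One step of a tropical modification. -/
def ModificationStep (Γ Γ' : AbstractTropicalCurve) : Prop :=
  IsIso Γ Γ' ∨ IsSubdivision Γ Γ' ∨ IsSubdivision Γ' Γ ∨ IsElementaryModification Γ Γ'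

/-- `Γ'` is a tropical modification of `Γ`: it is obtained by a finite sequence of elementary
tropical modifications, subdivisions and reverse subdivisions (and isomorphisms). -/
def IsModification (Γ Γ' : AbstractTropicalCurve) : Prop :=
  Relation.ReflTransGen ModificationStep Γ Γ'

end AbstractTropicalCurve

namespace PlaneTropical

/-- The plane (only its vector space structure, topology and lattice `ℤ²` matter). -/
abbrev Plane : Type := Fin 2 → ℝ

/-- An integer vector, as a real vector. -/
def toPlane (d : Fin 2 → ℤ) : Plane := fun i => (d i : ℝ)

/-- A primitive integer vector: its entries have no common divisor. -/
def IsPrimitive (d : Fin 2 → ℤ) : Prop := IsCoprime (d 0) (d 1)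

/-- The closed ray from `p` in direction `d`. -/
def ray (p d : Plane) : Set Plane := {q | ∃ t : ℝ, 0 ≤ t ∧ q = p + t • d}

/-- The set is a union of finitely many (closed) segments and rays. -/
def IsFiniteUnionOfSegmentsAndRays (C : Set Plane) : Prop :=
  ∃ S : Set (Set Plane), S.Finite ∧ C = ⋃₀ S ∧
    ∀ s ∈ S, (∃ p q, p ≠ q ∧ s = segment ℝ p q) ∨ (∃ p d, d ≠ 0 ∧ s = ray p d)

/-- The standard smooth model of valence two in the plane. -/
def smoothModelTwo : Set Plane := ray 0 ![1, 0] ∪ ray 0 ![-1, 0]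

/-- The standard smooth model of valence three in the plane. -/
def smoothModelThree : Set Plane := ray 0 ![1, 0] ∪ ray 0 ![0, 1] ∪ ray 0 ![-1, -1]

/-- The image of a subset of the plane under an integral change of coordinates. -/
def changeCoordinates (A : GL (Fin 2) ℤ) (M : Set Plane) : Set Plane :=
  (fun x : Plane => ((A : Matrix (Fin 2) (Fin 2) ℤ).map (Int.cast : ℤ → ℝ)).mulVec x) '' M

/-- Near `p`, the set `C` equals a standard smooth model,
up to translation and a change of coordinates in `GL₂(ℤ)`. -/
def IsSmoothAt (C : Set Plane) (p : Plane) : Prop :=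
  ∃ M : Set Plane, (M = smoothModelTwo ∨ M = smoothModelThree) ∧
    ∃ A : GL (Fin 2) ℤ, ∀ᶠ q in 𝓝 p, q ∈ C ↔ q - p ∈ changeCoordinates A M

/-- Near `p`, the set `C` is the union of two distinct lines through `p`, which are
parallel to the primitive integer vectors `a` and `b` respectively. -/
def IsNodeAt (C : Set Plane) (p : Plane) (a b : Fin 2 → ℤ) : Prop :=
  IsPrimitive a ∧ IsPrimitive b ∧ a 0 * b 1 - a 1 * b 0 ≠ 0 ∧
    ∀ᶠ q in 𝓝 p, q ∈ C ↔ ∃ t : ℝ, q = p + t • toPlane a ∨ q = p + t • toPlane b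

/-- A smooth tropical curve in the plane. -/
def IsSmoothTropicalCurve (C : Set Plane) : Prop :=
  IsFiniteUnionOfSegmentsAndRays C ∧ ∀ p ∈ C, IsSmoothAt C p

/-- A nodal tropical curve in the plane. -/
def IsNodalTropicalCurve (C : Set Plane) : Prop :=
  IsFiniteUnionOfSegmentsAndRays C ∧ ∀ p ∈ C, IsSmoothAt C p ∨ ∃ a b, IsNodeAt C p a b

/-- A way to see the abstract tropical curve `G` as the one determined by the nodal tropical
curve `C`: finite vertices are points of `C`, the edges are the relatively open segments and rays
into which `C` is cut, a vertex at infinity is added to each ray, the length of a segment is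
measured in multiples of a primitive integer vector, and every node is resolved into two vertices,
one for each of the two lines.  The position assigned to infinite vertices is irrelevant. -/
structure Resolution (C : Set Plane) (G : AbstractTropicalCurve) where
  pos : G.V → Plane
  arc : G.E → Set Plane
  finite_arc : ∀ e u v, G.ends e = s(u, v) → u ∉ G.infVerts → v ∉ G.infVerts →
    arc e = openSegment ℝ (pos u) (pos v) ∧
      ∃ d, IsPrimitive d ∧ pos v - pos u = (G.length e).toReal • toPlane d
  infinite_arc : ∀ e u w, G.ends e = s(u, w) → w ∈ G.infVerts →
    u ∉ G.infVerts ∧ ∃ d, IsPrimitive d ∧ arc e = {q | ∃ t : ℝ, 0 < t ∧ q = pos u + t • toPlane d}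
  cover : C = pos '' (G.infVerts)ᶜ ∪ ⋃ e, arc e
  arc_disjoint : ∀ e e', e ≠ e' → Disjoint (arc e) (arc e')
  pos_notMem_arc : ∀ v, v ∉ G.infVerts → ∀ e, pos v ∉ arc e
  pos_smooth : ∀ v w, v ∉ G.infVerts → w ∉ G.infVerts → pos v = pos w →
    IsSmoothAt C (pos v) → v = w
  pos_node : ∀ p a b, IsNodeAt C p a b →
    ∃ v w, v ≠ w ∧ {x | x ∉ G.infVerts ∧ pos x = p} = {v, w} ∧
      (∀ e, v ∈ G.ends e → ∀ q ∈ arc e, ∃ t : ℝ, q = p + t • toPlane a) ∧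
      (∀ e, w ∈ G.ends e → ∀ q ∈ arc e, ∃ t : ℝ, q = p + t • toPlane b)

/-- `C` is a planar embedding of `Γ`: a smooth tropical curve in the plane
whose abstract tropical curve is a tropical modification of `Γ`. -/
def IsEmbedding (C : Set Plane) (Γ : AbstractTropicalCurve) : Prop :=
  IsSmoothTropicalCurve C ∧ ∃ G, Γ.IsModification G ∧ Nonempty (Resolution C G)

/-- `C` is a planar immersion of `Γ`: a nodal tropical curve in the plane
whose abstract tropical curve is a tropical modification of `Γ`. -/
def IsImmersion (C : Set Plane) (Γ : AbstractTropicalCurve) : Prop :=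
  IsNodalTropicalCurve C ∧ ∃ G, Γ.IsModification G ∧ Nonempty (Resolution C G)

/-- The multiplicity of `p` as a node of `C`: the absolute value of the determinant of the two
primitive direction vectors (which are unique up to sign and order), and `0` if `p` is not a
node. -/
noncomputable def nodeMultiplicity (C : Set Plane) (p : Plane) : ℕ :=
  sInf {m | ∃ a b, IsNodeAt C p a b ∧ m = (a 0 * b 1 - a 1 * b 0).natAbs}

/-- The number of nodes of `C`, counted with multiplicity: the supremum of the partial sums of
multiplicities over finite sets of points (a nodal tropical curve has only finitely many nodes). -/
noncomputable def nodeCount (C : Set Plane) : ℕ∞ :=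
  ⨆ s : Finset Plane, ∑ p ∈ s, (nodeMultiplicity C p : ℕ∞)

end PlaneTropical

/-- The tropical crossing number: the minimal number of nodes, counted with multiplicity,
of a planar immersion of `Γ` (`⊤` if there is none; otherwise the infimum is attained). -/
noncomputable def AbstractTropicalCurve.crossingNumber (Γ : AbstractTropicalCurve) : ℕ∞ :=
  ⨅ (C : Set PlaneTropical.Plane) (_ : PlaneTropical.IsImmersion C Γ), PlaneTropical.nodeCount C

/-! Lower bound for the equilateral theta graph. Suppose that a curve without nodes resolves to a
modification of the theta graph whose three strands have length `L`. At a smooth point every line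
either runs along the curve or has branches of the curve on both of its sides. Therefore visibility
in the complement is transitive (`Vis.trans`), and the regions of the complement are open and
convex.

The theta graph inside a modification is recorded by flows: the edges carrying flow fall into three
classes of total length `L`, and the flows are the triples of class values with sum zero. This
description survives every modification step (`AbstractTropicalCurve.IsModification.hasTheta`). If
the regions on both sides of an edge are unbounded, recession directions produce a cut consisting of
that edge alone, so the edge carries no flow (`Drawing.flow_eq_zero`). Hence every class borders
bounded regions. The boundary of a bounded region is itself a flow, with values in {0, 1, -1}, so if
it uses one of the classes it uses exactly two. This yields two faces F and F' which miss different
classes and share a class m (`ThetaData.exists_two_faces`).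

Edges separating the same two convex regions are parallel, so all of m has one direction u. Walk
around F, keeping it on the right. After u come the directions v_1, ..., v_K of the other strand of
F. Beyond this strand all regions are unbounded (`Circuit.not_isBounded`), and their recession
directions limit how far the outward legs at the corners may converge. In the basis (v_1, u) this
becomes an integer recursion (`TurnSequence.exists_bound`), which provides a linear form φ with φ(u)
= 1 and φ(v_i) ≥ -1. The boundary of F closes up and its two strands have equal length, so the sum
of ℓ_i (φ(v_i) + 1) vanishes. Thus φ(v_i) = -1 for all i, and this forces v_1 + v_K = -2u
(`Circuit.vec_sum`). For F' the balancing condition replaces u, v_1, v_K by -u, v_K - u, v_1 - u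
(`Circuit.match_ends`), so that v_1 + v_K - 2u = 2u. Together these give u = 0, which is absurd
(`ThetaData.false`).

Upper bounds. A stable curve of genus two has two vertices and three edges and is a theta graph or a
dumbbell (`IsStable.isTheta_or_dumbbell`). Explicit drawings in coordinates embed dumbbells and
theta graphs with unequal edges, and immerse the equilateral theta graph with one node of
multiplicity one. For each of them it remains to check that the lengths add up, that arcs are
disjoint, and that the vertices are unimodular tripods (apart from the two lying over the node). -/

namespace PlaneTropical

/-! ### Cross products and primitive lattice vectors. -/

/-- The cross product (determinant) of two plane vectors. -/
def cross {R : Type*} [CommRing R] (u v : Fin 2 → R) : R := u 0 * v 1 - u 1 * v 0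

section Cross
variable {R : Type*} [CommRing R]

lemma cross_add_left (u v w : Fin 2 → R) : cross (u + v) w = cross u w + cross v w := by
  simp [cross]; ring
lemma cross_add_right (u v w : Fin 2 → R) : cross u (v + w) = cross u v + cross u w := by
  simp [cross]; ring
lemma cross_sub_left (u v w : Fin 2 → R) : cross (u - v) w = cross u w - cross v w := by
  simp [cross]; ring
lemma cross_sub_right (u v w : Fin 2 → R) : cross u (v - w) = cross u v - cross u w := by
  simp [cross]; ring
lemma cross_smul_left (c : R) (u v : Fin 2 → R) : cross (c • u) v = c * cross u v := by
  simp [cross]; ring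
lemma cross_smul_right (c : R) (u v : Fin 2 → R) : cross u (c • v) = c * cross u v := by
  simp [cross]; ring
lemma cross_neg_left (u v : Fin 2 → R) : cross (-u) v = -cross u v := by
  simp [cross]; ring
lemma cross_neg_right (u v : Fin 2 → R) : cross u (-v) = -cross u v := by
  simp [cross]; ring
@[simp] lemma cross_self (u : Fin 2 → R) : cross u u = 0 := by
  simp [cross]; ring
lemma cross_comm (u v : Fin 2 → R) : cross u v = -cross v u := by
  simp [cross]; ring

/-- Cramer's rule in the plane. -/
lemma cross_smul_eq (u v w : Fin 2 → R) :
    cross u v • w = cross w v • u + cross u w • v := by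
  ext i; fin_cases i <;> simp [cross] <;> ring

end Cross

lemma cross_toPlane (a b : Fin 2 → ℤ) : cross (toPlane a) (toPlane b) = ((cross a b : ℤ) : ℝ) := by
  simp [cross, toPlane]

lemma toPlane_neg (a : Fin 2 → ℤ) : toPlane (-a) = -toPlane a := by
  ext i; simp [toPlane]
lemma toPlane_add (a b : Fin 2 → ℤ) : toPlane (a + b) = toPlane a + toPlane b := by
  ext i; simp [toPlane]
lemma toPlane_smul (n : ℤ) (b : Fin 2 → ℤ) : toPlane (n • b) = (n : ℝ) • toPlane b := by
  ext i; simp [toPlane]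
lemma toPlane_injective : Function.Injective toPlane := by
  intro a b h; ext i; have := congrFun h i; simpa [toPlane] using this

lemma IsPrimitive.ne_zero {d : Fin 2 → ℤ} (h : IsPrimitive d) : d ≠ 0 := by
  rintro rfl; simp [IsPrimitive, isCoprime_zero_left] at h

lemma IsPrimitive.toPlane_ne_zero {d : Fin 2 → ℤ} (h : IsPrimitive d) : toPlane d ≠ 0 := by
  intro h0; exact h.ne_zero (toPlane_injective (by rw [h0]; ext i; simp [toPlane]))

lemma IsPrimitive.neg {d : Fin 2 → ℤ} (h : IsPrimitive d) : IsPrimitive (-d) := by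
  simpa [IsPrimitive] using h.neg_neg

/-- Two parallel primitive vectors agree up to sign. -/
lemma IsPrimitive.eq_or_neg {d d' : Fin 2 → ℤ} (h : IsPrimitive d) (h' : IsPrimitive d')
    (hc : cross d d' = 0) : d = d' ∨ d = -d' := by
  obtain ⟨x, y, hxy⟩ := h
  obtain ⟨x', y', hxy'⟩ := h'
  -- The Bezout relation of `d'` makes the factor of proportionality an integer; the one of `d` then
  -- makes it a unit.
  have hd : d = (x' * d 0 + y' * d 1) • d' := by
    unfold cross at hc
    ext i; fin_cases i <;> simp
    · linear_combination (-d 0) * hxy' + y' * hc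
    · linear_combination (-d 1) * hxy' - x' * hc
  set c := x' * d 0 + y' * d 1
  have hu : c * (x * d' 0 + y * d' 1) = 1 := by
    have h0 := congrFun hd 0
    have h1 := congrFun hd 1
    simp at h0 h1
    rw [h0, h1] at hxy
    linear_combination hxy
  rcases Int.isUnit_iff.1 (IsUnit.of_mul_eq_one _ hu) with h | h
  · left; rw [hd, h]; simp
  · right; rw [hd, h]; simp

lemma IsPrimitive.eq_of_smul {d d' : Fin 2 → ℤ} (h : IsPrimitive d) (h' : IsPrimitive d')
    {c c' : ℝ} (hc : 0 < c) (hc' : 0 < c') (he : c • toPlane d = c' • toPlane d') : d = d' := by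
  have h0 : cross d d' = 0 := by
    have : c * cross (toPlane d) (toPlane d') = 0 := by
      rw [← cross_smul_left, he, cross_smul_left, cross_self, mul_zero]
    rw [cross_toPlane] at this
    rcases mul_eq_zero.1 this with h | h
    · exact absurd h hc.ne'
    · exact_mod_cast h
  rcases h.eq_or_neg h' h0 with h1 | h1
  · exact h1
  · exfalso
    rw [h1, toPlane_neg, smul_neg, neg_eq_iff_add_eq_zero, ← add_smul] at he
    rcases smul_eq_zero.1 he with h | h
    · linarith
    · exact h'.toPlane_ne_zero h

/-! ### Drawings of metric graphs and their germs. -/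

/-- The relatively open segment or ray from `b` in direction `d`. -/
def track (b d : Plane) (ℓ : ℝ) (fin : Bool) : Set Plane :=
  {q | ∃ t : ℝ, 0 < t ∧ (fin → t < ℓ) ∧ q = b + t • d}

/-- Near any point `p`, a track is a germ of a line, a germ of a ray, or empty. -/
lemma eventually_mem_track (b : Plane) {d : Plane} (hd : d ≠ 0) {ℓ : ℝ} (hℓ : 0 < ℓ) (fin : Bool)
    (p : Plane) : ∀ᶠ q in 𝓝 p, q ∈ track b d ℓ fin ↔
      (p ∈ track b d ℓ fin ∧ ∃ t : ℝ, q = p + t • d) ∨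
      (p = b ∧ ∃ t : ℝ, 0 < t ∧ q = p + t • d) ∨
      (fin ∧ p = b + ℓ • d ∧ ∃ t : ℝ, 0 < t ∧ q = p - t • d) := by
  have hn : 0 < d 0 ^ 2 + d 1 ^ 2 := by
    by_contra h
    apply hd
    have h0 : d 0 = 0 := by nlinarith [sq_nonneg (d 0), sq_nonneg (d 1)]
    have h1 : d 1 = 0 := by nlinarith [sq_nonneg (d 0), sq_nonneg (d 1)]
    ext i; fin_cases i <;> simp [h0, h1]
  -- Orthogonal projection to the line through `b`, read as a parameter. For points of this line the
  -- claim compares the parameter with `0` and `ℓ`.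
  obtain ⟨τ, hτ, hτb⟩ : ∃ τ : Plane → ℝ, Continuous τ ∧ ∀ t : ℝ, τ (b + t • d) = t := by
    refine ⟨fun q => ((q 0 - b 0) * d 0 + (q 1 - b 1) * d 1) / (d 0 ^ 2 + d 1 ^ 2),
      by fun_prop, fun t => ?_⟩
    simp; field_simp
  have huniq : ∀ s t : ℝ, b + s • d = b + t • d ↔ s = t := fun s t =>
    ⟨fun h => by rw [← hτb s, h, hτb], fun h => by rw [h]⟩
  by_cases hp : p = b + τ p • d
  swap
  · have hev : ∀ᶠ q in 𝓝 p, q ≠ b + τ q • d := by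
      have : IsOpen {q : Plane | q ≠ b + τ q • d} :=
        isOpen_ne_fun continuous_id (by fun_prop)
      exact this.mem_nhds hp
    have hp' : ∀ t : ℝ, p ≠ b + t • d := fun t h => hp (by rw [h, hτb])
    filter_upwards [hev] with q hq
    have hq' : ∀ t : ℝ, q ≠ b + t • d := fun t h => hq (by rw [h, hτb])
    constructor
    · rintro ⟨t, -, -, h⟩; exact absurd h (hq' t)
    · rintro (⟨⟨t, -, -, h⟩, -⟩ | ⟨h, -⟩ | ⟨-, h, -⟩)
      · exact absurd h (hp' t)
      · exact absurd (by simpa using h) (hp' 0)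
      · exact absurd h (hp' ℓ)
  · set t₀ := τ p with ht₀
    -- Strict inequalities satisfied by the parameter of `p` persist nearby; the equalities `t₀ = 0`
    -- and `t₀ = ℓ` produce the two ray germs.
    have e1 : ∀ᶠ q in 𝓝 p, t₀ < 0 → τ q < 0 := by
      by_cases h : t₀ < 0
      · filter_upwards [hτ.continuousAt.eventually (gt_mem_nhds h)] with q hq _ using hq
      · exact .of_forall fun q hq => absurd hq h
    have e2 : ∀ᶠ q in 𝓝 p, 0 < t₀ → 0 < τ q := by
      by_cases h : 0 < t₀
      · filter_upwards [hτ.continuousAt.eventually (lt_mem_nhds h)] with q hq _ using hq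
      · exact .of_forall fun q hq => absurd hq h
    have e3 : ∀ᶠ q in 𝓝 p, t₀ < ℓ → τ q < ℓ := by
      by_cases h : t₀ < ℓ
      · filter_upwards [hτ.continuousAt.eventually (gt_mem_nhds h)] with q hq _ using hq
      · exact .of_forall fun q hq => absurd hq h
    have e4 : ∀ᶠ q in 𝓝 p, ℓ < t₀ → ℓ < τ q := by
      by_cases h : ℓ < t₀
      · filter_upwards [hτ.continuousAt.eventually (lt_mem_nhds h)] with q hq _ using hq
      · exact .of_forall fun q hq => absurd hq h
    filter_upwards [e1, e2, e3, e4] with q q1 q2 q3 q4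
    have add : ∀ t : ℝ, p + t • d = b + (t₀ + t) • d := fun t => by
      rw [hp, add_smul, add_assoc]
    have sub : ∀ t : ℝ, p - t • d = b + (t₀ - t) • d := fun t => by
      rw [hp, sub_smul, add_sub_assoc]
    have hpt : p ∈ track b d ℓ fin ↔ 0 < t₀ ∧ (fin → t₀ < ℓ) := by
      constructor
      · rintro ⟨t, h1, h2, h3⟩
        rw [hp, huniq] at h3
        rw [h3]; exact ⟨h1, h2⟩
      · rintro ⟨h1, h2⟩; exact ⟨t₀, h1, h2, hp⟩
    have hpb : p = b ↔ t₀ = 0 := by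
      rw [← huniq, ← hp]; simp
    have hpl : p = b + ℓ • d ↔ t₀ = ℓ := by
      rw [← huniq, ← hp]
    rw [hpt, hpb, hpl]
    simp_rw [add, sub]
    constructor
    · rintro ⟨t, h1, h2, rfl⟩
      rw [hτb] at q1 q2 q3 q4
      simp_rw [huniq]
      rcases lt_trichotomy t₀ 0 with h | h | h
      · linarith [q1 h]
      · exact Or.inr (Or.inl ⟨h, t, h1, by rw [h, zero_add]⟩)
      · cases fin with
        | false => exact Or.inl ⟨⟨h, by simp⟩, t - t₀, by ring⟩
        | true =>
          rcases lt_trichotomy t₀ ℓ with h' | h' | h'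
          · exact Or.inl ⟨⟨h, fun _ => h'⟩, t - t₀, by ring⟩
          · exact Or.inr (Or.inr ⟨rfl, h', t₀ - t, by linarith [h2 rfl], by ring⟩)
          · linarith [q4 h', h2 rfl]
    · rintro (⟨⟨h1, h2⟩, t, rfl⟩ | ⟨h1, t, ht, rfl⟩ | ⟨h1, h2, t, ht, rfl⟩)
      · rw [hτb] at q1 q2 q3 q4
        exact ⟨_, q2 h1, fun h => q3 (h2 h), rfl⟩
      · rw [hτb] at q1 q2 q3 q4
        exact ⟨_, by linarith, fun h => q3 (by linarith), rfl⟩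
      · rw [hτb] at q1 q2 q3 q4
        exact ⟨_, q2 (by linarith), fun h => by linarith, rfl⟩

/-- A finite metric graph drawn in the plane: vertices are points, edges are segments (from
`tail e` to `head e`) or rays (when `head e = none`) in primitive integral directions. -/
structure Drawing (V E : Type) where
  pos : V → Plane
  tail : E → V
  head : E → Option V
  dir : E → Fin 2 → ℤ
  len : E → ℝ
  prim : ∀ e, IsPrimitive (dir e)
  len_pos : ∀ e, 0 < len e
  pos_head : ∀ e v, head e = some v → pos v = pos (tail e) + len e • toPlane (dir e)
  disj : ∀ e e', e ≠ e' →
    Disjoint (track (pos (tail e)) (toPlane (dir e)) (len e) (head e).isSome)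
      (track (pos (tail e')) (toPlane (dir e')) (len e') (head e').isSome)
  notMem : ∀ v e, pos v ∉ track (pos (tail e)) (toPlane (dir e)) (len e) (head e).isSome

namespace Drawing

variable {V E : Type} (D : Drawing V E)

/-- The relatively open segment or ray of an edge. -/
def arc (e : E) : Set Plane :=
  track (D.pos (D.tail e)) (toPlane (D.dir e)) (D.len e) (D.head e).isSome

/-- The union of all vertices and edges. -/
def support : Set Plane := Set.range D.pos ∪ ⋃ e, D.arc e

/-- The source of a dart, that is, of an oriented edge. -/
def src (δ : E × Bool) : Option V := if δ.2 then some (D.tail δ.1) else D.head δ.1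

/-- The direction vector of a dart. -/
def vec (δ : E × Bool) : Fin 2 → ℤ := if δ.2 then D.dir δ.1 else -D.dir δ.1

/-- The dart with the opposite orientation. -/
def rev (δ : E × Bool) : E × Bool := (δ.1, !δ.2)

@[simp] lemma rev_rev (δ : E × Bool) : rev (rev δ) = δ := by simp [rev]
@[simp] lemma rev_fst (δ : E × Bool) : (rev δ).1 = δ.1 := rfl
@[simp] lemma vec_rev (δ : E × Bool) : D.vec (rev δ) = -D.vec δ := by
  obtain ⟨e, b⟩ := δ; cases b <;> simp [rev, vec]

lemma vec_prim (δ : E × Bool) : IsPrimitive (D.vec δ) := by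
  obtain ⟨e, b⟩ := δ
  cases b
  · simpa [vec] using (D.prim e).neg
  · simpa [vec] using D.prim e

lemma arc_disjoint {e e' : E} (h : e ≠ e') : Disjoint (D.arc e) (D.arc e') := D.disj e e' h
lemma pos_notMem_arc (v : V) (e : E) : D.pos v ∉ D.arc e := D.notMem v e

lemma arc_eq_of_mem {e e' : E} {q : Plane} (h : q ∈ D.arc e) (h' : q ∈ D.arc e') : e = e' := by
  by_contra hne; exact (Set.disjoint_left.1 (D.arc_disjoint hne)) h h'

lemma arc_subset (e : E) : D.arc e ⊆ D.support := fun _ hq =>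
  Or.inr (Set.mem_iUnion.2 ⟨e, hq⟩)
lemma pos_mem (v : V) : D.pos v ∈ D.support := Or.inl ⟨v, rfl⟩

/-- The arc of an edge, parametrised from the source of a dart. -/
lemma arc_eq {δ : E × Bool} {v : V} (h : D.src δ = some v) :
    D.arc δ.1 = track (D.pos v) (toPlane (D.vec δ)) (D.len δ.1) (D.src (rev δ)).isSome := by
  obtain ⟨e, b⟩ := δ
  cases b
  · simp only [src, Bool.false_eq_true, if_false] at h
    have hp := D.pos_head e v h
    simp only [arc, track, h, src, rev, vec, Bool.not_false, if_true, Option.isSome_some,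
      Bool.false_eq_true, if_false, forall_const]
    ext q
    constructor
    · rintro ⟨t, h1, h2, rfl⟩
      refine ⟨D.len e - t, by linarith, by linarith, ?_⟩
      rw [hp, toPlane_neg]; module
    · rintro ⟨t, h1, h2, rfl⟩
      refine ⟨D.len e - t, by linarith, by linarith, ?_⟩
      rw [hp, toPlane_neg]; module
  · simp only [src, if_true, Option.some.injEq] at h
    simp [arc, src, rev, vec, h]

lemma pos_target {δ : E × Bool} {v w : V} (h : D.src δ = some v) (h' : D.src (rev δ) = some w) :
    D.pos w = D.pos v + D.len δ.1 • toPlane (D.vec δ) := by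
  obtain ⟨e, b⟩ := δ
  cases b
  · simp [src, rev] at h h'
    rw [D.pos_head e v h, h']
    simp [vec, toPlane_neg]
  · simp [src, rev] at h h'
    rw [D.pos_head e w h', h]
    simp [vec]

lemma mem_arc_of_small {δ : E × Bool} {v : V} (h : D.src δ = some v) {t : ℝ} (ht : 0 < t)
    (ht' : t < D.len δ.1) : D.pos v + t • toPlane (D.vec δ) ∈ D.arc δ.1 := by
  rw [D.arc_eq h]; exact ⟨t, ht, fun _ => ht', rfl⟩

/-- In terms of darts both ends of an edge look alike: the germ of an arc at an end is the ray of
the dart leaving it. -/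
lemma eventually_mem_arc (e : E) (p : Plane) : ∀ᶠ q in 𝓝 p, q ∈ D.arc e ↔
    (p ∈ D.arc e ∧ ∃ t : ℝ, q = p + t • toPlane (D.dir e)) ∨
    ∃ b v, D.src (e, b) = some v ∧ D.pos v = p ∧
      ∃ t : ℝ, 0 < t ∧ q = p + t • toPlane (D.vec (e, b)) := by
  filter_upwards [eventually_mem_track (D.pos (D.tail e)) (D.prim e).toPlane_ne_zero
    (D.len_pos e) (D.head e).isSome p] with q hq
  rw [arc, hq]
  apply or_congr Iff.rfl
  simp only [Bool.exists_bool, src, vec, if_true, Bool.false_eq_true, if_false,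
    Option.some.injEq, exists_eq_left', toPlane_neg, smul_neg, ← sub_eq_add_neg]
  constructor
  · rintro (⟨h, t, ht⟩ | ⟨h1, h2, t, ht⟩)
    · exact Or.inr ⟨h.symm, t, ht⟩
    · obtain ⟨v, hv⟩ := Option.isSome_iff_exists.1 h1
      exact Or.inl ⟨v, hv, by rw [h2, D.pos_head e v hv], t, ht⟩
  · rintro (⟨v, hv, h2, t, ht⟩ | ⟨h, t, ht⟩)
    · exact Or.inr ⟨by rw [hv]; rfl, by rw [← h2, D.pos_head e v hv], t, ht⟩
    · exact Or.inl ⟨h.symm, t, ht⟩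

variable [Finite V] [Finite E]

lemma eventually_mem_support (p : Plane) : ∀ᶠ q in 𝓝 p, q ∈ D.support ↔
    (q = p ∧ p ∈ Set.range D.pos) ∨
    (∃ e, p ∈ D.arc e ∧ ∃ t : ℝ, q = p + t • toPlane (D.dir e)) ∨
    ∃ δ v, D.src δ = some v ∧ D.pos v = p ∧
      ∃ t : ℝ, 0 < t ∧ q = p + t • toPlane (D.vec δ) := by
  have h1 : ∀ᶠ q in 𝓝 p, q ∈ Set.range D.pos ↔ (q = p ∧ p ∈ Set.range D.pos) := by
    have : ∀ᶠ q in 𝓝 p, q ∉ Set.range D.pos \ {p} :=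
      (((Set.finite_range D.pos).subset Set.sdiff_subset).isClosed.isOpen_compl).mem_nhds (by simp)
    filter_upwards [this] with q hq
    constructor
    · intro h
      have : q = p := by
        by_contra hne; exact hq ⟨h, hne⟩
      exact ⟨this, this ▸ h⟩
    · rintro ⟨rfl, h⟩; exact h
  have h2 := Filter.eventually_all.2 fun e => D.eventually_mem_arc e p
  filter_upwards [h1, h2] with q hq1 hq2
  rw [support, Set.mem_union, Set.mem_iUnion, hq1, exists_congr hq2, exists_or, Prod.exists]

/-- Each clause of the local description at `p` already requires `p` itself to lie on the drawing.
-/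
lemma isClosed_support : IsClosed D.support := by
  rw [← isOpen_compl_iff, isOpen_iff_mem_nhds]
  intro p hp
  filter_upwards [D.eventually_mem_support p] with q hq hqs
  apply hp
  rcases hq.1 hqs with ⟨-, v, hv⟩ | ⟨e, he, -⟩ | ⟨δ, v, -, hv, -⟩
  · exact hv ▸ D.pos_mem v
  · exact D.arc_subset e he
  · exact hv ▸ D.pos_mem v

/-- Near a point of an arc, the support is a line. -/
lemma eventually_mem_support_of_mem_arc {e : E} {p : Plane} (hp : p ∈ D.arc e) :
    ∀ᶠ q in 𝓝 p, q ∈ D.support ↔ ∃ t : ℝ, q = p + t • toPlane (D.dir e) := by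
  filter_upwards [D.eventually_mem_support p] with q hq
  rw [hq]
  constructor
  · rintro (⟨-, v, hv⟩ | ⟨e', he', h⟩ | ⟨δ, v, -, hv, -⟩)
    · exact absurd (hv ▸ hp) (D.pos_notMem_arc v e)
    · rwa [D.arc_eq_of_mem hp he']
    · exact absurd (hv ▸ hp) (D.pos_notMem_arc v e)
  · exact fun h => Or.inr (Or.inl ⟨e, hp, h⟩)

/-- Near a vertex, the support is the union of the germs of the darts leaving this position. -/
lemma eventually_mem_support_pos (v : V) : ∀ᶠ q in 𝓝 (D.pos v), q ∈ D.support ↔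
    q = D.pos v ∨ ∃ δ w, D.src δ = some w ∧ D.pos w = D.pos v ∧
      ∃ t : ℝ, 0 < t ∧ q = D.pos v + t • toPlane (D.vec δ) := by
  filter_upwards [D.eventually_mem_support (D.pos v)] with q hq
  rw [hq]
  constructor
  · rintro (⟨h, -⟩ | ⟨e, he, -⟩ | h)
    · exact Or.inl h
    · exact absurd he (D.pos_notMem_arc v e)
    · exact Or.inr h
  · rintro (h | h)
    · exact Or.inl ⟨h, v, rfl⟩
    · exact Or.inr (Or.inr h)

end Drawing

end PlaneTropical

/-! ### Local models at smooth points and nodes. -/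

namespace PlaneTropical

lemma mem_changeCoordinates_two (A : GL (Fin 2) ℤ) (x : Plane) :
    x ∈ changeCoordinates A smoothModelTwo ↔
      ∃ t : ℝ, x = t • toPlane fun i => (A : Matrix (Fin 2) (Fin 2) ℤ) i 0 := by
  have key : ∀ (c : ℝ), (((A : Matrix (Fin 2) (Fin 2) ℤ).map (Int.cast : ℤ → ℝ)).mulVec
      ![c, 0]) = c • toPlane fun i => (A : Matrix (Fin 2) (Fin 2) ℤ) i 0 := by
    intro c; ext i; simp [Matrix.mulVec, dotProduct, Fin.sum_univ_two, toPlane, mul_comm]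
  constructor
  · rintro ⟨y, hy | hy, rfl⟩ <;> obtain ⟨t, -, rfl⟩ := hy
    · exact ⟨t, by rw [← key]; congr 1; ext i; fin_cases i <;> simp⟩
    · exact ⟨-t, by rw [← key]; congr 1; ext i; fin_cases i <;> simp⟩
  · rintro ⟨t, rfl⟩
    refine ⟨![t, 0], ?_, key t⟩
    rcases le_total 0 t with h | h
    · exact Or.inl ⟨t, h, by ext i; fin_cases i <;> simp⟩
    · exact Or.inr ⟨-t, by linarith, by ext i; fin_cases i <;> simp⟩

/-- The tripod at `p` spanned by `d`, `d'` and `-(d + d')`. -/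
def tripod (p : Plane) (d d' : Fin 2 → ℤ) : Set Plane :=
  {q | ∃ t : ℝ, 0 ≤ t ∧ (q = p + t • toPlane d ∨ q = p + t • toPlane d' ∨
    q = p + t • toPlane (-(d + d')))}

lemma mem_changeCoordinates_three (A : GL (Fin 2) ℤ) (x : Plane) :
    x ∈ changeCoordinates A smoothModelThree ↔
      x ∈ tripod 0 (fun i => (A : Matrix (Fin 2) (Fin 2) ℤ) i 0)
        (fun i => (A : Matrix (Fin 2) (Fin 2) ℤ) i 1) := by
  have key : ∀ (c c' : ℝ), (((A : Matrix (Fin 2) (Fin 2) ℤ).map (Int.cast : ℤ → ℝ)).mulVec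
      ![c, c']) = c • toPlane (fun i => (A : Matrix (Fin 2) (Fin 2) ℤ) i 0) +
        c' • toPlane (fun i => (A : Matrix (Fin 2) (Fin 2) ℤ) i 1) := by
    intro c c'; ext i; simp [Matrix.mulVec, dotProduct, Fin.sum_univ_two, toPlane, mul_comm]
  constructor
  · rintro ⟨y, (hy | hy) | hy, rfl⟩ <;> obtain ⟨t, ht, rfl⟩ := hy <;> refine ⟨t, ht, ?_⟩
    · left
      have : (0 : Plane) + t • ![1, 0] = ![t, 0] := by ext i; fin_cases i <;> simp
      simp only [this, key]; simp
    · right; left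
      have : (0 : Plane) + t • ![0, 1] = ![0, t] := by ext i; fin_cases i <;> simp
      simp only [this, key]; simp
    · right; right
      have : (0 : Plane) + t • ![-1, -1] = ![-t, -t] := by ext i; fin_cases i <;> simp
      simp only [this, key, toPlane_neg, toPlane_add]; module
  · rintro ⟨t, ht, h | h | h⟩
    · refine ⟨![t, 0], Or.inl (Or.inl ⟨t, ht, by ext i; fin_cases i <;> simp⟩), ?_⟩
      simp only [key, h]; simp
    · refine ⟨![0, t], Or.inl (Or.inr ⟨t, ht, by ext i; fin_cases i <;> simp⟩), ?_⟩
      simp only [key, h]; simp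
    · refine ⟨![-t, -t], Or.inr ⟨t, ht, by ext i; fin_cases i <;> simp⟩, ?_⟩
      simp only [key, h, toPlane_neg, toPlane_add]; module

lemma tripod_swap (p : Plane) (d d' : Fin 2 → ℤ) : tripod p d d' = tripod p d' d := by
  ext q
  simp only [tripod, Set.mem_ofPred_eq, add_comm d d']
  constructor <;> rintro ⟨t, ht, h | h | h⟩ <;> exact ⟨t, ht, by tauto⟩

lemma mem_tripod_iff_sub (p q : Plane) (d d' : Fin 2 → ℤ) :
    q ∈ tripod p d d' ↔ q - p ∈ tripod 0 d d' := by
  simp only [tripod, Set.mem_ofPred_eq, zero_add, sub_eq_iff_eq_add']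

/-- Smoothness in terms of primitive direction vectors. -/
lemma isSmoothAt_iff (C : Set Plane) (p : Plane) : IsSmoothAt C p ↔
    (∃ d, IsPrimitive d ∧ ∀ᶠ q in 𝓝 p, q ∈ C ↔ ∃ t : ℝ, q = p + t • toPlane d) ∨
    (∃ d d', cross d d' = 1 ∧ ∀ᶠ q in 𝓝 p, q ∈ C ↔ q ∈ tripod p d d') := by
  constructor
  · rintro ⟨M, hM, A, hA⟩
    have hdet : cross (fun i => (A : Matrix (Fin 2) (Fin 2) ℤ) i 0)
        (fun i => (A : Matrix (Fin 2) (Fin 2) ℤ) i 1) = A.1.det := by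
      rw [Matrix.det_fin_two]; simp [cross]; ring
    have hu := Int.isUnit_iff.1 ((Matrix.isUnit_iff_isUnit_det _).1 A.isUnit)
    rw [← hdet] at hu
    rcases hM with rfl | rfl
    · left
      refine ⟨fun i => (A : Matrix (Fin 2) (Fin 2) ℤ) i 0, ?_, ?_⟩
      rotate_left
      · filter_upwards [hA] with q hq
        rw [hq, mem_changeCoordinates_two]
        simp_rw [sub_eq_iff_eq_add']
      · rcases hu with h | h
        · exact ⟨(A : Matrix (Fin 2) (Fin 2) ℤ) 1 1, -(A : Matrix (Fin 2) (Fin 2) ℤ) 0 1, by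
            simp only [cross] at h; linarith⟩
        · exact ⟨-(A : Matrix (Fin 2) (Fin 2) ℤ) 1 1, (A : Matrix (Fin 2) (Fin 2) ℤ) 0 1, by
            simp only [cross] at h; linarith⟩
    · right
      rcases hu with h | h
      · refine ⟨_, _, h, ?_⟩
        filter_upwards [hA] with q hq
        rw [hq, mem_changeCoordinates_three, ← mem_tripod_iff_sub]
      · rw [cross_comm, neg_inj] at h
        refine ⟨_, _, h, ?_⟩
        filter_upwards [hA] with q hq
        rw [hq, mem_changeCoordinates_three, ← mem_tripod_iff_sub, tripod_swap]
  · rintro (⟨d, ⟨x, y, hxy⟩, h⟩ | ⟨d, d', hd, h⟩)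
    · have hu : IsUnit (Matrix.det !![d 0, -y; d 1, x]) := by
        rw [Matrix.det_fin_two_of, Int.isUnit_iff]; left; linarith
      refine ⟨_, Or.inl rfl, Matrix.GeneralLinearGroup.mk'' !![d 0, -y; d 1, x] hu, ?_⟩
      filter_upwards [h] with q hq
      rw [hq, mem_changeCoordinates_two]
      simp_rw [sub_eq_iff_eq_add']
      have : (fun i => (Matrix.GeneralLinearGroup.mk'' !![d 0, -y; d 1, x] hu).1 i 0) = d := by
        ext i; fin_cases i <;> rfl
      rw [this]
    · have hu : IsUnit (Matrix.det !![d 0, d' 0; d 1, d' 1]) := by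
        rw [Matrix.det_fin_two_of, Int.isUnit_iff]; left; simp only [cross] at hd; linarith
      refine ⟨_, Or.inr rfl, Matrix.GeneralLinearGroup.mk'' !![d 0, d' 0; d 1, d' 1] hu, ?_⟩
      filter_upwards [h] with q hq
      rw [hq, mem_changeCoordinates_three, mem_tripod_iff_sub]
      have h0 : (fun i => (Matrix.GeneralLinearGroup.mk'' !![d 0, d' 0; d 1, d' 1] hu).1 i 0)
          = d := by
        ext i; fin_cases i <;> rfl
      have h1 : (fun i => (Matrix.GeneralLinearGroup.mk'' !![d 0, d' 0; d 1, d' 1] hu).1 i 1)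
          = d' := by
        ext i; fin_cases i <;> rfl
      rw [h0, h1]

lemma eventually_add_smul {p : Plane} {P : Plane → Prop} (h : ∀ᶠ q in 𝓝 p, P q) (u : Plane) :
    ∀ᶠ t in 𝓝 (0 : ℝ), P (p + t • u) := by
  have hc : Filter.Tendsto (fun t : ℝ => p + t • u) (𝓝 0) (𝓝 p) := by
    have : Continuous fun t : ℝ => p + t • u := by fun_prop
    simpa using this.tendsto 0
  exact hc.eventually h

lemma exists_small_pos {P : ℝ → Prop} (h : ∀ᶠ t in 𝓝 (0 : ℝ), P t) {ε : ℝ} (hε : 0 < ε) :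
    ∃ t, 0 < t ∧ t < ε ∧ P t := by
  obtain ⟨r, hr, h⟩ := Metric.eventually_nhds_iff.1 h
  refine ⟨min r ε / 2, by positivity, ?_, h ?_⟩
  · linarith [min_le_right r ε, lt_min hr hε]
  · have := min_le_left r ε
    have := lt_min hr hε
    rw [Real.dist_eq, sub_zero, abs_of_pos (by linarith)]; linarith

lemma IsNodeAt.mem {C : Set Plane} {p : Plane} {a b : Fin 2 → ℤ} (h : IsNodeAt C p a b) : p ∈ C :=
  h.2.2.2.self_of_nhds.2 ⟨0, by simp⟩

/-- A cone with apex `p` which contains a line germ through `p` in direction `a`. -/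
lemma cross_eq_zero_of_line_germ {C : Set Plane} {p : Plane} {a d : Plane}
    (h : ∀ᶠ q in 𝓝 p, q ∈ C ↔ ∃ t : ℝ, q = p + t • d)
    (hl : ∀ᶠ t in 𝓝 (0 : ℝ), p + t • a ∈ C) : cross a d = 0 := by
  obtain ⟨t, ht, -, h1, h2⟩ := exists_small_pos ((eventually_add_smul h a).and hl) one_pos
  obtain ⟨s, hs⟩ := h1.1 h2
  have : t • a = s • d := by simpa using hs
  have h3 : t * cross a d = 0 := by
    rw [← cross_smul_left, this, cross_smul_left, cross_self, mul_zero]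
  rcases mul_eq_zero.1 h3 with h | h
  · exact absurd h ht.ne'
  · exact h

/-- In the basis `d`, `d'` the legs of a tripod are the multiples of (1, 0), (0, 1) and (-1, -1) by
nonnegative scalars. No nonzero vector lies on a leg together with its negative. -/
lemma not_line_germ_of_tripod {C : Set Plane} {p : Plane} {a : Plane} (ha : a ≠ 0)
    {d d' : Fin 2 → ℤ} (hd : cross d d' = 1)
    (h : ∀ᶠ q in 𝓝 p, q ∈ C ↔ q ∈ tripod p d d') :
    ¬ ∀ᶠ t in 𝓝 (0 : ℝ), p + t • a ∈ C := by
  intro hl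
  have hl' : ∀ᶠ t in 𝓝 (0 : ℝ), p + t • (-a) ∈ C := by
    have := (continuous_neg.tendsto (0 : ℝ)).eventually (by rw [neg_zero]; exact hl)
    filter_upwards [this] with t ht
    simpa using ht
  obtain ⟨t, ht, -, ⟨h1, h2⟩, h3, h4⟩ := exists_small_pos
    (((eventually_add_smul h a).and hl).and ((eventually_add_smul h (-a)).and hl')) one_pos
  obtain ⟨s, hs, h5⟩ := h1.1 h2
  obtain ⟨s', hs', h6⟩ := h3.1 h4
  have hd' : cross (toPlane d) (toPlane d') = 1 := by rw [cross_toPlane, hd]; simp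
  simp only [add_right_inj] at h5 h6
  have hta : t • a ≠ 0 := smul_ne_zero ht.ne' ha
  rw [smul_neg] at h6
  have c1 : cross (t • a) (toPlane d') ≤ 0 ∨ cross (toPlane d) (t • a) ≤ 0 := by
    rcases h5 with h5 | h5 | h5 <;> rw [h5]
    · right; simp [cross_smul_right]
    · left; simp [cross_smul_left]
    · left; rw [cross_smul_left, toPlane_neg, toPlane_add, cross_neg_left, cross_add_left, hd']
      simp; linarith
  have key : ∀ x y : ℝ, ∀ s s' : ℝ, 0 ≤ s → 0 ≤ s' →
      ((x = s ∧ y = 0) ∨ (x = 0 ∧ y = s) ∨ (x = -s ∧ y = -s)) →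
      ((-x = s' ∧ -y = 0) ∨ (-x = 0 ∧ -y = s') ∨ (-x = -s' ∧ -y = -s')) → x = 0 ∧ y = 0 := by
    rintro x y s s' h1 h2 (⟨h3, h4⟩ | ⟨h3, h4⟩ | ⟨h3, h4⟩) (⟨h5, h6⟩ | ⟨h5, h6⟩ | ⟨h5, h6⟩) <;>
      constructor <;> linarith
  have conv : ∀ (v : Plane) (s : ℝ), (v = s • toPlane d ∨ v = s • toPlane d' ∨
      v = s • toPlane (-(d + d'))) → ((cross v (toPlane d') = s ∧ cross (toPlane d) v = 0) ∨
      (cross v (toPlane d') = 0 ∧ cross (toPlane d) v = s) ∨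
      (cross v (toPlane d') = -s ∧ cross (toPlane d) v = -s)) := by
    rintro v s (rfl | rfl | rfl)
    · left; simp [cross_smul_left, cross_smul_right, hd']
    · right; left; simp [cross_smul_left, cross_smul_right, hd']
    · right; right
      simp [cross_smul_left, cross_smul_right, hd', toPlane_neg, toPlane_add, cross_neg_left,
        cross_neg_right, cross_add_left, cross_add_right]
  have h7 := conv _ _ h6
  rw [cross_neg_left, cross_neg_right] at h7
  obtain ⟨hx, hy⟩ := key _ _ s s' hs hs' (conv _ _ h5) h7
  apply hta
  have := cross_smul_eq (toPlane d) (toPlane d') (t • a)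
  rw [hd', hx, hy] at this
  simpa using this

lemma IsNodeAt.line_germ_left {C : Set Plane} {p : Plane} {a b : Fin 2 → ℤ}
    (h : IsNodeAt C p a b) : ∀ᶠ t in 𝓝 (0 : ℝ), p + t • toPlane a ∈ C := by
  filter_upwards [eventually_add_smul h.2.2.2 (toPlane a)] with t ht
  exact ht.2 ⟨t, Or.inl rfl⟩

lemma IsNodeAt.line_germ_right {C : Set Plane} {p : Plane} {a b : Fin 2 → ℤ}
    (h : IsNodeAt C p a b) : ∀ᶠ t in 𝓝 (0 : ℝ), p + t • toPlane b ∈ C := by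
  filter_upwards [eventually_add_smul h.2.2.2 (toPlane b)] with t ht
  exact ht.2 ⟨t, Or.inr rfl⟩

/-- A node contains two line germs of different directions. A line contains only one, and a tripod
none. -/
lemma IsNodeAt.not_isSmoothAt {C : Set Plane} {p : Plane} {a b : Fin 2 → ℤ}
    (h : IsNodeAt C p a b) : ¬ IsSmoothAt C p := by
  rw [isSmoothAt_iff]
  rintro (⟨d, hd, hC⟩ | ⟨d, d', hd, hC⟩)
  · have h1 := cross_eq_zero_of_line_germ hC h.line_germ_left
    have h2 := cross_eq_zero_of_line_germ hC h.line_germ_right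
    rw [cross_toPlane] at h1 h2
    have h1' := h.1.eq_or_neg hd (by exact_mod_cast h1)
    have h2' := h.2.1.eq_or_neg hd (by exact_mod_cast h2)
    apply h.2.2.1
    change cross a b = 0
    rcases h1' with rfl | rfl <;> rcases h2' with rfl | rfl <;>
      simp [cross_neg_left, cross_neg_right]
  · exact not_line_germ_of_tripod h.1.toPlane_ne_zero hd hC h.line_germ_left

lemma eq_smul_of_cross_eq_zero {u v : Plane} (hv : v ≠ 0) (h : cross u v = 0) :
    ∃ c : ℝ, u = c • v := by
  have : v 0 ≠ 0 ∨ v 1 ≠ 0 := by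
    by_contra hh; push Not at hh
    exact hv (by ext i; fin_cases i <;> simp [hh])
  simp only [cross] at h
  rcases this with h0 | h0
  · refine ⟨u 0 / v 0, ?_⟩
    ext i; fin_cases i <;> simp <;> field_simp
    linarith
  · refine ⟨u 1 / v 1, ?_⟩
    ext i; fin_cases i <;> simp <;> field_simp
    linarith

/-- At a smooth point, a direction either runs along the curve or meets
branches of the curve on both sides. -/
lemma IsSmoothAt.transversal {C : Set Plane} {p : Plane} (h : IsSmoothAt C p) {δ : Plane}
    (hδ : δ ≠ 0) : (∀ᶠ t in 𝓝 (0 : ℝ), p + t • δ ∈ C) ∨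
      ∃ a b, 0 < cross δ a ∧ cross δ b < 0 ∧
        (∀ᶠ t in 𝓝 (0 : ℝ), 0 ≤ t → p + t • a ∈ C) ∧
        ∀ᶠ t in 𝓝 (0 : ℝ), 0 ≤ t → p + t • b ∈ C := by
  rw [isSmoothAt_iff] at h
  rcases h with ⟨d, hd, hC⟩ | ⟨d, d', hd, hC⟩
  · have e1 : ∀ c : ℝ, ∀ᶠ t in 𝓝 (0 : ℝ), p + t • (c • toPlane d) ∈ C := fun c => by
      filter_upwards [eventually_add_smul hC (c • toPlane d)] with t ht
      exact ht.2 ⟨t * c, by rw [smul_smul]⟩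
    rcases lt_trichotomy (cross δ (toPlane d)) 0 with h0 | h0 | h0
    · right
      refine ⟨(-1 : ℝ) • toPlane d, (1 : ℝ) • toPlane d, ?_, ?_, ?_, ?_⟩
      · rw [cross_smul_right]; linarith
      · rw [cross_smul_right]; linarith
      · filter_upwards [e1 (-1)] with t ht _ using ht
      · filter_upwards [e1 1] with t ht _ using ht
    · left
      obtain ⟨c, rfl⟩ := eq_smul_of_cross_eq_zero hd.toPlane_ne_zero h0
      exact e1 c
    · right
      refine ⟨(1 : ℝ) • toPlane d, (-1 : ℝ) • toPlane d, ?_, ?_, ?_, ?_⟩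
      · rw [cross_smul_right]; linarith
      · rw [cross_smul_right]; linarith
      · filter_upwards [e1 1] with t ht _ using ht
      · filter_upwards [e1 (-1)] with t ht _ using ht
  · right
    have hd' : cross (toPlane d) (toPlane d') = 1 := by rw [cross_toPlane, hd]; simp
    have g1 : ∀ᶠ t in 𝓝 (0 : ℝ), 0 ≤ t → p + t • toPlane d ∈ C := by
      filter_upwards [eventually_add_smul hC (toPlane d)] with t ht h0
      exact ht.2 ⟨t, h0, Or.inl rfl⟩
    have g2 : ∀ᶠ t in 𝓝 (0 : ℝ), 0 ≤ t → p + t • toPlane d' ∈ C := by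
      filter_upwards [eventually_add_smul hC (toPlane d')] with t ht h0
      exact ht.2 ⟨t, h0, Or.inr (Or.inl rfl)⟩
    have g3 : ∀ᶠ t in 𝓝 (0 : ℝ), 0 ≤ t → p + t • toPlane (-(d + d')) ∈ C := by
      filter_upwards [eventually_add_smul hC (toPlane (-(d + d')))] with t ht h0
      exact ht.2 ⟨t, h0, Or.inr (Or.inr rfl)⟩
    -- The cross products of `δ` with the three legs add up to zero and do not all vanish, so both
    -- signs occur.
    have c3 : cross δ (toPlane (-(d + d'))) = -(cross δ (toPlane d) + cross δ (toPlane d')) := by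
      rw [toPlane_neg, toPlane_add, cross_neg_right, cross_add_right]
    have hne : ¬ (cross δ (toPlane d) = 0 ∧ cross δ (toPlane d') = 0) := by
      rintro ⟨h1, h2⟩
      apply hδ
      have := cross_smul_eq (toPlane d) (toPlane d') δ
      rw [hd', h2, cross_comm, h1] at this
      simpa using this
    set x := cross δ (toPlane d)
    set y := cross δ (toPlane d')
    have hpos : ∃ a, 0 < cross δ a ∧ ∀ᶠ t in 𝓝 (0 : ℝ), 0 ≤ t → p + t • a ∈ C := by
      by_cases h1 : 0 < x
      · exact ⟨_, h1, g1⟩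
      by_cases h2 : 0 < y
      · exact ⟨_, h2, g2⟩
      refine ⟨_, ?_, g3⟩
      rw [c3]
      by_contra h3
      exact hne ⟨by linarith, by linarith⟩
    have hneg : ∃ a, cross δ a < 0 ∧ ∀ᶠ t in 𝓝 (0 : ℝ), 0 ≤ t → p + t • a ∈ C := by
      by_cases h1 : x < 0
      · exact ⟨_, h1, g1⟩
      by_cases h2 : y < 0
      · exact ⟨_, h2, g2⟩
      refine ⟨_, ?_, g3⟩
      rw [c3]
      by_contra h3
      exact hne ⟨by linarith, by linarith⟩
    obtain ⟨a, ha, ha'⟩ := hpos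
    obtain ⟨b, hb, hb'⟩ := hneg
    exact ⟨a, b, ha, hb, ha', hb'⟩

/-! ### Visibility in the complement of a smooth curve. -/

/-- Two points see each other if the segment between them does not meet `C`. -/
def Vis (C : Set Plane) (x y : Plane) : Prop := ∀ z ∈ segment ℝ x y, z ∉ C

lemma Vis.symm {C : Set Plane} {x y : Plane} (h : Vis C x y) : Vis C y x := by
  intro z hz; rw [segment_symm] at hz; exact h z hz
lemma Vis.left_notMem {C : Set Plane} {x y : Plane} (h : Vis C x y) : x ∉ C :=
  h x (left_mem_segment ℝ x y)
lemma Vis.mono {C : Set Plane} {x y z w : Plane} (h : Vis C x y) (hz : z ∈ segment ℝ x y)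
    (hw : w ∈ segment ℝ x y) : Vis C z w :=
  fun v hv => h v ((convex_segment x y).segment_subset hz hw hv)
lemma vis_of_convex {C S : Set Plane} (hS : Convex ℝ S) (hd : ∀ z ∈ S, z ∉ C) {x y : Plane}
    (hx : x ∈ S) (hy : y ∈ S) : Vis C x y := fun z hz => hd z (hS.segment_subset hx hy hz)

lemma segment_eq_lineMap (x y : Plane) :
    segment ℝ x y = (fun t : ℝ => x + t • (y - x)) '' Set.Icc 0 1 := segment_eq_image' ℝ x y

/-- The segment is compact and avoids a closed set, hence so do the segments to nearby endpoints. -/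
lemma Vis.eventually {C : Set Plane} (hC : IsClosed C) {x y : Plane} (h : Vis C x y) :
    ∀ᶠ z in 𝓝 y, Vis C x z := by
  have : ∀ᶠ z in 𝓝 y, ∀ t ∈ Set.Icc (0 : ℝ) 1, x + t • (z - x) ∉ C := by
    apply isCompact_Icc.eventually_forall_of_forall_eventually
    intro t ht
    have hc : Continuous fun w : Plane × ℝ => x + w.2 • (w.1 - x) := by fun_prop
    have h1 : x + t • (y - x) ∉ C :=
      h _ (by rw [segment_eq_lineMap]; exact ⟨t, ht, rfl⟩)
    exact (hc.tendsto (y, t)).eventually (hC.isOpen_compl.mem_nhds h1)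
  filter_upwards [this] with z hz w hw
  rw [segment_eq_lineMap] at hw
  obtain ⟨t, ht, rfl⟩ := hw
  exact hz t ht

/-- A branch of `C` crossing the segment from `x` to `w` blocks the view of `x`
on one side of this segment. -/
lemma eventually_not_vis {C : Set Plane} {x w a : Plane} {τ : ℝ} (h0 : 0 < τ) (h1 : τ < 1)
    (ha : cross (w - x) a ≠ 0)
    (hg : ∀ᶠ t in 𝓝 (0 : ℝ), 0 ≤ t → x + τ • (w - x) + t • a ∈ C) :
    ∀ᶠ y in 𝓝 w, 0 ≤ τ * cross (w - x) (y - x) / cross (y - x) a → ¬ Vis C x y := by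
  have hcD : Continuous fun y : Plane => cross (y - x) a := by unfold cross; fun_prop
  have hcN : Continuous fun y : Plane => cross (w - x) (y - x) := by unfold cross; fun_prop
  have e0 : ∀ᶠ y in 𝓝 w, cross (y - x) a ≠ 0 := hcD.continuousAt.eventually_ne ha
  -- Cramer's rule locates the meeting point of the line of sight from `x` to `y` with the line of
  -- the branch. Its parameter along the branch tends to `0`, and its parameter along the line of
  -- sight tends to `τ`, which is inside `(0, 1)`.
  have ht : Filter.Tendsto (fun y : Plane => τ * cross (w - x) (y - x) / cross (y - x) a)
      (𝓝 w) (𝓝 0) := by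
    have : ContinuousAt (fun y : Plane => τ * cross (w - x) (y - x) / cross (y - x) a) w :=
      (continuousAt_const.mul hcN.continuousAt).div hcD.continuousAt ha
    simpa [ContinuousAt] using this
  have hl : Filter.Tendsto (fun y : Plane => τ * cross (w - x) a / cross (y - x) a)
      (𝓝 w) (𝓝 τ) := by
    have : ContinuousAt (fun y : Plane => τ * cross (w - x) a / cross (y - x) a) w :=
      continuousAt_const.div hcD.continuousAt ha
    simpa [ContinuousAt, ha] using this
  filter_upwards [e0, ht.eventually hg, hl.eventually (lt_mem_nhds h0),
    hl.eventually (gt_mem_nhds h1)] with y y0 y1 y2 y3 hpos hv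
  refine hv _ ?_ (y1 hpos)
  rw [segment_eq_lineMap]
  refine ⟨τ * cross (w - x) a / cross (y - x) a, ⟨y2.le, y3.le⟩, ?_⟩
  have := cross_smul_eq (y - x) a (w - x)
  have h2 : w - x = (cross (w - x) a / cross (y - x) a) • (y - x) -
      (cross (w - x) (y - x) / cross (y - x) a) • a := by
    calc w - x = (cross (y - x) a)⁻¹ • (cross (y - x) a • (w - x)) := by
          rw [smul_smul, inv_mul_cancel₀ y0, one_smul]
      _ = _ := by rw [this, cross_comm (y - x) (w - x)]; module
  have h3 : τ • (w - x) = τ • ((cross (w - x) a / cross (y - x) a) • (y - x) -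
      (cross (w - x) (y - x) / cross (y - x) a) • a) := congrArg (τ • ·) h2
  simp only
  rw [h3]
  module

/-- If `C` is smooth, visibility is transitive; so the components of the complement are convex. -/
lemma Vis.trans {C : Set Plane} (hC : IsClosed C) (hs : ∀ p ∈ C, IsSmoothAt C p) {x y z : Plane}
    (hxy : Vis C x y) (hyz : Vis C y z) : Vis C x z := by
  set w : ℝ → Plane := fun s => y + s • (z - y) with hw
  have hwc : Continuous w := by fun_prop
  have hwC : ∀ s ∈ Set.Icc (0 : ℝ) 1, w s ∉ C := fun s hs' =>
    hyz _ (by rw [segment_eq_lineMap]; exact ⟨s, hs', rfl⟩)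
  -- The target slides from `y` to `z`. The set of positions seen from `x` is open by
  -- `Vis.eventually`; smoothness is needed to show that it is closed.
  set S : Set ℝ := {s | Vis C x (w s)} with hS
  have hclosed : IsClosed (S ∩ Set.Icc 0 1) := by
    rw [← closure_subset_iff_isClosed]
    intro s₀ hs₀
    have hI : s₀ ∈ Set.Icc (0 : ℝ) 1 :=
      closure_minimal Set.inter_subset_right isClosed_Icc hs₀
    refine ⟨?_, hI⟩
    by_contra hnv
    -- At a limit position that is not seen, the line of sight is followed to its first point on the
    -- curve.
    set T : Set ℝ := {τ | x + τ • (w s₀ - x) ∈ C} ∩ Set.Icc 0 1 with hT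
    have hTc : IsCompact T :=
      isCompact_Icc.inter_left (hC.preimage (by fun_prop : Continuous fun τ : ℝ =>
        x + τ • (w s₀ - x)))
    have hTn : T.Nonempty := by
      simp only [hS, Vis, Set.mem_ofPred_eq, not_forall, not_not] at hnv
      obtain ⟨v, hv, hvC⟩ := hnv
      rw [segment_eq_lineMap] at hv
      obtain ⟨τ, hτ, rfl⟩ := hv
      exact ⟨τ, hvC, hτ⟩
    obtain ⟨τ, ⟨hτC, hτI⟩, hmin⟩ := hTc.exists_isLeast hTn
    simp only [Set.mem_ofPred_eq] at hτC
    have hτ0 : 0 < τ := by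
      rcases hτI.1.lt_or_eq with h | h
      · exact h
      · rw [← h] at hτC; simp at hτC; exact absurd hτC hxy.left_notMem
    have hτ1 : τ < 1 := by
      rcases hτI.2.lt_or_eq with h | h
      · exact h
      · rw [h] at hτC; simp at hτC; exact absurd hτC (hwC s₀ hI)
    have hδ : w s₀ - x ≠ 0 := by
      intro h; rw [h] at hτC; simp at hτC; exact hxy.left_notMem hτC
    -- A curve running along the line of sight would have been met earlier. Otherwise branches leave
    -- on both sides and hide all positions near `w s₀`, which contradicts the choice of `s₀` in the
    -- closure.
    rcases (hs _ hτC).transversal hδ with hl | ⟨a, b, ha, hb, hga, hgb⟩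
    · have hl' : ∀ᶠ t in 𝓝 (0 : ℝ), x + τ • (w s₀ - x) + (-t) • (w s₀ - x) ∈ C :=
        (continuous_neg.tendsto (0 : ℝ)).eventually (by rw [neg_zero]; exact hl)
      obtain ⟨t, ht0, ht1, ht⟩ := exists_small_pos hl' hτ0
      have : τ - t ∈ T := by
        refine ⟨?_, by linarith, by linarith⟩
        simp only [Set.mem_ofPred_eq]
        convert ht using 1
        module
      have := hmin this
      linarith
    · have ea := eventually_not_vis hτ0 hτ1 ha.ne' hga
      have eb := eventually_not_vis hτ0 hτ1 hb.ne hgb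
      have hcD : ∀ c : Plane, Continuous fun y : Plane => cross (y - x) c := fun c => by
        unfold cross; fun_prop
      have sa := (hcD a).continuousAt.eventually (lt_mem_nhds ha)
      have sb := (hcD b).continuousAt.eventually (gt_mem_nhds hb)
      have hev := hwc.continuousAt.eventually ((ea.and eb).and (sa.and sb))
      obtain ⟨s, ⟨⟨h1, h2⟩, h3, h4⟩, h5, -⟩ := mem_closure_iff_nhds.1 hs₀ _ hev
      rcases le_total 0 (cross (w s₀ - x) (w s - x)) with h | h
      · exact h1 (div_nonneg (mul_nonneg hτ0.le h) h3.le) h5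
      · exact h2 (div_nonneg_of_nonpos (mul_nonpos_of_nonneg_of_nonpos hτ0.le h) h4.le) h5
  have hsub := hclosed.Icc_subset_of_forall_mem_nhdsWithin (by simpa [hS, hw] using hxy)
    (fun s hs' => mem_nhdsWithin_of_mem_nhds
      (hwc.continuousAt.eventually (Vis.eventually hC hs'.1)))
  simpa [hS, hw] using hsub (Set.right_mem_Icc.2 zero_le_one)

end PlaneTropical

/-! ### The regions beside the edges and their arrangement around a vertex. -/

namespace PlaneTropical

lemma convex_cross_pos (d p : Plane) : Convex ℝ {q : Plane | 0 < cross d (q - p)} := by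
  have := convex_halfSpace_gt (𝕜 := ℝ) (f := fun q : Plane => cross d q)
    ⟨fun x y => cross_add_right d x y, fun c x => by simp [cross_smul_right]⟩ (cross d p)
  simpa only [cross_sub_right, sub_pos] using this

lemma convex_track (b d : Plane) (ℓ : ℝ) (fin : Bool) : Convex ℝ (track b d ℓ fin) := by
  rintro x ⟨s, hs, hs', rfl⟩ y ⟨t, ht, ht', rfl⟩ α β hα hβ hαβ
  have h1 : 0 < α ∨ 0 < β := by
    by_contra h; push Not at h; linarith
  refine ⟨α * s + β * t, ?_, fun h => ?_, ?_⟩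
  · rcases h1 with h1 | h1
    · have := mul_pos h1 hs; have := mul_nonneg hβ ht.le; linarith
    · have := mul_pos h1 ht; have := mul_nonneg hα hs.le; linarith
  · have e : ℓ = α * ℓ + β * ℓ := by rw [← add_mul, hαβ, one_mul]
    rcases h1 with h1 | h1
    · have := mul_lt_mul_of_pos_left (hs' h) h1
      have := mul_le_mul_of_nonneg_left (ht' h).le hβ; linarith
    · have := mul_lt_mul_of_pos_left (ht' h) h1
      have := mul_le_mul_of_nonneg_left (hs' h).le hα; linarith
  · have e : b = α • b + β • b := by rw [← add_smul, hαβ, one_smul]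
    nth_rewrite 3 [e]
    module

/-- A vector pointing to the left of `d`. -/
def rot (d : Plane) : Plane := ![-d 1, d 0]

lemma cross_rot_pos {d : Plane} (hd : d ≠ 0) : 0 < cross d (rot d) := by
  simp only [cross, rot, Matrix.cons_val_zero, Matrix.cons_val_one]
  by_contra h
  apply hd
  have h0 : d 0 = 0 := by nlinarith [sq_nonneg (d 0), sq_nonneg (d 1)]
  have h1 : d 1 = 0 := by nlinarith [sq_nonneg (d 0), sq_nonneg (d 1)]
  ext i; fin_cases i <;> simp [h0, h1]

/-- Supplies an actual test point immediately to the left: a small displacement along `rot d` stays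
in any neighbourhood. -/
lemma exists_cross_pos {d m : Plane} (hd : d ≠ 0) {P : Plane → Prop} (h : ∀ᶠ q in 𝓝 m, P q) :
    ∃ q, P q ∧ 0 < cross d (q - m) := by
  obtain ⟨t, ht, -, hP⟩ := exists_small_pos (eventually_add_smul h (rot d)) one_pos
  exact ⟨_, hP, by rw [add_sub_cancel_left, cross_smul_right]; exact mul_pos ht (cross_rot_pos hd)⟩

lemma continuous_cross_right (d p : Plane) : Continuous fun q : Plane => cross d (q - p) := by
  unfold cross; fun_prop

namespace Drawing

variable {V E : Type} (D : Drawing V E)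

lemma toPlane_vec_ne_zero (δ : E × Bool) : toPlane (D.vec δ) ≠ 0 :=
  (D.vec_prim δ).toPlane_ne_zero

lemma vec_eq_or (δ : E × Bool) : D.dir δ.1 = D.vec δ ∨ D.dir δ.1 = -D.vec δ := by
  obtain ⟨e, b⟩ := δ; cases b <;> simp [vec]

lemma cross_sub_of_mem_arc (δ : E × Bool) {m m' : Plane} (hm : m ∈ D.arc δ.1)
    (hm' : m' ∈ D.arc δ.1) : cross (toPlane (D.vec δ)) (m - m') = 0 := by
  obtain ⟨s, -, -, rfl⟩ := hm
  obtain ⟨t, -, -, rfl⟩ := hm'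
  rcases D.vec_eq_or δ with h | h <;> rw [h] <;>
    simp [cross_smul_right, cross_neg_right, toPlane_neg, cross_sub_right, cross_add_right]

lemma arc_nonempty (e : E) : (D.arc e).Nonempty :=
  ⟨_, D.len e / 2, half_pos (D.len_pos e), fun _ => half_lt_self (D.len_pos e), rfl⟩

/-- The region to the left of a dart: all points which see the points immediately to the left. -/
def left (δ : E × Bool) : Set Plane :=
  {y | ∃ m ∈ D.arc δ.1, ∀ᶠ q in 𝓝 m, 0 < cross (toPlane (D.vec δ)) (q - m) → Vis D.support y q}

variable [Finite V] [Finite E]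

/-- Points immediately to the left of an arc see each other. -/
lemma exists_vis_of_arc (δ : E × Bool) {m m' : Plane} (hm : m ∈ D.arc δ.1)
    (hm' : m' ∈ D.arc δ.1) : ∃ ρ > 0, ∀ q ∈ Metric.ball m ρ, ∀ q' ∈ Metric.ball m' ρ,
      0 < cross (toPlane (D.vec δ)) (q - m) → 0 < cross (toPlane (D.vec δ)) (q' - m') →
      Vis D.support q q' := by
  set d := toPlane (D.vec δ)
  have hseg : segment ℝ m m' ⊆ D.arc δ.1 := (convex_track _ _ _ _).segment_subset hm hm'
  -- Near the segment the curve stays on the line of the arc. A thin thickening cut by the open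
  -- half-plane on the left is therefore a convex set that avoids the curve.
  have hsub : segment ℝ m m' ⊆ interior {z | z ∈ D.support → cross d (z - m) = 0} := by
    intro z hz
    rw [mem_interior_iff_mem_nhds]
    filter_upwards [D.eventually_mem_support_of_mem_arc (hseg hz)] with q hq hqC
    obtain ⟨t, rfl⟩ := hq.1 hqC
    have h1 := D.cross_sub_of_mem_arc δ (hseg hz) hm
    have h2 : cross d (toPlane (D.dir δ.1)) = 0 := by
      rcases D.vec_eq_or δ with h | h <;> rw [h] <;> simp [d, toPlane_neg, cross_neg_right]
    rw [show z + t • toPlane (D.dir δ.1) - m = (z - m) + t • toPlane (D.dir δ.1) by module,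
      cross_add_right, cross_smul_right, h2]
    simpa using h1
  have hcomp : IsCompact (segment ℝ m m') := by
    rw [segment_eq_lineMap]
    exact isCompact_Icc.image (by fun_prop)
  obtain ⟨ρ, hρ, h⟩ := hcomp.exists_thickening_subset_open isOpen_interior hsub
  refine ⟨ρ, hρ, fun q hq q' hq' hc hc' => ?_⟩
  refine vis_of_convex (((convex_segment m m').thickening ρ).inter (convex_cross_pos d m))
    (fun z hz hzC => ?_) ⟨?_, hc⟩ ⟨?_, ?_⟩
  · have h3 := interior_subset (h hz.1) hzC
    exact hz.2.ne' h3
  · exact Metric.mem_thickening_iff.2 ⟨m, left_mem_segment ℝ m m', hq⟩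
  · exact Metric.mem_thickening_iff.2 ⟨m', right_mem_segment ℝ m m', hq'⟩
  · have h1 := D.cross_sub_of_mem_arc δ hm' hm
    change 0 < cross d (q' - m)
    rw [show q' - m = (q' - m') + (m' - m) by module, cross_add_right, h1, add_zero]
    exact hc'

lemma eventually_mem_left {δ : E × Bool} {m : Plane} (hm : m ∈ D.arc δ.1) :
    ∀ᶠ q in 𝓝 m, 0 < cross (toPlane (D.vec δ)) (q - m) → q ∈ D.left δ := by
  obtain ⟨ρ, hρ, h⟩ := D.exists_vis_of_arc δ hm hm
  filter_upwards [Metric.ball_mem_nhds m hρ] with q hq hc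
  refine ⟨m, hm, ?_⟩
  filter_upwards [Metric.ball_mem_nhds m hρ] with q' hq' hc'
  exact h q hq q' hq' hc hc'

lemma left_nonempty (δ : E × Bool) : (D.left δ).Nonempty := by
  obtain ⟨m, hm⟩ := D.arc_nonempty δ.1
  obtain ⟨q, h, hc⟩ := exists_cross_pos (D.toPlane_vec_ne_zero δ) (D.eventually_mem_left hm)
  exact ⟨q, h hc⟩

omit [Finite V] [Finite E] in
lemma notMem_support_of_mem_left {δ : E × Bool} {y : Plane} (hy : y ∈ D.left δ) :
    y ∉ D.support := by
  obtain ⟨m, hm, h⟩ := hy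
  obtain ⟨q, h, hc⟩ := exists_cross_pos (D.toPlane_vec_ne_zero δ) h
  exact (h hc).left_notMem

variable (hs : ∀ p ∈ D.support, IsSmoothAt D.support p)
include hs

lemma vis_trans {x y z : Plane} (h : Vis D.support x y) (h' : Vis D.support y z) :
    Vis D.support x z := Vis.trans D.isClosed_support hs h h'

/-- Points immediately to the left of one arc see one another, and visibility is transitive, so a
region is an entire visibility class. Convexity and openness of regions follow from this. -/
lemma left_eq {δ : E × Bool} {y : Plane} (hy : y ∈ D.left δ) :
    D.left δ = {z | Vis D.support y z} := by
  ext z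
  obtain ⟨m, hm, hmy⟩ := hy
  constructor
  · rintro ⟨m', hm', hmz⟩
    obtain ⟨ρ, hρ, h⟩ := D.exists_vis_of_arc δ hm hm'
    obtain ⟨q, ⟨h1, h2⟩, h3⟩ := exists_cross_pos (D.toPlane_vec_ne_zero δ)
      (hmy.and (Metric.ball_mem_nhds m hρ))
    obtain ⟨q', ⟨h1', h2'⟩, h3'⟩ := exists_cross_pos (D.toPlane_vec_ne_zero δ)
      (hmz.and (Metric.ball_mem_nhds m' hρ))
    exact D.vis_trans hs (h1 h3) (D.vis_trans hs (h q h2 q' h2' h3 h3') (h1' h3').symm)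
  · intro h
    refine ⟨m, hm, ?_⟩
    filter_upwards [hmy] with q hq hc
    exact D.vis_trans hs (Vis.symm h) (hq hc)

lemma vis_of_mem_left {δ : E × Bool} {y z : Plane} (hy : y ∈ D.left δ) (hz : z ∈ D.left δ) :
    Vis D.support y z := by
  rw [D.left_eq hs hy] at hz; exact hz

lemma mem_left_of_vis {δ : E × Bool} {y z : Plane} (hy : y ∈ D.left δ)
    (h : Vis D.support y z) : z ∈ D.left δ := by
  rw [D.left_eq hs hy]; exact h

lemma left_eq_of_mem {δ δ' : E × Bool} {y : Plane} (hy : y ∈ D.left δ) (hy' : y ∈ D.left δ') :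
    D.left δ = D.left δ' := by
  rw [D.left_eq hs hy, D.left_eq hs hy']

lemma convex_left (δ : E × Bool) : Convex ℝ (D.left δ) := by
  rw [convex_iff_segment_subset]
  intro x hx y hy z hz
  exact D.mem_left_of_vis hs hx
    ((D.vis_of_mem_left hs hx hy).mono (left_mem_segment ℝ x y) hz)

lemma isOpen_left (δ : E × Bool) : IsOpen (D.left δ) := by
  rw [isOpen_iff_mem_nhds]
  intro y hy
  filter_upwards [(D.vis_of_mem_left hs hy hy).eventually D.isClosed_support] with z hz
  exact D.mem_left_of_vis hs hy hz

/-- A point of the region on or behind the line of the arc could be pushed strictly behind it, the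
region being open. From there the points immediately to the left of `m` that lie opposite to it are
hidden by `m`. -/
lemma left_cross_pos {δ : E × Bool} {y m : Plane} (hy : y ∈ D.left δ) (hm : m ∈ D.arc δ.1) :
    0 < cross (toPlane (D.vec δ)) (y - m) := by
  set d := toPlane (D.vec δ) with hd
  by_contra hle
  push Not at hle
  obtain ⟨ε, hε, -, hy'⟩ := exists_small_pos
    (eventually_add_smul ((D.isOpen_left hs δ).mem_nhds hy) (-rot d)) one_pos
  have hneg : cross d (y + ε • (-rot d) - m) < 0 := by
    rw [show y + ε • (-rot d) - m = (y - m) - ε • rot d by module, cross_sub_right,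
      cross_smul_right]
    have := mul_pos hε (cross_rot_pos (D.toPlane_vec_ne_zero δ))
    linarith
  set y' := y + ε • (-rot d)
  obtain ⟨t, ht, -, hq⟩ := exists_small_pos
    (eventually_add_smul (D.eventually_mem_left hm) (-(y' - m))) one_pos
  have hq' := hq (by
    rw [add_sub_cancel_left, cross_smul_right, cross_neg_right]
    exact mul_pos ht (by linarith))
  refine D.vis_of_mem_left hs hy' hq' m ?_ (D.arc_subset _ hm)
  rw [segment_eq_lineMap]
  -- The segment ends at `m - t • (y' - m)`, so it passes through `m` at the parameter `1 / (1 +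
  -- t)`.
  refine ⟨1 / (1 + t), ⟨by positivity, by rw [div_le_one (by positivity)]; linarith⟩, ?_⟩
  have h1 : (1 : ℝ) + t ≠ 0 := by positivity
  have h2 : (1 / (1 + t)) • (m + t • (-(y' - m)) - y') = m - y' := by
    rw [show m + t • (-(y' - m)) - y' = (1 + t) • (m - y') by module, smul_smul,
      one_div_mul_cancel h1, one_smul]
  simp only [h2]
  module

lemma disjoint_left_rev (δ : E × Bool) : Disjoint (D.left δ) (D.left (rev δ)) := by
  rw [Set.disjoint_left]
  intro y hy hy'
  obtain ⟨m, hm⟩ := D.arc_nonempty δ.1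
  have h1 := D.left_cross_pos hs hy hm
  have h2 := D.left_cross_pos hs hy' (m := m) hm
  rw [vec_rev, toPlane_neg, cross_neg_left] at h2
  linarith

lemma left_ne_left_rev (δ : E × Bool) : D.left δ ≠ D.left (rev δ) := by
  intro h
  obtain ⟨y, hy⟩ := D.left_nonempty δ
  exact Set.disjoint_left.1 (D.disjoint_left_rev hs δ) hy (h ▸ hy)

/-- The sector swept counterclockwise from `δ` to `δ'` has angle at most π, so it is convex, and
near the vertex it avoids the curve. It lies immediately to the left of `δ` and immediately to the
right of `δ'`, hence in both regions. -/
lemma left_eq_left_rev {δ δ' : E × Bool} {v : V} (hδ : D.src δ = some v) (hδ' : D.src δ' = some v)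
    (hc : 0 < cross (D.vec δ) (D.vec δ') ∨ D.vec δ' = -D.vec δ)
    (hsec : ∀ᶠ q in 𝓝 (D.pos v), 0 < cross (toPlane (D.vec δ)) (q - D.pos v) →
      0 < cross (q - D.pos v) (toPlane (D.vec δ')) → q ∉ D.support) :
    D.left δ = D.left (rev δ') := by
  set p := D.pos v
  set d := toPlane (D.vec δ) with hd
  set d' := toPlane (D.vec δ') with hd'
  have hdd : d' = -d ∨ 0 < cross d d' := by
    rcases hc with h | h
    · right; rw [cross_toPlane]; exact_mod_cast h
    · left; rw [hd', h, toPlane_neg]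
  obtain ⟨ρ, hρ, hball⟩ := Metric.eventually_nhds_iff_ball.1 hsec
  set S : Set Plane := Metric.ball p ρ ∩ ({q | 0 < cross d (q - p)} ∩ {q | 0 < cross (-d') (q - p)})
    with hS
  have hSc : Convex ℝ S :=
    (convex_ball p ρ).inter ((convex_cross_pos d p).inter (convex_cross_pos (-d') p))
  have hSn : ∀ z ∈ S, z ∉ D.support := fun z hz =>
    hball z hz.1 hz.2.1 (by rw [cross_comm, ← cross_neg_left]; exact hz.2.2)
  obtain ⟨t, ht, ht', hb, hb'⟩ := exists_small_pos (ε := min (D.len δ.1) (D.len δ'.1))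
    ((eventually_add_smul (Metric.ball_mem_nhds p hρ) d).and
      (eventually_add_smul (Metric.ball_mem_nhds p hρ) d')) (lt_min (D.len_pos _) (D.len_pos _))
  have hm : p + t • d ∈ D.arc δ.1 := D.mem_arc_of_small hδ ht (ht'.trans_le (min_le_left _ _))
  have hm' : p + t • d' ∈ D.arc (rev δ').1 :=
    D.mem_arc_of_small hδ' ht (ht'.trans_le (min_le_right _ _))
  have hnear : ∀ᶠ q in 𝓝 (p + t • d), 0 < cross d (q - (p + t • d)) → q ∈ S := by
    have hq2 : ∀ᶠ q in 𝓝 (p + t • d), 0 < cross d (q - (p + t • d)) →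
        0 < cross (-d') (q - p) := by
      rcases hdd with h | h
      · refine .of_forall fun q hq => ?_
        rw [h, neg_neg, show q - p = (q - (p + t • d)) + t • d by module, cross_add_right,
          cross_smul_right]
        simpa using hq
      · have : 0 < cross (-d') (p + t • d - p) := by
          rw [add_sub_cancel_left, cross_smul_right, cross_neg_left, ← cross_comm]
          exact mul_pos ht h
        filter_upwards [(continuous_cross_right (-d') p).continuousAt.eventually
          (lt_mem_nhds this)] with q hq _ using hq
    filter_upwards [Metric.isOpen_ball.mem_nhds hb, hq2] with q hq hq2 hc
    refine ⟨hq, ?_, hq2 hc⟩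
    change 0 < cross d (q - p)
    rw [show q - p = (q - (p + t • d)) + t • d by module, cross_add_right, cross_smul_right]
    simpa using hc
  have hnear' : ∀ᶠ q in 𝓝 (p + t • d'), 0 < cross (-d') (q - (p + t • d')) → q ∈ S := by
    have hq2 : ∀ᶠ q in 𝓝 (p + t • d'), 0 < cross (-d') (q - (p + t • d')) →
        0 < cross d (q - p) := by
      rcases hdd with h | h
      · refine .of_forall fun q hq => ?_
        rw [show d = -d' by rw [h, neg_neg],
          show q - p = (q - (p + t • d')) + t • d' by module, cross_add_right,
          cross_smul_right]
        simpa [cross_neg_left] using hq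
      · have : 0 < cross d (p + t • d' - p) := by
          rw [add_sub_cancel_left, cross_smul_right]
          exact mul_pos ht h
        filter_upwards [(continuous_cross_right d p).continuousAt.eventually
          (lt_mem_nhds this)] with q hq _ using hq
    filter_upwards [Metric.isOpen_ball.mem_nhds hb', hq2] with q hq hq2 hc
    refine ⟨hq, hq2 hc, ?_⟩
    change 0 < cross (-d') (q - p)
    rw [show q - p = (q - (p + t • d')) + t • d' by module, cross_add_right, cross_smul_right]
    simpa [cross_neg_left] using hc
  obtain ⟨s, h1, h2⟩ := exists_cross_pos (D.toPlane_vec_ne_zero δ) hnear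
  have hsS := h1 h2
  refine D.left_eq_of_mem hs (y := s) ⟨_, hm, ?_⟩ ⟨_, hm', ?_⟩
  · filter_upwards [hnear] with q hq hc
    exact vis_of_convex hSc hSn hsS (hq hc)
  · filter_upwards [hnear'] with q hq hc
    rw [vec_rev, toPlane_neg] at hc
    exact vis_of_convex hSc hSn hsS (hq hc)

-- Two darts from one vertex in the same direction have overlapping arcs, so they belong to the same
-- edge; their orientations agree because a primitive vector differs from its negative.
omit [Finite V] [Finite E] hs in
lemma dart_eq {δ δ' : E × Bool} {v : V} (h : D.src δ = some v) (h' : D.src δ' = some v)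
    (hv : D.vec δ = D.vec δ') : δ = δ' := by
  have hl := lt_min (D.len_pos δ.1) (D.len_pos δ'.1)
  have hm := D.mem_arc_of_small h (half_pos hl) ((half_lt_self hl).trans_le (min_le_left _ _))
  have hm' := D.mem_arc_of_small h' (half_pos hl) ((half_lt_self hl).trans_le (min_le_right _ _))
  rw [hv] at hm
  have he := D.arc_eq_of_mem hm hm'
  obtain ⟨e, b⟩ := δ
  obtain ⟨e', b'⟩ := δ'
  obtain rfl : e = e' := he
  have hne : D.dir e ≠ -D.dir e := fun h => (D.prim e).ne_zero (self_eq_neg.1 h)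
  cases b <;> cases b'
  · rfl
  · exact absurd hv.symm (by simpa [vec] using hne)
  · exact absurd hv (by simpa [vec] using hne)
  · rfl

variable (hinj : Function.Injective D.pos)
include hinj

-- Points of the germ close to the vertex lie on rays of darts leaving this position. Injectivity of
-- `pos` identifies the source and primitivity identifies the vector.
omit hs in
lemma exists_dart_of_germ {v : V} {d : Fin 2 → ℤ} (hd : IsPrimitive d)
    (h : ∀ᶠ t in 𝓝 (0 : ℝ), 0 ≤ t → D.pos v + t • toPlane d ∈ D.support) :
    ∃ δ, D.src δ = some v ∧ D.vec δ = d := by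
  obtain ⟨t, ht, -, h1, h2⟩ := exists_small_pos
    (h.and (eventually_add_smul (D.eventually_mem_support_pos v) (toPlane d))) one_pos
  rcases h2.1 (h1 ht.le) with h3 | ⟨δ, w, hδ, hw, s, hs, h3⟩
  · exfalso
    simp only [add_eq_left, smul_eq_zero] at h3
    rcases h3 with h3 | h3
    · exact ht.ne' h3
    · exact hd.toPlane_ne_zero h3
  · rw [add_right_inj] at h3
    refine ⟨δ, by rw [hδ, hinj hw], ((hd.eq_of_smul (D.vec_prim δ) ht hs h3)).symm⟩

omit [Finite V] [Finite E] hs hinj in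
lemma exists_pos_mem_support {δ : E × Bool} {v : V} (h : D.src δ = some v) {P : Plane → Prop}
    (hP : ∀ᶠ q in 𝓝 (D.pos v), P q) :
    ∃ t : ℝ, 0 < t ∧ D.pos v + t • toPlane (D.vec δ) ∈ D.support ∧
      P (D.pos v + t • toPlane (D.vec δ)) := by
  obtain ⟨t, ht, ht', h1⟩ := exists_small_pos
    (eventually_add_smul hP (toPlane (D.vec δ))) (D.len_pos δ.1)
  exact ⟨t, ht, D.arc_subset _ (D.mem_arc_of_small h ht ht'), h1⟩

omit [Finite V] [Finite E] hs hinj in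
lemma tripod_rotate (p : Plane) (d d' : Fin 2 → ℤ) :
    tripod p d d' = tripod p d' (-(d + d')) := by
  ext q
  simp only [tripod, Set.mem_ofPred_eq]
  have : -(d' + -(d + d')) = d := by abel
  rw [this]
  constructor <;> rintro ⟨t, ht, h | h | h⟩ <;> exact ⟨t, ht, by tauto⟩

omit [Finite V] [Finite E] hs hinj in
lemma tripod_rotate' (p : Plane) (d d' : Fin 2 → ℤ) :
    tripod p d d' = tripod p (-(d + d')) d := by
  rw [tripod_rotate p d d', tripod_rotate p d' _]
  congr 1; abel

omit hinj in
lemma left_eq_of_tripod {v : V} {δ δ' : E × Bool} (hδ : D.src δ = some v)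
    (hδ' : D.src δ' = some v) (hc : cross (D.vec δ) (D.vec δ') = 1)
    (hC : ∀ᶠ q in 𝓝 (D.pos v), q ∈ D.support ↔ q ∈ tripod (D.pos v) (D.vec δ) (D.vec δ')) :
    D.left δ = D.left (rev δ') := by
  apply D.left_eq_left_rev hs hδ hδ' (Or.inl (by rw [hc]; exact one_pos))
  have hc' : cross (toPlane (D.vec δ)) (toPlane (D.vec δ')) = 1 := by
    rw [cross_toPlane, hc]; simp
  filter_upwards [hC] with q hq h1 h2 hqC
  obtain ⟨t, ht, h | h | h⟩ := hq.1 hqC <;> rw [h, add_sub_cancel_left] at h1 h2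
  · simp [cross_smul_right] at h1
  · simp [cross_smul_left] at h2
  · rw [cross_smul_right, toPlane_neg, toPlane_add, cross_neg_right, cross_add_right, hc'] at h1
    simp at h1; linarith

/-- The local structure of a smooth drawing at a vertex. -/
theorem vertex_structure {v : V} {δ : E × Bool} (hδ : D.src δ = some v) :
    ∃ δ', D.src δ' = some v ∧ D.left δ = D.left (rev δ') ∧
      ((D.vec δ' = -D.vec δ ∧ D.left δ' = D.left (rev δ) ∧
          ∀ ε, D.src ε = some v → ε = δ ∨ ε = δ') ∨
        (cross (D.vec δ) (D.vec δ') = 1 ∧ ∃ δ'', D.src δ'' = some v ∧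
          D.vec δ'' = -(D.vec δ + D.vec δ') ∧ D.left δ' = D.left (rev δ'') ∧
          D.left δ'' = D.left (rev δ) ∧
          ∀ ε, D.src ε = some v → ε = δ ∨ ε = δ' ∨ ε = δ'')) := by
  have hsm := hs _ (D.pos_mem v)
  rw [isSmoothAt_iff] at hsm
  rcases hsm with ⟨d, hd, hC⟩ | ⟨d, d', hd, hC⟩
  · have hex : ∀ c : ℝ, ∀ᶠ t in 𝓝 (0 : ℝ), 0 ≤ t → D.pos v + t • (c • toPlane d) ∈ D.support :=
      fun c => by
        filter_upwards [eventually_add_smul hC (c • toPlane d)] with t ht _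
        exact ht.2 ⟨t * c, by rw [smul_smul]⟩
    -- The beginning of a dart lies in the local model, which leaves only the model's own primitive
    -- directions.
    have hdir : ∀ ε, D.src ε = some v → D.vec ε = d ∨ D.vec ε = -d := by
      intro ε hε
      obtain ⟨t, ht, h1, h2⟩ := D.exists_pos_mem_support hε hC
      obtain ⟨s, hs'⟩ := h2.1 h1
      rw [add_right_inj] at hs'
      apply (D.vec_prim ε).eq_or_neg hd
      have : t * cross (toPlane (D.vec ε)) (toPlane d) = 0 := by
        rw [← cross_smul_left, hs', cross_smul_left, cross_self, mul_zero]
      rw [cross_toPlane] at this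
      rcases mul_eq_zero.1 this with h | h
      · exact absurd h ht.ne'
      · exact_mod_cast h
    obtain ⟨δ', hδ', hv⟩ : ∃ δ', D.src δ' = some v ∧ D.vec δ' = -D.vec δ := by
      apply D.exists_dart_of_germ hinj (D.vec_prim δ).neg
      rcases hdir δ hδ with h | h <;> rw [h]
      · filter_upwards [hex (-1)] with t ht
        simpa [toPlane_neg] using ht
      · filter_upwards [hex 1] with t ht
        simpa [toPlane_neg] using ht
    have hline : ∀ u, (u = d ∨ u = -d) → ∀ᶠ q in 𝓝 (D.pos v),
        0 < cross (toPlane u) (q - D.pos v) → q ∉ D.support := by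
      intro u hu
      filter_upwards [hC] with q hq hc hqC
      obtain ⟨t, rfl⟩ := hq.1 hqC
      rw [add_sub_cancel_left, cross_smul_right] at hc
      rcases hu with rfl | rfl <;> simp [toPlane_neg, cross_neg_left] at hc
    refine ⟨δ', hδ', ?_, Or.inl ⟨hv, ?_, fun ε hε => ?_⟩⟩
    · apply D.left_eq_left_rev hs hδ hδ' (Or.inr hv)
      filter_upwards [hline _ (hdir δ hδ)] with q hq h1 _ using hq h1
    · apply D.left_eq_left_rev hs hδ' hδ (Or.inr (by rw [hv, neg_neg]))
      filter_upwards [hline _ (hdir δ' hδ')] with q hq h1 _ using hq h1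
    · rcases hdir ε hε with h | h <;> rcases hdir δ hδ with h' | h'
      · exact Or.inl (D.dart_eq hε hδ (by rw [h, h']))
      · exact Or.inr (D.dart_eq hε hδ' (by rw [h, hv, h', neg_neg]))
      · exact Or.inr (D.dart_eq hε hδ' (by rw [h, hv, h']))
      · exact Or.inl (D.dart_eq hε hδ (by rw [h, h']))
  · have hdir : ∀ ε, D.src ε = some v → D.vec ε = d ∨ D.vec ε = d' ∨ D.vec ε = -(d + d') := by
      intro ε hε
      obtain ⟨t, ht, h1, h2⟩ := D.exists_pos_mem_support hε hC
      obtain ⟨s, hs0, hs'⟩ := h2.1 h1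
      simp only [add_right_inj] at hs'
      have hspos : 0 < s := by
        rcases hs0.lt_or_eq with h | h
        · exact h
        · exfalso
          rw [← h] at hs'
          simp only [zero_smul, or_self, smul_eq_zero] at hs'
          rcases hs' with h | h
          · exact ht.ne' h
          · exact D.toPlane_vec_ne_zero ε h
      have hp : ∀ x y x' y' : ℤ, ∀ u : Fin 2 → ℤ, u 0 * y - u 1 * x = 1 → IsPrimitive u :=
        fun x y _ _ u h => ⟨y, -x, by linarith⟩
      simp only [cross] at hd
      rcases hs' with h | h | h
      · exact Or.inl ((D.vec_prim ε).eq_of_smul (hp (d' 0) (d' 1) 0 0 d hd) ht hspos h)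
      · exact Or.inr (Or.inl ((D.vec_prim ε).eq_of_smul
          (hp (-d 0) (-d 1) 0 0 d' (by linarith)) ht hspos h))
      · exact Or.inr (Or.inr ((D.vec_prim ε).eq_of_smul
          (hp (d 0) (d 1) 0 0 _ (by simp; linarith)) ht hspos h))
    -- rotate the tripod so that the first leg is the given dart
    obtain ⟨u, u', hu, hC, hvu, hdir⟩ : ∃ u u', cross u u' = 1 ∧
        (∀ᶠ q in 𝓝 (D.pos v), q ∈ D.support ↔ q ∈ tripod (D.pos v) u u') ∧ D.vec δ = u ∧
        ∀ ε, D.src ε = some v → D.vec ε = u ∨ D.vec ε = u' ∨ D.vec ε = -(u + u') := by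
      have e1 : cross d' (-(d + d')) = 1 := by
        rw [cross_neg_right, cross_add_right, cross_self, cross_comm, hd]; simp
      have e2 : cross (-(d + d')) d = 1 := by
        rw [cross_neg_left, cross_add_left, cross_self, cross_comm, hd]; simp
      have r1 : -(d' + -(d + d')) = d := by abel
      have r2 : -(-(d + d') + d) = d' := by abel
      rcases hdir δ hδ with h | h | h
      · exact ⟨d, d', hd, hC, h, hdir⟩
      · refine ⟨d', -(d + d'), e1, by rwa [← tripod_rotate], h, fun ε hε => ?_⟩
        rw [r1]; rcases hdir ε hε with h | h | h <;> tauto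
      · refine ⟨-(d + d'), d, e2, ?_, h, fun ε hε => ?_⟩
        · rwa [← tripod_rotate']
        · rw [r2]; rcases hdir ε hε with h | h | h <;> tauto
    subst hvu
    have g : ∀ a a' : Fin 2 → ℤ, cross a a' = 1 → (∀ᶠ q in 𝓝 (D.pos v), q ∈ D.support ↔
        q ∈ tripod (D.pos v) a a') → ∃ ε, D.src ε = some v ∧ D.vec ε = a := by
      intro a a' ha h
      apply D.exists_dart_of_germ hinj
      · simp only [cross] at ha; exact ⟨a' 1, -a' 0, by linarith⟩
      · filter_upwards [eventually_add_smul h (toPlane a)] with t ht h0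
        exact ht.2 ⟨t, h0, Or.inl rfl⟩
    have hC' : ∀ᶠ q in 𝓝 (D.pos v), q ∈ D.support ↔
        q ∈ tripod (D.pos v) u' (-(D.vec δ + u')) := by rwa [← tripod_rotate]
    have r1 : -(u' + -(D.vec δ + u')) = D.vec δ := by abel
    have hC'' : ∀ᶠ q in 𝓝 (D.pos v), q ∈ D.support ↔
        q ∈ tripod (D.pos v) (-(D.vec δ + u')) (D.vec δ) := by
      rwa [← tripod_rotate']
    have e1 : cross u' (-(D.vec δ + u')) = 1 := by
      rw [cross_neg_right, cross_add_right, cross_self, cross_comm, hu]; simp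
    have e2 : cross (-(D.vec δ + u')) (D.vec δ) = 1 := by
      rw [cross_neg_left, cross_add_left, cross_self, cross_comm, hu]; simp
    obtain ⟨δ', hδ', hv'⟩ := g _ _ e1 hC'
    obtain ⟨δ'', hδ'', hv''⟩ := g _ _ e2 hC''
    subst hv'
    refine ⟨δ', hδ', D.left_eq_of_tripod hs hδ hδ' hu hC, Or.inr ⟨hu, δ'', hδ'', hv'',
      D.left_eq_of_tripod hs hδ' hδ'' (by rw [hv'']; exact e1) (by rw [hv'']; exact hC'),
      D.left_eq_of_tripod hs hδ'' hδ (by rw [hv'']; exact e2) (by rw [hv'']; exact hC''),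
      fun ε hε => ?_⟩⟩
    rcases hdir ε hε with h | h | h
    · exact Or.inl (D.dart_eq hε hδ h)
    · exact Or.inr (Or.inl (D.dart_eq hε hδ' h))
    · exact Or.inr (Or.inr (D.dart_eq hε hδ'' (by rw [h, hv''])))

end Drawing

end PlaneTropical

/-! ### Recession directions and flows. -/

namespace PlaneTropical

/-- `r` is a recession direction of `U`. -/
def IsRec (U : Set Plane) (r : Plane) : Prop := r ≠ 0 ∧ ∀ y ∈ U, ∀ t : ℝ, 0 ≤ t → y + t • r ∈ U

/-- An unbounded open convex set has a recession direction. -/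
lemma exists_isRec {U : Set Plane} (ho : IsOpen U) (hc : Convex ℝ U)
    (hb : ¬ Bornology.IsBounded U) : ∃ r, IsRec U r := by
  have hy : ∀ n : ℕ, ∃ y ∈ U, (n + 1 : ℝ) < ‖y‖ := by
    intro n
    by_contra h
    push Not at h
    exact hb (isBounded_iff_forall_norm_le.2 ⟨n + 1, h⟩)
  choose y hyU hyn using hy
  have hpos : ∀ n, 0 < ‖y n‖ := fun n => lt_trans (by positivity) (hyn n)
  -- The direction is a limit of normalised points of the set that escape to infinity.
  obtain ⟨r, hr, φ, hφ, hlim⟩ := (isCompact_sphere (0 : Plane) 1).tendsto_subseq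
    (x := fun n => ‖y n‖⁻¹ • y n) (fun n => by
      simp [norm_smul, inv_mul_cancel₀ (hpos n).ne'])
  have hinv : Filter.Tendsto (fun n => ‖y (φ n)‖⁻¹) Filter.atTop (𝓝 0) := by
    apply tendsto_inv_atTop_zero.comp
    refine Filter.tendsto_atTop_mono (fun n => ?_) tendsto_natCast_atTop_atTop
    have h1 : (n : ℝ) ≤ φ n := by exact_mod_cast hφ.le_apply
    linarith [hyn (φ n)]
  -- Convex combinations of `z` with the escaping points, of weight `t / ‖y‖` on the latter,
  -- converge to `z + t • r`.
  have hcl : ∀ z ∈ U, ∀ t : ℝ, 0 ≤ t → z + t • r ∈ closure U := by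
    intro z hz t ht
    have h1 : Filter.Tendsto (fun n => z + (t • (‖y (φ n)‖⁻¹ • y (φ n)) -
        (t * ‖y (φ n)‖⁻¹) • z)) Filter.atTop (𝓝 (z + (t • r - (t * 0) • z))) :=
      tendsto_const_nhds.add ((hlim.const_smul t).sub ((hinv.const_mul t).smul_const z))
    rw [mul_zero, zero_smul, sub_zero] at h1
    refine mem_closure_of_tendsto h1 ?_
    have h2 : ∀ᶠ n in Filter.atTop, t * ‖y (φ n)‖⁻¹ < 1 :=
      (hinv.const_mul t).eventually (gt_mem_nhds (by simp))
    filter_upwards [h2] with n hn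
    have h3 := hc hz (hyU (φ n)) (a := 1 - t * ‖y (φ n)‖⁻¹) (b := t * ‖y (φ n)‖⁻¹)
      (by linarith) (by have := hpos (φ n); positivity) (by ring)
    convert h3 using 1
    module
  refine ⟨r, ?_, fun z hz t ht => ?_⟩
  · rintro rfl; simp at hr
  · rcases ht.eq_or_lt with rfl | ht
    · simpa using hz
    -- The point is the midpoint of the interior point `z` and the closure point `z + (2 * t) • r`,
    -- hence interior.
    · apply interior_subset
      apply hc.openSegment_interior_closure_subset_interior (ho.interior_eq.symm ▸ hz)
        (hcl z hz (2 * t) (by positivity))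
      rw [openSegment_eq_image']
      exact ⟨1 / 2, by norm_num, by module⟩

/-- The value of a function on edges at a dart: it changes sign when the orientation does. -/
def dval {E : Type} (ω : E → ℝ) (δ : E × Bool) : ℝ := if δ.2 then ω δ.1 else -ω δ.1

namespace Drawing

variable {V E : Type} (D : Drawing V E)

lemma exists_src_eq_of_mem_segment {e : E} {w : V} (h : D.head e = some w) {z : Plane}
    (hz : z ∈ segment ℝ (D.pos (D.tail e)) (D.pos w)) :
    z = D.pos (D.tail e) ∨ z = D.pos w ∨ z ∈ D.arc e := by
  rw [segment_eq_lineMap] at hz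
  obtain ⟨t, ⟨h0, h1⟩, rfl⟩ := hz
  rcases h0.eq_or_lt with rfl | h0
  · left; simp
  rcases h1.eq_or_lt with rfl | h1
  · right; left; simp
  right; right
  have hl := D.len_pos e
  refine ⟨t * D.len e, by positivity, fun _ => by nlinarith, ?_⟩
  rw [D.pos_head e w h]
  simp only
  module

section Flow
variable [Fintype E]

open Classical in
/-- A flow on a drawing: it vanishes on rays and is conserved at every vertex. -/
def IsFlow (ω : E → ℝ) : Prop :=
  (∀ e, D.head e = none → ω e = 0) ∧
    ∀ v, ∑ δ : E × Bool, (if D.src δ = some v then dval ω δ else 0) = 0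

variable {D}

/-- Summation by parts. A missing head contributes `0`, since the dart from infinity has no source
in `V`. -/
lemma IsFlow.sum_mul [Finite V] {ω : E → ℝ} (h : D.IsFlow ω) (σ : V → ℝ) :
    ∑ e, ω e * (σ (D.tail e) - (D.head e).elim 0 σ) = 0 := by
  classical
  have := Fintype.ofFinite V
  have h1 : ∑ v, σ v * ∑ δ : E × Bool, (if D.src δ = some v then dval ω δ else 0) = 0 := by
    apply Finset.sum_eq_zero
    intro v _
    exact mul_eq_zero_of_right _ (by convert h.2 v)
  simp_rw [Finset.mul_sum] at h1
  rw [Finset.sum_comm, Fintype.sum_prod_type] at h1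
  refine Eq.trans (Finset.sum_congr rfl fun e _ => ?_) h1
  have h2 : ∀ δ : E × Bool, (∑ v, σ v * (if D.src δ = some v then dval ω δ else 0)) =
      (D.src δ).elim 0 σ * dval ω δ := by
    intro δ
    cases hδ : D.src δ with
    | none => simp
    | some w => simp
  simp_rw [h2]
  simp [src, dval]
  ring

/-- The flow is paired with the indicator function of `S`; only `e` can contribute. -/
lemma IsFlow.eq_zero_of_cut [Finite V] {ω : E → ℝ} (h : D.IsFlow ω) {e : E} (S : Set V)
    (hS : ∀ e' w, e' ≠ e → D.head e' = some w → (D.tail e' ∈ S ↔ w ∈ S))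
    (he : ∀ w, D.head e = some w → ¬ (D.tail e ∈ S ↔ w ∈ S)) : ω e = 0 := by
  classical
  cases hh : D.head e with
  | none => exact h.1 e hh
  | some w =>
    have h1 := h.sum_mul (fun v => if v ∈ S then 1 else 0)
    rw [Finset.sum_eq_single e] at h1
    · have h2 := he w hh
      rw [hh] at h1
      by_cases ht : D.tail e ∈ S <;> by_cases hw : w ∈ S <;> simp_all
    · intro e' _ hne
      cases hh' : D.head e' with
      | none => rw [h.1 e' hh', zero_mul]
      | some w' =>
        have h2 := hS e' w' hne hh'
        by_cases ht : D.tail e' ∈ S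
        · simp [ht, h2.1 ht]
        · have hw' : w' ∉ S := fun h => ht (h2.2 h)
          simp [ht, hw']
    · simp
end Flow

variable [Finite V] [Finite E]

lemma arc_subset_closure_left (δ : E × Bool) : D.arc δ.1 ⊆ closure (D.left δ) := by
  intro m hm
  rw [mem_closure_iff_nhds]
  intro t ht
  obtain ⟨q, ⟨h1, h2⟩, h3⟩ := exists_cross_pos (D.toPlane_vec_ne_zero δ)
    ((D.eventually_mem_left hm).and ht)
  exact ⟨q, h2, h1 h3⟩

lemma pos_mem_closure_left {δ : E × Bool} {v : V} (h : D.src δ = some v) :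
    D.pos v ∈ closure (D.left δ) := by
  refine closure_minimal (D.arc_subset_closure_left δ) isClosed_closure ?_
  rw [mem_closure_iff_nhds]
  intro t ht
  obtain ⟨s, hs, hs', h1⟩ := exists_small_pos
    (eventually_add_smul (p := D.pos v) ht (toPlane (D.vec δ))) (D.len_pos δ.1)
  exact ⟨_, h1, D.mem_arc_of_small h hs hs'⟩

/-- A ray is unbounded and lies in the closure of the region beside it. -/
lemma not_isBounded_left_of_ray {δ : E × Bool} (h : D.head δ.1 = none) :
    ¬ Bornology.IsBounded (D.left δ) := by
  intro hb
  have hb' := hb.closure.subset (D.arc_subset_closure_left δ)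
  obtain ⟨R, hR⟩ := isBounded_iff_forall_norm_le.1 hb'
  set p := D.pos (D.tail δ.1)
  set d := toPlane (D.dir δ.1)
  have hd : 0 < ‖d‖ := norm_pos_iff.2 (D.prim δ.1).toPlane_ne_zero
  have hR0 : 0 ≤ |R| + ‖p‖ + 1 := by positivity
  have := hR (p + ((|R| + ‖p‖ + 1) / ‖d‖) • d) ⟨_, by positivity, by simp [h], rfl⟩
  have h2 : ‖((|R| + ‖p‖ + 1) / ‖d‖) • d‖ = |R| + ‖p‖ + 1 := by
    rw [norm_smul, Real.norm_of_nonneg (by positivity), div_mul_cancel₀ _ hd.ne']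
  have h3 := norm_sub_le (p + ((|R| + ‖p‖ + 1) / ‖d‖) • d) p
  rw [add_sub_cancel_left, h2] at h3
  linarith [le_abs_self R]

variable (hs : ∀ p ∈ D.support, IsSmoothAt D.support p)
include hs

lemma exists_isRec_left {δ : E × Bool} (h : ¬ Bornology.IsBounded (D.left δ)) :
    ∃ r, IsRec (D.left δ) r :=
  exists_isRec (D.isOpen_left hs δ) (D.convex_left hs δ) h

/-- Moving towards the right of the edge would eventually cross its line, against `left_cross_pos`.
-/
lemma cross_isRec_nonneg {δ : E × Bool} {r : Plane} (h : IsRec (D.left δ) r) :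
    0 ≤ cross (toPlane (D.vec δ)) r := by
  by_contra hneg
  push Not at hneg
  obtain ⟨y, hy⟩ := D.left_nonempty δ
  obtain ⟨m, hm⟩ := D.arc_nonempty δ.1
  set d := toPlane (D.vec δ)
  have h0 := D.left_cross_pos hs hy hm
  have h1 := D.left_cross_pos hs (h.2 y hy (cross d (y - m) / -cross d r)
    (div_nonneg h0.le (by linarith))) hm
  rw [show y + (cross d (y - m) / -cross d r) • r - m =
    (y - m) + (cross d (y - m) / -cross d r) • r by module, cross_add_right,
    cross_smul_right] at h1
  have : cross d (y - m) / -cross d r * cross d r = -cross d (y - m) := by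
    rw [div_neg, neg_mul, div_mul_cancel₀ _ hneg.ne]
  change 0 < cross d (y - m) + cross d (y - m) / -cross d r * cross d r at h1
  linarith

lemma cross_nonneg_of_mem_closure {δ : E × Bool} {z : Plane} (hz : z ∈ closure (D.left δ))
    {m : Plane} (hm : m ∈ closure (D.arc δ.1)) : 0 ≤ cross (toPlane (D.vec δ)) (z - m) := by
  have h1 : ∀ m ∈ D.arc δ.1, 0 ≤ cross (toPlane (D.vec δ)) (z - m) := by
    intro m hm
    have hcl : IsClosed {z : Plane | 0 ≤ cross (toPlane (D.vec δ)) (z - m)} :=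
      isClosed_le continuous_const (continuous_cross_right _ _)
    exact closure_minimal (fun y hy => (D.left_cross_pos hs hy hm).le) hcl hz
  have hcl : IsClosed {m : Plane | 0 ≤ cross (toPlane (D.vec δ)) (z - m)} :=
    isClosed_le continuous_const (by unfold cross; fun_prop)
  exact closure_minimal h1 hcl hm

/-- The half-line from a point `m` of an arc along the arc lies in the curve
if the region next to the arc recedes in this direction. -/
lemma add_smul_mem_support {δ : E × Bool} {r m : Plane} (hr : IsRec (D.left δ) r)
    (hc : cross (toPlane (D.vec δ)) r = 0) (hm : m ∈ D.arc δ.1) {s : ℝ} (h0 : 0 ≤ s) :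
    m + s • r ∈ D.support := by
  -- If the point were off the curve, translating region points close to `m` by `s • r` would give
  -- region points that see it. It would then belong to the region although it lies on the line of
  -- the arc.
  by_contra hz
  have hvis : Vis D.support (m + s • r) (m + s • r) := by
    intro z hz'
    rw [segment_same] at hz'
    rw [hz']; exact hz
  have hev := hvis.eventually D.isClosed_support
  have hc' : Filter.Tendsto (fun y : Plane => y + s • r) (𝓝 m) (𝓝 (m + s • r)) :=
    (by fun_prop : Continuous fun y : Plane => y + s • r).tendsto m
  obtain ⟨y, h1, h2⟩ := mem_closure_iff_nhds.1 (D.arc_subset_closure_left δ hm) _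
    (hc'.eventually hev)
  have h3 := D.mem_left_of_vis hs (hr.2 y h2 s h0) (Vis.symm h1)
  have h4 := D.left_cross_pos hs h3 hm
  rw [add_sub_cancel_left, cross_smul_right, hc, mul_zero] at h4
  exact lt_irrefl _ h4

/-- Here the curve contains the whole half-line from `m` in direction `r`. At a vertex on it beyond
`m` the curve contains a line germ, so there is no tripod and every edge there runs along the
half-line. The vertices beyond `m` are therefore joined to the others only by the edge of `m`. -/
lemma flow_eq_zero_of_parallel [Fintype E] {ω : E → ℝ} (hω : D.IsFlow ω) {δ : E × Bool}
    {r : Plane} (hr : IsRec (D.left δ) r) (hc : cross (toPlane (D.vec δ)) r = 0) :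
    ω δ.1 = 0 := by
  obtain ⟨m, hm⟩ := D.arc_nonempty δ.1
  have hrd : ∀ ε : E × Bool, cross (toPlane (D.vec ε)) r = 0 →
      ∃ k : ℝ, toPlane (D.vec ε) = k • r := fun ε h => eq_smul_of_cross_eq_zero hr.1 h
  set H : Set V := {v | ∃ s : ℝ, 0 < s ∧ D.pos v = m + s • r} with hH
  have hstep : ∀ (ε : E × Bool) (v w : V), ε.1 ≠ δ.1 → D.src ε = some v →
      D.src (rev ε) = some w → v ∈ H → w ∈ H := by
    rintro ε v w hne hv hw ⟨s, hs0, hsv⟩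
    have hgerm : ∀ᶠ t in 𝓝 (0 : ℝ), D.pos v + t • r ∈ D.support := by
      filter_upwards [lt_mem_nhds (show -s < (0 : ℝ) by linarith)] with t ht
      rw [hsv, add_assoc, ← add_smul]
      exact D.add_smul_mem_support hs hr hc hm (by linarith)
    have hpar : cross (toPlane (D.vec ε)) r = 0 := by
      rcases (isSmoothAt_iff _ _).1 (hs _ (D.pos_mem v)) with ⟨d, hd, hC⟩ | ⟨d, d', hd, hC⟩
      · have h1 := cross_eq_zero_of_line_germ hC hgerm
        obtain ⟨t, ht, h2, h3⟩ := D.exists_pos_mem_support hv hC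
        obtain ⟨t', ht'⟩ := h3.1 h2
        rw [add_right_inj] at ht'
        obtain ⟨k, hk⟩ := eq_smul_of_cross_eq_zero hd.toPlane_ne_zero h1
        have h4 : t * cross (toPlane (D.vec ε)) r = 0 := by
          rw [← cross_smul_left, ht', hk]; simp [cross_smul_left, cross_smul_right]
        exact (mul_eq_zero.1 h4).resolve_left ht.ne'
      · exact absurd hgerm (not_line_germ_of_tripod hr.1 hd hC)
    obtain ⟨k, hk⟩ := hrd ε hpar
    have hpw := D.pos_target hv hw
    by_cases hp : 0 < s + D.len ε.1 * k
    · exact ⟨_, hp, by rw [hpw, hk, hsv]; module⟩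
    -- An edge leading back to `m` or past it would make `m` a vertex or a point of a second arc.
    · exfalso
      push Not at hp
      have hl := D.len_pos ε.1
      have hk0 : k < 0 := by by_contra h; push Not at h; nlinarith
      have hm' : m = D.pos v + (s / -k) • toPlane (D.vec ε) := by
        rw [hsv, hk, smul_smul, show s / -k * k = -s by
          rw [div_neg, neg_mul, div_mul_cancel₀ _ hk0.ne]]; module
      have ht : s / -k ≤ D.len ε.1 := by
        rw [div_le_iff₀ (by linarith)]; linarith
      rcases ht.lt_or_eq with h | h
      · exact hne (D.arc_eq_of_mem (hm' ▸ D.mem_arc_of_small hv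
          (div_pos hs0 (by linarith)) h) hm)
      · rw [h, ← hpw] at hm'
        exact D.pos_notMem_arc w δ.1 (hm' ▸ hm)
  apply hω.eq_zero_of_cut H
  · intro e' w hne hw
    exact ⟨hstep (e', true) _ _ hne (by simp [src]) (by simpa [src, rev] using hw),
      hstep (e', false) _ _ hne (by simpa [src] using hw) (by simp [src, rev])⟩
  · intro w hw
    obtain ⟨k, hk⟩ := hrd (δ.1, true) (by
      rcases D.vec_eq_or δ with h | h
      · rw [show D.vec (δ.1, true) = D.dir δ.1 from rfl, h]; exact hc
      · rw [show D.vec (δ.1, true) = D.dir δ.1 from rfl, h, toPlane_neg, cross_neg_left, hc,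
          neg_zero])
    have hk' : toPlane (D.dir δ.1) = k • r := by simpa [vec] using hk
    obtain ⟨t, ht0, ht1, hmt⟩ := hm
    have ht1 := ht1 (by simp [hw])
    have huniq : ∀ a b : ℝ, m + a • r = m + b • r → a = b := fun a b h => by
      rw [add_right_inj] at h
      exact smul_left_injective ℝ hr.1 h
    have htail : D.pos (D.tail δ.1) = m + (-t * k) • r := by
      rw [hmt, hk']; module
    have hhead : D.pos w = m + ((D.len δ.1 - t) * k) • r := by
      rw [D.pos_head _ w hw, htail, hk']; module
    have h1 : D.tail δ.1 ∈ H ↔ 0 < -t * k :=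
      ⟨fun ⟨a, ha, h⟩ => huniq _ _ (htail.symm.trans h) ▸ ha, fun h => ⟨_, h, htail⟩⟩
    have h2 : w ∈ H ↔ 0 < (D.len δ.1 - t) * k :=
      ⟨fun ⟨a, ha, h⟩ => huniq _ _ (hhead.symm.trans h) ▸ ha, fun h => ⟨_, h, hhead⟩⟩
    have hk0 : k ≠ 0 := by
      rintro rfl; exact (D.prim δ.1).toPlane_ne_zero (by rw [hk']; simp)
    rw [h1, h2]
    have hl : 0 < D.len δ.1 - t := by linarith
    rcases lt_or_gt_of_ne hk0 with h | h
    · have a1 : 0 < -t * k := by nlinarith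
      have a2 : ¬ 0 < (D.len δ.1 - t) * k := by nlinarith
      tauto
    · have a1 : ¬ 0 < -t * k := by nlinarith
      have a2 : 0 < (D.len δ.1 - t) * k := by positivity
      tauto

-- One recession ray on each side of the edge, both starting at `m`, form a bent line which meets
-- the curve only in `m`. Any other edge stays on one side of it, so the bent line defines a cut
-- through `e` alone.
omit hs in
lemma flow_eq_zero_of_wedge [Fintype E] {ω : E → ℝ} (hω : D.IsFlow ω) {e : E}
    {r r' : Plane} (hr : IsRec (D.left (e, true)) r) (hr' : IsRec (D.left (e, false)) r')
    (hc : 0 < cross (toPlane (D.dir e)) r) (hc' : cross (toPlane (D.dir e)) r' < 0) :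
    ω e = 0 := by
  obtain ⟨m, hm⟩ := D.arc_nonempty e
  set d := toPlane (D.dir e) with hd
  have hd0 : d ≠ 0 := (D.prim e).toPlane_ne_zero
  have hdd : 0 < d 0 ^ 2 + d 1 ^ 2 := by
    have := cross_rot_pos hd0
    simp [cross, rot] at this
    nlinarith
  obtain ⟨lam, hlam, ladd, lsmul, hl1⟩ : ∃ lam : Plane → ℝ, Continuous lam ∧
      (∀ u v, lam (u - v) = lam u - lam v) ∧ (∀ (c : ℝ) u, lam (c • u) = c * lam u) ∧
      lam d = 1 := by
    refine ⟨fun u => (u 0 * d 0 + u 1 * d 1) / (d 0 ^ 2 + d 1 ^ 2), by fun_prop, ?_, ?_, ?_⟩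
    · intro u v; simp; ring
    · intro c u; simp; ring
    · simp only; field_simp
  have hzero : ∀ u : Plane, cross d u = 0 → lam u = 0 → u = 0 := by
    intro u h1 h2
    obtain ⟨c, rfl⟩ := eq_smul_of_cross_eq_zero hd0 (u := u) (by rw [cross_comm, h1, neg_zero])
    rw [lsmul, hl1, mul_one] at h2
    rw [h2, zero_smul]
  -- The ray enters the region immediately after `m`, and recession keeps it there.
  have hray : ∀ (b : Bool) (ρ : Plane), IsRec (D.left (e, b)) ρ →
      0 < cross (toPlane (D.vec (e, b))) ρ → ∀ t : ℝ, 0 < t → m + t • ρ ∉ D.support := by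
    intro b ρ hρ hcρ t ht
    obtain ⟨ε, hε, hε', h1⟩ := exists_small_pos
      (eventually_add_smul (D.eventually_mem_left (δ := (e, b)) hm) ρ) ht
    have h2 := hρ.2 _ (h1 (by
      rw [add_sub_cancel_left, cross_smul_right]; exact mul_pos hε hcρ)) (t - ε) (by linarith)
    rw [add_assoc, ← add_smul, show ε + (t - ε) = t by ring] at h2
    exact D.notMem_support_of_mem_left h2
  set X : Plane → ℝ := fun q => cross d (q - m) with hX
  have hXc : Continuous X := continuous_cross_right d m
  -- The displacement from the bent line measured along `d`: the two quotients are the slopes of its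
  -- two halves. Its sign tells the sides apart, and it restricts to the parameter on the line of
  -- `e`.
  set g : Plane → ℝ := fun q => lam (q - m) - lam r / cross d r * max (X q) 0 -
    lam r' / cross d r' * min (X q) 0 with hg
  have hgc : Continuous g := by
    have : Continuous fun q : Plane => lam (q - m) := hlam.comp (by fun_prop)
    fun_prop
  have hg0 : ∀ q ∈ D.support, g q = 0 → q = m := by
    intro q hq h0
    simp only [hg] at h0
    rcases lt_trichotomy (X q) 0 with h | h | h
    · exfalso
      rw [max_eq_right h.le, min_eq_left h.le, mul_zero, sub_zero] at h0
      have : q - m - (X q / cross d r') • r' = 0 := by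
        apply hzero
        · rw [cross_sub_right, cross_smul_right, div_mul_cancel₀ _ hc'.ne]; simp [hX]
        · rw [ladd, lsmul, ← h0]; ring
      refine hray false r' hr' (by simp [vec, toPlane_neg, cross_neg_left, ← hd, hc'])
        (X q / cross d r') (div_pos_of_neg_of_neg h hc') ?_
      rwa [← sub_eq_zero.1 this, add_sub_cancel]
    · rw [h] at h0
      simp only [max_self, min_self, mul_zero, sub_zero] at h0
      exact sub_eq_zero.1 (hzero _ h h0)
    · exfalso
      rw [max_eq_left h.le, min_eq_right h.le, mul_zero, sub_zero] at h0
      have : q - m - (X q / cross d r) • r = 0 := by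
        apply hzero
        · rw [cross_sub_right, cross_smul_right, div_mul_cancel₀ _ hc.ne']; simp [hX]
        · rw [ladd, lsmul, ← h0]; ring
      refine hray true r hr (by simpa [vec] using hc) (X q / cross d r) (div_pos h hc) ?_
      rwa [← sub_eq_zero.1 this, add_sub_cancel]
  have hgl : ∀ c : ℝ, g (m + c • d) = c := by
    intro c
    simp [hg, hX, lsmul, hl1, cross_smul_right]
  apply hω.eq_zero_of_cut {v | 0 < g (D.pos v)}
  · intro e' w hne hw
    have hnz : ∀ z ∈ segment ℝ (D.pos (D.tail e')) (D.pos w), g z ≠ 0 := by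
      intro z hz h0
      rcases D.exists_src_eq_of_mem_segment hw hz with h | h | h
      · have := hg0 z (h ▸ D.pos_mem _) h0
        exact D.pos_notMem_arc (D.tail e') e (by rw [← h, this]; exact hm)
      · have := hg0 z (h ▸ D.pos_mem _) h0
        exact D.pos_notMem_arc w e (by rw [← h, this]; exact hm)
      · have := hg0 z (D.arc_subset _ h) h0
        exact hne (D.arc_eq_of_mem h (this ▸ hm))
    have hpc := (convex_segment (𝕜 := ℝ) (D.pos (D.tail e')) (D.pos w)).isPreconnected
    have hl := left_mem_segment ℝ (D.pos (D.tail e')) (D.pos w)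
    have hr := right_mem_segment ℝ (D.pos (D.tail e')) (D.pos w)
    simp only [Set.mem_ofPred_eq]
    constructor <;> intro h <;> by_contra hcon <;> push Not at hcon
    · obtain ⟨z, hz, hz0⟩ := hpc.intermediate_value hr hl hgc.continuousOn ⟨hcon, h.le⟩
      exact hnz z hz hz0
    · obtain ⟨z, hz, hz0⟩ := hpc.intermediate_value hl hr hgc.continuousOn ⟨hcon, h.le⟩
      exact hnz z hz hz0
  · intro w hw
    obtain ⟨t, ht0, ht1, hmt⟩ := id hm
    have ht1 := ht1 (by simp [hw])
    have htail : D.pos (D.tail e) = m + (-t) • d := by rw [hmt, ← hd]; module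
    have hhead : D.pos w = m + (D.len e - t) • d := by
      rw [D.pos_head _ w hw, htail, ← hd]; module
    simp only [Set.mem_ofPred_eq, htail, hhead, hgl]
    intro h
    have := h.2 (by linarith)
    linarith

/-- If both regions next to an edge are unbounded, then no flow passes through the edge. -/
theorem flow_eq_zero [Fintype E] {ω : E → ℝ} (hω : D.IsFlow ω) {e : E}
    (h : ∀ b, ¬ Bornology.IsBounded (D.left (e, b))) : ω e = 0 := by
  obtain ⟨r, hr⟩ := D.exists_isRec_left hs (h true)
  obtain ⟨r', hr'⟩ := D.exists_isRec_left hs (h false)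
  have h1 := D.cross_isRec_nonneg hs hr
  have h2 := D.cross_isRec_nonneg hs hr'
  rcases h1.eq_or_lt with h1 | h1
  · exact D.flow_eq_zero_of_parallel hs hω hr h1.symm
  rcases h2.eq_or_lt with h2 | h2
  · exact D.flow_eq_zero_of_parallel hs hω hr' h2.symm
  refine D.flow_eq_zero_of_wedge hω hr hr' (by simpa [vec] using h1) ?_
  simp [vec, toPlane_neg, cross_neg_left] at h2
  exact h2

open Classical in
/-- The boundary flow of a region. -/
noncomputable def boundary (U : Set Plane) (e : E) : ℝ :=
  (if D.left (e, true) = U then 1 else 0) - (if D.left (e, false) = U then 1 else 0)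

end Drawing

end PlaneTropical

/-! ### Theta data, boundary flows and faces. -/

namespace PlaneTropical
namespace Drawing

variable {V E : Type} (D : Drawing V E)

lemma dval_boundary [Finite V] [Finite E] (U : Set Plane) (δ : E × Bool) [Decidable (D.left δ = U)]
    [Decidable (D.left (rev δ) = U)] : dval (D.boundary U) δ =
      (if D.left δ = U then 1 else 0) - (if D.left (rev δ) = U then 1 else 0) := by
  obtain ⟨e, b⟩ := δ
  cases b <;> simp [dval, boundary, rev]

variable [Fintype E]

/-- The flows on the drawing are those of a theta graph: the edges which carry flow fall into three
classes of total length `L`, and only at two vertices do different classes meet. -/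
structure ThetaData (L : ℝ) where
  cls : E → Option (Fin 3)
  sgn : E → ℝ
  sgn_eq : ∀ e, sgn e = 1 ∨ sgn e = -1
  flow_iff : ∀ ω, D.IsFlow ω ↔
    ∃ x : Fin 3 → ℝ, x 0 + x 1 + x 2 = 0 ∧ ∀ e, ω e = sgn e * (cls e).elim 0 x
  len_sum : ∀ i, ∑ e, (if cls e = some i then D.len e else 0) = L
  P : V
  Q : V
  uniform : ∀ v δ δ' i j, D.src δ = some v → D.src δ' = some v →
    cls δ.1 = some i → cls δ'.1 = some j → i ≠ j → v = P ∨ v = Q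

variable [Finite V]

section
variable (hs : ∀ p ∈ D.support, IsSmoothAt D.support p) (hinj : Function.Injective D.pos)
include hs hinj

/-- A ray borders only unbounded regions. Around a vertex the region to the left of one dart is the
region to the right of the next, so the indicator terms cancel cyclically. -/
lemma isFlow_boundary {U : Set Plane} (hb : Bornology.IsBounded U) : D.IsFlow (D.boundary U) := by
  classical
  constructor
  · intro e he
    have h : ∀ b, D.left (e, b) ≠ U := fun b h =>
      D.not_isBounded_left_of_ray (δ := (e, b)) he (h ▸ hb)
    simp [boundary, h]
  · intro v
    by_cases hv : ∃ δ, D.src δ = some v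
    swap
    · push Not at hv
      simp [hv]
    obtain ⟨δ, hδ⟩ := hv
    obtain ⟨δ', hδ', h1, h | h⟩ := D.vertex_structure hs hinj hδ
    · obtain ⟨hv, h2, hall⟩ := h
      have hne : δ ≠ δ' := by
        rintro rfl
        exact (D.vec_prim δ).ne_zero (self_eq_neg.1 hv)
      have hf : Finset.univ.filter (fun ε => D.src ε = some v) = {δ, δ'} := by
        ext ε
        simp only [Finset.mem_filter, Finset.mem_univ, true_and, Finset.mem_insert,
          Finset.mem_singleton]
        exact ⟨hall ε, by rintro (rfl | rfl) <;> assumption⟩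
      rw [← Finset.sum_filter]
      convert_to ∑ a ∈ {δ, δ'}, dval (D.boundary U) a = 0
      · rw [← hf]
      rw [Finset.sum_pair hne, dval_boundary, dval_boundary, h1, h2]
      ring
    · obtain ⟨hc, δ'', hδ'', hv, h2, h3, hall⟩ := h
      have hne : δ ≠ δ' := by rintro rfl; simp at hc
      have hne' : δ ≠ δ'' := by
        rintro rfl
        have : cross (D.vec δ) (D.vec δ) = -1 := by
          nth_rewrite 2 [hv]
          rw [cross_neg_right, cross_add_right, cross_self, hc]; rfl
        simp at this
      have hne'' : δ' ≠ δ'' := by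
        rintro rfl
        have : cross (D.vec δ') (D.vec δ') = 1 := by
          nth_rewrite 2 [hv]
          rw [cross_neg_right, cross_add_right, cross_self, cross_comm, hc]; rfl
        simp at this
      have hf : Finset.univ.filter (fun ε => D.src ε = some v) = {δ, δ', δ''} := by
        ext ε
        simp only [Finset.mem_filter, Finset.mem_univ, true_and, Finset.mem_insert,
          Finset.mem_singleton]
        exact ⟨hall ε, by rintro (rfl | rfl | rfl) <;> assumption⟩
      rw [← Finset.sum_filter]
      convert_to ∑ a ∈ {δ, δ', δ''}, dval (D.boundary U) a = 0
      · rw [← hf]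
      rw [Finset.sum_insert (by simp [hne, hne']), Finset.sum_pair hne'', dval_boundary,
        dval_boundary, dval_boundary, h1, h2, h3]
      ring

-- Around a vertex, `vertex_structure` identifies the left region of every other dart with the right
-- region of `α` or conversely, so a coincidence would equate the two sides of one edge.
omit [Fintype E] in
lemma dart_eq_of_left_eq [Finite E] {v : V} {α β : E × Bool} (hα : D.src α = some v)
    (hβ : D.src β = some v) (h : D.left α = D.left β) : α = β := by
  obtain ⟨δ', -, h1, ⟨-, -, hall⟩ | ⟨-, δ'', -, -, h2, h3, hall⟩⟩ := D.vertex_structure hs hinj hα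
  · rcases hall β hβ with rfl | rfl
    · rfl
    · exact absurd (h.symm.trans h1) (D.left_ne_left_rev hs _)
  · rcases hall β hβ with rfl | rfl | rfl
    · rfl
    · exact absurd (h.symm.trans h1) (D.left_ne_left_rev hs _)
    · exact absurd (h.trans h3) (D.left_ne_left_rev hs _)

omit [Fintype E] in
lemma dart_eq_of_left_rev_eq [Finite E] {v : V} {α β : E × Bool} (hα : D.src α = some v)
    (hβ : D.src β = some v) (h : D.left (rev α) = D.left (rev β)) : α = β := by
  obtain ⟨δ', -, h1, ⟨-, -, hall⟩ | ⟨-, δ'', -, -, h2, h3, hall⟩⟩ := D.vertex_structure hs hinj hα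
  · rcases hall β hβ with rfl | rfl
    · rfl
    · exact absurd (h1.trans h.symm) (D.left_ne_left_rev hs _)
  · rcases hall β hβ with rfl | rfl | rfl
    · rfl
    · exact absurd (h1.trans h.symm) (D.left_ne_left_rev hs _)
    · exact absurd (h3.trans h) (D.left_ne_left_rev hs _)

omit [Fintype E] in
/-- The next dart along the boundary of the region to the right of a dart. -/
lemma exists_next [Finite E] {v : V} {ε : E × Bool} (hε : D.src (rev ε) = some v) :
    ∃ ε', D.src ε' = some v ∧ D.left (rev ε') = D.left (rev ε) ∧
      ((D.vec ε' = D.vec ε ∧ D.left ε' = D.left ε) ∨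
        (cross (D.vec ε) (D.vec ε') = -1 ∧ ∃ g, D.src g = some v ∧
          D.vec g = D.vec ε - D.vec ε' ∧ D.left g = D.left ε ∧ D.left (rev g) = D.left ε')) := by
  obtain ⟨δ', hδ', h1, ⟨hv, h2, -⟩ | ⟨hc, g, hg, hv, h2, h3, -⟩⟩ := D.vertex_structure hs hinj hε
  · exact ⟨δ', hδ', h1.symm, Or.inl ⟨by simpa using hv, by simpa using h2⟩⟩
  · refine ⟨δ', hδ', h1.symm, Or.inr ⟨?_, g, hg, ?_, by simpa using h3, h2.symm⟩⟩
    · rw [vec_rev, cross_neg_left] at hc; linarith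
    · rw [hv, vec_rev]; abel

end

namespace ThetaData

variable {D} {L : ℝ} (T : D.ThetaData L)

omit [Finite V] in
lemma sgn_ne (e : E) : T.sgn e ≠ 0 := by
  rcases T.sgn_eq e with h | h <;> rw [h] <;> norm_num

omit [Finite V] in
lemma exists_cls (hL : 0 < L) (i : Fin 3) : ∃ e, T.cls e = some i := by
  by_contra h
  push Not at h
  have := T.len_sum i
  simp [h] at this
  linarith

omit [Finite V] in
lemma exists_flow_ne (i : Fin 3) {e : E} (h : T.cls e = some i) : ∃ ω, D.IsFlow ω ∧ ω e ≠ 0 := by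
  -- The weights `2`, `-1`, `-1` have sum zero and vanish on no class.
  refine ⟨fun e => T.sgn e * (T.cls e).elim 0 (fun j => if j = i then 2 else -1),
    (T.flow_iff _).2 ⟨_, ?_, fun e => rfl⟩, ?_⟩
  · fin_cases i <;> simp <;> norm_num
  · simp [h, T.sgn_ne]

omit [Finite V] in
lemma exists_src {i : Fin 3} {δ : E × Bool} (h : T.cls δ.1 = some i) : ∃ v, D.src δ = some v := by
  obtain ⟨e, b⟩ := δ
  cases b
  · obtain ⟨ω, hω, hne⟩ := T.exists_flow_ne i h
    cases hh : D.head e with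
    | none => exact absurd (hω.1 e hh) hne
    | some w => exact ⟨w, by simp [src, hh]⟩
  · exact ⟨_, rfl⟩

/-- A bounded region whose boundary consists of the edges outside the class `k`. -/
structure IsFace (U : Set Plane) (k : Fin 3) : Prop where
  bdd : Bornology.IsBounded U
  exists_coeff : ∃ x : Fin 3 → ℝ, x 0 + x 1 + x 2 = 0 ∧ x k = 0 ∧ (∀ i, i ≠ k → x i ≠ 0) ∧
    ∀ e, D.boundary U e = T.sgn e * (T.cls e).elim 0 x

section
variable (hs : ∀ p ∈ D.support, IsSmoothAt D.support p)
include hs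

omit T in
lemma boundary_ne_zero {δ : E × Bool} : D.boundary (D.left δ) δ.1 ≠ 0 := by
  classical
  have h := D.left_ne_left_rev hs δ
  have h' := h.symm
  obtain ⟨e, b⟩ := δ
  cases b <;> simp only [rev, Bool.not_true, Bool.not_false] at h h' <;>
    simp [boundary, h']

variable {T}

omit [Finite V] hs in
lemma IsFace.exists_left {U : Set Plane} {k : Fin 3} (h : T.IsFace U k) {e : E} {i : Fin 3}
    (hi : i ≠ k) (he : T.cls e = some i) : ∃ b, D.left (e, b) = U := by
  classical
  obtain ⟨x, -, -, hx, hb⟩ := h.exists_coeff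
  have h1 := hb e
  rw [he, Option.elim_some] at h1
  by_contra hcon
  push Not at hcon
  simp [boundary, hcon] at h1
  rcases h1 with h1 | h1
  · exact T.sgn_ne e h1
  · exact hx i hi h1

lemma IsFace.exists_cls {U : Set Plane} {k : Fin 3} (h : T.IsFace U k) {δ : E × Bool}
    (hδ : D.left δ = U) : ∃ i, i ≠ k ∧ T.cls δ.1 = some i := by
  obtain ⟨x, -, hk, hx, hb⟩ := h.exists_coeff
  have h1 := hb δ.1
  have h2 := boundary_ne_zero hs (δ := δ)
  rw [hδ, h1] at h2
  cases hc : T.cls δ.1 with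
  | none => simp [hc] at h2
  | some i =>
    refine ⟨i, ?_, rfl⟩
    rintro rfl
    simp [hc, hk] at h2

variable (T) (hinj : Function.Injective D.pos)
include hinj

/-- The boundary flow takes a value `0` or `±1` on each class, with sum zero and a nonzero value on
`i`. By parity exactly one class has the value zero. -/
lemma exists_isFace (hL : 0 < L) {δ : E × Bool} {i : Fin 3} (h : T.cls δ.1 = some i)
    (hb : Bornology.IsBounded (D.left δ)) : ∃ k, i ≠ k ∧ T.IsFace (D.left δ) k := by
  classical
  obtain ⟨x, h0, hx⟩ := (T.flow_iff _).1 (D.isFlow_boundary hs hinj hb)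
  have hval : ∀ j, x j = 0 ∨ x j = 1 ∨ x j = -1 := by
    intro j
    obtain ⟨e, he⟩ := T.exists_cls hL j
    have h1 := hx e
    rw [he, Option.elim_some, boundary] at h1
    rcases T.sgn_eq e with h2 | h2 <;> rw [h2] at h1 <;> split_ifs at h1 <;> norm_num at h1
    all_goals first
      | (left; linarith) | (right; left; linarith) | (right; right; linarith)
  have hi : x i ≠ 0 := by
    intro h1
    have := hx δ.1
    rw [h, Option.elim_some, h1, mul_zero] at this
    exact boundary_ne_zero hs this
  have key : ∃ k, x k = 0 ∧ ∀ j, j ≠ k → x j ≠ 0 := by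
    by_cases z0 : x 0 = 0
    · refine ⟨0, z0, fun j hj hxj => hi ?_⟩
      fin_cases j
      · exact absurd rfl hj
      · simp at hxj; fin_cases i <;> simp <;> linarith
      · simp at hxj; fin_cases i <;> simp <;> linarith
    by_cases z1 : x 1 = 0
    · refine ⟨1, z1, fun j hj hxj => hi ?_⟩
      fin_cases j
      · exact absurd hxj z0
      · exact absurd rfl hj
      · simp at hxj; exact absurd (by linarith) z0
    by_cases z2 : x 2 = 0
    · refine ⟨2, z2, fun j hj hxj => hi ?_⟩
      fin_cases j
      · exact absurd hxj z0
      · exact absurd hxj z1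
      · exact absurd rfl hj
    · exfalso
      rcases hval 0 with a | a | a <;> rcases hval 1 with b | b | b <;>
        rcases hval 2 with c | c | c <;> first | contradiction | (exfalso; linarith)
  obtain ⟨k, hk, hk'⟩ := key
  exact ⟨k, fun h => hi (h ▸ hk), hb, x, h0, hk, hk', hx⟩

/-- There are two different faces. -/
lemma exists_two_faces (hL : 0 < L) : ∃ U U' k k', k ≠ k' ∧ T.IsFace U k ∧ T.IsFace U' k' := by
  have hstep : ∀ i, ∃ U k, i ≠ k ∧ T.IsFace U k := by
    intro i
    obtain ⟨e, he⟩ := T.exists_cls hL i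
    obtain ⟨ω, hω, hne⟩ := T.exists_flow_ne i he
    -- An edge that carries flow cannot have unbounded regions on both sides.
    have : ∃ b, Bornology.IsBounded (D.left (e, b)) := by
      by_contra hcon
      push Not at hcon
      exact hne (D.flow_eq_zero hs hω hcon)
    obtain ⟨b, hb⟩ := this
    obtain ⟨k, hk, h⟩ := T.exists_isFace hs hinj hL (δ := (e, b)) he hb
    exact ⟨_, k, hk, h⟩
  -- A second application, to the class missed by the first face, yields a face bordering that class
  -- and so missing another one.
  obtain ⟨U, k, -, hU⟩ := hstep 0
  obtain ⟨U', k', hk', hU'⟩ := hstep k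
  exact ⟨U, U', k, k', hk', hU, hU'⟩

end

end ThetaData
end Drawing
end PlaneTropical

/-! ### The boundary walk of a face. -/

namespace PlaneTropical
namespace Drawing

variable {V E : Type} (D : Drawing V E)

/-- `ε'` follows `ε` along the boundary of the region to the right of `ε`. -/
def Succ (ε ε' : E × Bool) : Prop :=
  ∃ v, D.src (rev ε) = some v ∧ D.src ε' = some v ∧ D.left (rev ε') = D.left (rev ε) ∧
    ((D.vec ε' = D.vec ε ∧ D.left ε' = D.left ε) ∨
      (cross (D.vec ε) (D.vec ε') = -1 ∧ ∃ g, D.src g = some v ∧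
        D.vec g = D.vec ε - D.vec ε' ∧ D.left g = D.left ε ∧ D.left (rev g) = D.left ε'))

variable [Finite V]

lemma eq_of_src_rev [Finite E] (hs : ∀ p ∈ D.support, IsSmoothAt D.support p)
    (hinj : Function.Injective D.pos) {v : V} {α β : E × Bool}
    (hα : D.src (rev α) = some v) (hβ : D.src (rev β) = some v)
    (h : D.left (rev α) = D.left (rev β)) : α = β := by
  have := D.dart_eq_of_left_eq hs hinj hα hβ h
  rw [← rev_rev α, this, rev_rev]

variable [Fintype E]

namespace ThetaData

variable {D} {L : ℝ} {T : D.ThetaData L} (hs : ∀ p ∈ D.support, IsSmoothAt D.support p)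
  (hinj : Function.Injective D.pos)
include hs

lemma IsFace.cls_right {F : Set Plane} {k : Fin 3} (h : T.IsFace F k) {ε : E × Bool}
    (hε : D.left (rev ε) = F) : ∃ i, i ≠ k ∧ T.cls ε.1 = some i := by
  simpa using h.exists_cls hs hε

include hinj

lemma IsFace.exists_succ {F : Set Plane} {k : Fin 3} (h : T.IsFace F k) {ε : E × Bool}
    (hε : D.left (rev ε) = F) : ∃ ε', D.Succ ε ε' := by
  obtain ⟨i, -, hi⟩ := h.cls_right hs hε
  obtain ⟨v, hv⟩ := T.exists_src (δ := rev ε) (by simpa using hi)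
  obtain ⟨ε', h1, h2, h3⟩ := D.exists_next hs hinj hv
  exact ⟨ε', v, hv, h1, h2, h3⟩

/-- The boundary of a face is a single closed walk. -/
lemma IsFace.mem_of_closed (hL : 0 < L) {F : Set Plane} {k : Fin 3} (h : T.IsFace F k)
    {nxt : E × Bool → E × Bool} (hn : ∀ ε, D.left (rev ε) = F → D.Succ ε (nxt ε))
    {O : Finset (E × Bool)} (hO : ∀ ε ∈ O, D.left (rev ε) = F) (hm : ∀ ε ∈ O, nxt ε ∈ O)
    (hne : O.Nonempty) {β : E × Bool} (hβ : D.left (rev β) = F) : β ∈ O := by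
  classical
  have hrev : ∀ {ε}, D.left (rev ε) = F → rev ε ∉ O := by
    intro ε hε hr
    have := hO _ hr
    rw [rev_rev] at this
    exact D.left_ne_left_rev hs ε (this.trans hε.symm)
  -- The signed indicator of `O`. It is a flow because `nxt` permutes `O` and carries the head of
  -- each dart to the source of its successor.
  set ω : E → ℝ := fun e => (if (e, true) ∈ O then 1 else 0) - (if (e, false) ∈ O then 1 else 0)
    with hω
  have hd : ∀ δ : E × Bool, dval ω δ = (if δ ∈ O then 1 else 0) - (if rev δ ∈ O then 1 else 0) := by
    rintro ⟨e, b⟩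
    cases b <;> simp [dval, hω, rev]
  have hne0 : ∀ {ε}, ε ∈ O → ω ε.1 ≠ 0 := by
    intro ε hε
    have h1 : dval ω ε = 1 := by rw [hd, if_pos hε, if_neg (hrev (hO _ hε)), sub_zero]
    intro h0
    simp [dval, h0] at h1
  -- A dart with `F` on its right is determined by its head.
  have hinjO : Set.InjOn nxt O := by
    intro α hα β hβ hab
    obtain ⟨v, h1, h2, -⟩ := hn α (hO _ hα)
    obtain ⟨w, h3, h4, -⟩ := hn β (hO _ hβ)
    rw [hab, h4, Option.some.injEq] at h2
    subst h2
    exact D.eq_of_src_rev hs hinj h1 h3 ((hO _ hα).trans (hO _ hβ).symm)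
  have hfl : D.IsFlow ω := by
    constructor
    · intro e he
      have : ∀ b, (e, b) ∉ O := by
        intro b hb
        exact D.not_isBounded_left_of_ray (δ := rev (e, b)) (by simpa using he) (hO _ hb ▸ h.bdd)
      simp [hω, this]
    · intro v
      have h1 : ∑ δ : E × Bool, (if D.src δ = some v then (if rev δ ∈ O then (1 : ℝ) else 0) else 0) =
          ∑ δ : E × Bool, (if D.src (rev δ) = some v then (if δ ∈ O then (1 : ℝ) else 0) else 0) := by
        refine Fintype.sum_equiv ⟨rev, rev, rev_rev, rev_rev⟩ _ _ fun δ => ?_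
        simp
      have h2 : ∑ δ ∈ O, (if D.src (rev δ) = some v then (1 : ℝ) else 0) =
          ∑ δ ∈ O, (if D.src δ = some v then (1 : ℝ) else 0) := by
        refine Finset.sum_nbij nxt hm hinjO
          (Finset.surjOn_of_injOn_of_card_le _ hm hinjO le_rfl) fun δ hδ => ?_
        obtain ⟨w, h3, h4, -⟩ := hn δ (hO _ hδ)
        rw [h3, h4]
      have h3 : ∀ (f : E × Bool → Prop) [DecidablePred f], ∑ δ : E × Bool, (if f δ then (if δ ∈ O then (1 : ℝ) else 0)
          else 0) = ∑ δ ∈ O, (if f δ then (1 : ℝ) else 0) := by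
        intro f _
        rw [← Finset.sum_filter_add_sum_filter_not Finset.univ (· ∈ O)]
        rw [Finset.sum_eq_zero (s := Finset.univ.filter (¬ · ∈ O))]
        · rw [add_zero]
          refine Finset.sum_congr (by ext; simp) fun δ hδ => ?_
          simp [hδ]
        · intro δ hδ
          simp only [Finset.mem_filter, Finset.mem_univ, true_and] at hδ
          simp [hδ]
      calc ∑ δ : E × Bool, (if D.src δ = some v then dval ω δ else 0)
          = ∑ δ : E × Bool, ((if D.src δ = some v then (if δ ∈ O then (1 : ℝ) else 0) else 0) -
            (if D.src δ = some v then (if rev δ ∈ O then (1 : ℝ) else 0) else 0)) := by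
            refine Finset.sum_congr rfl fun δ _ => ?_
            rw [hd]; split_ifs <;> simp
        _ = 0 := by
            rw [Finset.sum_sub_distrib, h1, h3 (fun δ => D.src δ = some v),
              h3 (fun δ => D.src (rev δ) = some v), h2, sub_self]
  -- By the theta description the flow vanishes on the class `k`, which does not border `F`. Being
  -- nonzero somewhere, it is nonzero on both remaining classes, so `O` contains every boundary
  -- dart.
  obtain ⟨x, hx0, hx⟩ := (T.flow_iff ω).1 hfl
  have hxk : x k = 0 := by
    obtain ⟨e, he⟩ := T.exists_cls hL k
    have : ∀ b, (e, b) ∉ O := by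
      intro b hb
      obtain ⟨i, hi, hi'⟩ := h.cls_right hs (hO _ hb)
      rw [he, Option.some.injEq] at hi'
      exact hi hi'.symm
    have h1 := hx e
    simp only [hω, this, if_false, he, Option.elim_some, sub_zero] at h1
    rcases mul_eq_zero.1 h1.symm with h1 | h1
    · exact absurd h1 (T.sgn_ne e)
    · exact h1
  obtain ⟨α, hα⟩ := hne
  obtain ⟨i, hi, hi'⟩ := h.cls_right hs (hO _ hα)
  obtain ⟨j, hj, hj'⟩ := h.cls_right hs hβ
  have hxi : x i ≠ 0 := by
    intro h0
    have := hx α.1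
    rw [hi', Option.elim_some, h0, mul_zero] at this
    exact hne0 hα this
  have hxj : x j ≠ 0 := by
    fin_cases k <;> fin_cases i <;> fin_cases j <;> simp at hi hj hxk hxi ⊢ <;>
      first | exact hxi | (intro h0; apply hxi; linarith)
  have hωβ : ω β.1 ≠ 0 := by
    rw [hx, hj', Option.elim_some]
    exact mul_ne_zero (T.sgn_ne _) hxj
  by_contra hcon
  apply hωβ
  have h1 : dval ω β = 0 := by
    rw [hd, if_neg hcon, if_neg (hrev hβ), sub_zero]
  obtain ⟨e, b⟩ := β
  cases b <;> simpa [dval] using h1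

/-- The orbit of a boundary dart is closed under `nxt`, hence contains the whole boundary. -/
lemma IsFace.exists_iterate (hL : 0 < L) {F : Set Plane} {k : Fin 3} (h : T.IsFace F k)
    {nxt : E × Bool → E × Bool} (hn : ∀ ε, D.left (rev ε) = F → D.Succ ε (nxt ε))
    {α β : E × Bool} (hα : D.left (rev α) = F) (hβ : D.left (rev β) = F) :
    ∃ n, nxt^[n] α = β := by
  classical
  have hO : ∀ n, D.left (rev (nxt^[n] α)) = F := by
    intro n
    induction n with
    | zero => exact hα
    | succ n ih =>
      rw [Function.iterate_succ_apply']
      obtain ⟨v, -, -, h1, -⟩ := hn _ ih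
      exact h1.trans ih
  have := h.mem_of_closed hs hinj hL hn (O := (Set.range fun n => nxt^[n] α).toFinite.toFinset)
    (β := β) (by simpa using hO)
    (by
      simp only [Set.Finite.mem_toFinset, Set.mem_range, forall_exists_index,
        forall_apply_eq_imp_iff]
      intro n
      exact ⟨n + 1, Function.iterate_succ_apply' _ _ _⟩) ⟨α, by simpa using ⟨0, rfl⟩⟩ hβ
  simpa using this

end ThetaData

/-- The closed walk along the boundary of a face `F`, starting with the last edge of class `m`
before the stretch of edges of class `r`. -/
structure Circuit {D : Drawing V E} {L : ℝ} (T : D.ThetaData L) (F : Set Plane) (m r : Fin 3) where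
  dart : ℕ → E × Bool
  K : ℕ
  right : ∀ n, D.left (rev (dart n)) = F
  succ : ∀ n, D.Succ (dart n) (dart (n + 1))
  cls_zero : T.cls (dart 0).1 = some m
  cls_mid : ∀ n, 1 ≤ n → n ≤ K → T.cls (dart n).1 = some r
  cls_last : T.cls (dart (K + 1)).1 = some m
  one_le : 1 ≤ K
  cover : ∀ δ, D.left (rev δ) = F → T.cls δ.1 = some r → ∃ n, 1 ≤ n ∧ n ≤ K ∧ dart n = δ
  a : V
  b : V
  src_a : D.src (dart 1) = some a
  src_b : D.src (dart (K + 1)) = some b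
  ends : (a = T.P ∧ b = T.Q) ∨ (a = T.Q ∧ b = T.P)

/-- Different classes meet only at `P` and `Q`, and a boundary dart is determined by its head. So
the walk passes from `m` to `r` just once in a period, and the class `r` is traversed in a single
stretch between these two vertices. -/
theorem ThetaData.IsFace.exists_circuit {D : Drawing V E} {L : ℝ} {T : D.ThetaData L}
    (hs : ∀ p ∈ D.support, IsSmoothAt D.support p) (hinj : Function.Injective D.pos)
    (hL : 0 < L) {F : Set Plane} {k m r : Fin 3} (h : T.IsFace F k) (hm : m ≠ k) (hr : r ≠ k)
    (hmr : m ≠ r) : Nonempty (Circuit T F m r) := by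
  classical
  have hex : ∀ ε : E × Bool, ∃ ε', D.left (rev ε) = F → D.Succ ε ε' := by
    intro ε
    by_cases hε : D.left (rev ε) = F
    · obtain ⟨ε', h'⟩ := h.exists_succ hs hinj hε
      exact ⟨ε', fun _ => h'⟩
    · exact ⟨ε, fun h => absurd h hε⟩
  choose nxt hn using hex
  have hit : ∀ {α} (_ : D.left (rev α) = F) n, D.left (rev (nxt^[n] α)) = F := by
    intro α hα n
    induction n with
    | zero => exact hα
    | succ n ih =>
      rw [Function.iterate_succ_apply']
      obtain ⟨v, -, -, h1, -⟩ := hn _ ih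
      exact h1.trans ih
  have hcl : ∀ {α} (_ : D.left (rev α) = F), T.cls α.1 = some m ∨ T.cls α.1 = some r := by
    intro α hα
    obtain ⟨i, hi, hi'⟩ := h.cls_right hs hα
    rw [hi']
    have : i = m ∨ i = r := by clear hi'; omega
    rcases this with rfl | rfl <;> simp
  have hrep : ∀ i, i ≠ k → ∃ α, D.left (rev α) = F ∧ T.cls α.1 = some i := by
    intro i hi
    obtain ⟨e, he⟩ := T.exists_cls hL i
    obtain ⟨b, hb⟩ := h.exists_left hi he
    exact ⟨rev (e, b), by rwa [rev_rev], he⟩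
  obtain ⟨α, hα, hαm⟩ := hrep m hm
  obtain ⟨β, hβ, hβr⟩ := hrep r hr
  have hmr' : ∀ {γ : E × Bool}, T.cls γ.1 = some m → T.cls γ.1 ≠ some r := by
    intro γ h1 h2
    rw [h1, Option.some.injEq] at h2
    exact hmr h2
  have hex1 : ∃ n, T.cls (nxt^[n] α).1 = some r := by
    obtain ⟨n, hn⟩ := h.exists_iterate hs hinj hL hn hα hβ
    exact ⟨n, by rw [hn, hβr]⟩
  obtain ⟨ε, hε, hεm, hεr⟩ : ∃ ε, D.left (rev ε) = F ∧ T.cls ε.1 = some m ∧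
      T.cls (nxt ε).1 = some r := by
    have h1 := Nat.find_spec hex1
    cases hN : Nat.find hex1 with
    | zero =>
      rw [hN] at h1
      exact absurd h1 (hmr' hαm)
    | succ N =>
      have h2 := Nat.find_min hex1 (m := N) (by omega)
      rw [hN, Function.iterate_succ_apply'] at h1
      exact ⟨nxt^[N] α, hit hα N, (hcl (hit hα N)).resolve_right h2, h1⟩
  have hε1 : D.left (rev (nxt ε)) = F := hit hε 1
  have hex2 : ∃ n, T.cls (nxt^[n] (nxt ε)).1 = some m := by
    obtain ⟨n, hn⟩ := h.exists_iterate hs hinj hL hn hε1 hε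
    exact ⟨n, by rw [hn, hεm]⟩
  -- The search starts at `nxt ε`, so the darts `1, …, K` counted from `ε` have class `r` and dart
  -- `K + 1` is the first of class `m` again.
  set K := Nat.find hex2 with hK
  have hKm : T.cls (nxt^[K + 1] ε).1 = some m := Nat.find_spec hex2
  have hmid : ∀ n, 1 ≤ n → n ≤ K → T.cls (nxt^[n] ε).1 = some r := by
    intro n h1 h2
    obtain ⟨n, rfl⟩ : ∃ j, n = j + 1 := ⟨n - 1, by omega⟩
    exact (hcl (hit hε _)).resolve_left (Nat.find_min hex2 (m := n) (by omega))
  have hK1 : 1 ≤ K := by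
    by_contra h0
    have : K = 0 := by omega
    rw [this] at hKm
    exact hmr' hKm hεr
  obtain ⟨a, ha, ha', -⟩ := hn ε hε
  obtain ⟨b, hb, hb', -⟩ := hn _ (hit hε K)
  rw [← Function.iterate_succ_apply' nxt K ε] at hb'
  have haPQ : a = T.P ∨ a = T.Q :=
    T.uniform a (rev ε) (nxt ε) m r ha ha' hεm hεr hmr
  have hbPQ : b = T.P ∨ b = T.Q :=
    T.uniform b (rev (nxt^[K] ε)) (nxt^[K + 1] ε) r m hb hb'
      (by simpa using hmid K hK1 le_rfl) hKm hmr.symm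
  have hab : a ≠ b := by
    intro hab
    subst hab
    have := D.eq_of_src_rev hs hinj ha hb (hε.trans (hit hε K).symm)
    have h1 := hmid K hK1 le_rfl
    rw [← this] at h1
    exact hmr' hεm h1
  -- A second passage from `m` to `r` would have its head at `a` or `b`, where `ε` and dart `K` are
  -- already the boundary darts arriving there.
  have htrans : ∀ {γ : E × Bool} (_ : D.left (rev γ) = F), T.cls γ.1 = some m →
      T.cls (nxt γ).1 = some r → γ = ε := by
    intro γ hγ h1 h2
    obtain ⟨c, hc, hc', -⟩ := hn γ hγ
    have hcPQ : c = T.P ∨ c = T.Q := T.uniform c (rev γ) (nxt γ) m r hc hc' h1 h2 hmr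
    have : c = a ∨ c = b := by
      rcases haPQ with rfl | rfl <;> rcases hbPQ with rfl | rfl <;> tauto
    rcases this with rfl | rfl
    · exact D.eq_of_src_rev hs hinj hc ha (hγ.trans hε.symm)
    · have := D.eq_of_src_rev hs hinj hc hb (hγ.trans (hit hε K).symm)
      rw [this] at h1
      exact absurd (hmid K hK1 le_rfl) (hmr' h1)
  have hcov : ∀ n, T.cls (nxt^[n] ε).1 = some m ∨ ∃ j, 1 ≤ j ∧ j ≤ K ∧ nxt^[j] ε = nxt^[n] ε := by
    intro n
    induction n with
    | zero => exact Or.inl hεm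
    | succ n ih =>
      rcases ih with ih | ⟨j, hj1, hj2, hj⟩
      · rcases hcl (hit hε (n + 1)) with h1 | h1
        · exact Or.inl h1
        · right
          have h2 := htrans (hit hε n) ih (by rwa [← Function.iterate_succ_apply' nxt])
          exact ⟨1, le_rfl, hK1, by
            rw [Function.iterate_succ_apply' nxt n, h2]; rfl⟩
      · rcases hj2.eq_or_lt with rfl | hj2
        · left
          rwa [Function.iterate_succ_apply', ← hj, ← Function.iterate_succ_apply' nxt]
        · right
          exact ⟨j + 1, by omega, hj2, by
            rw [Function.iterate_succ_apply', hj, ← Function.iterate_succ_apply' nxt]⟩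
  refine ⟨{ dart := fun n => nxt^[n] ε, K := K, right := hit hε, succ := ?_, cls_zero := hεm,
            cls_mid := hmid, cls_last := hKm, one_le := hK1, cover := ?_, a := a, b := b,
            src_a := ha', src_b := hb', ends := ?_ }⟩
  · intro n
    simp only [Function.iterate_succ_apply']
    exact hn _ (hit hε n)
  · intro δ hδ hδr
    obtain ⟨n, hn⟩ := h.exists_iterate hs hinj hL hn hε hδ
    rcases hcov n with h1 | ⟨j, h1, h2, h3⟩
    · rw [hn] at h1
      exact absurd hδr (hmr' h1)
    · exact ⟨j, h1, h2, h3.trans hn⟩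
  · rcases haPQ with rfl | rfl <;> rcases hbPQ with rfl | rfl <;> tauto

end Drawing
end PlaneTropical

/-! ### Integer recursion for the directions along a convex boundary. -/

namespace PlaneTropical

/-- Coordinates of the direction vectors met along the boundary walk of a polygon: `(X, Y)` is the
current direction, `(A, B)` the previous one, `(S, T)` the next one. -/
structure TurnSequence (K : ℕ) (X Y A B S T n : ℕ → ℤ) : Prop where
  one_le : 1 ≤ K
  X_one : X 1 = 1
  Y_one : Y 1 = 0
  A_one : A 1 = 0
  B_one : B 1 = 1
  X_last : X K = -1
  S_last : S K = 0
  T_last : T K = 1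
  rel_X : ∀ k, 1 ≤ k → k ≤ K → A k + S k = (2 - n k) * X k
  rel_Y : ∀ k, 1 ≤ k → k ≤ K → B k + T k = (2 - n k) * Y k
  n_nonneg : ∀ k, 1 ≤ k → k ≤ K → 0 ≤ n k
  n_one : 1 ≤ n 1
  n_last : 1 ≤ n K
  step : ∀ k, 1 ≤ k → k < K →
    (X (k + 1) = X k ∧ Y (k + 1) = Y k ∧ A (k + 1) = A k ∧ B (k + 1) = B k ∧ S (k + 1) = S k ∧
      T (k + 1) = T k ∧ n (k + 1) = n k) ∨
    (S k = X (k + 1) ∧ T k = Y (k + 1) ∧ A (k + 1) = X k ∧ B (k + 1) = Y k)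
  sign : ∀ k, 1 ≤ k → k < K → X k < 0 → X (k + 1) < 0

namespace TurnSequence

variable {K : ℕ} {X Y A B S T n : ℕ → ℤ} (h : TurnSequence K X Y A B S T n)
include h

/-- Read from the end. Negative `X` stays negative, so moving back the previous direction is
negative too. In the last block `rel_X` then forces `n = 1`, in the earlier ones `n = 0`; each block
back keeps `X = -1` and lowers `Y` by one. -/
lemma backward {k : ℕ} (hk : k ≤ K) : 1 ≤ k → X k < 0 →
    X k = -1 ∧ ((S k = 0 ∧ T k = 1 ∧ 1 ≤ n k) ∨ (S k = -1 ∧ T k = Y k + 1)) := by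
  induction hk using Nat.decreasingInduction with
  | self => exact fun _ _ => ⟨h.X_last, Or.inl ⟨h.S_last, h.T_last, h.n_last⟩⟩
  | of_succ k hk ih =>
    intro h1 hX
    obtain ⟨i1, i2⟩ := ih (by omega) (h.sign k h1 hk hX)
    have r1 := h.rel_X (k + 1) (by omega) hk
    have r2 := h.rel_Y (k + 1) (by omega) hk
    have r3 := h.n_nonneg (k + 1) (by omega) hk
    rcases h.step k h1 hk with ⟨s1, s2, s3, s4, s5, s6, s7⟩ | ⟨s1, s2, s3, s4⟩
    · rw [s1] at i1
      rw [s2, s5, s6, s7] at i2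
      exact ⟨i1, i2⟩
    · rw [i1, s3] at r1
      rw [s4] at r2
      rcases i2 with ⟨j1, j2, j3⟩ | ⟨j1, j2⟩
      · have hn : n (k + 1) = 1 := by omega
        rw [hn] at r1 r2
        exact ⟨by omega, Or.inr ⟨by omega, by omega⟩⟩
      · have hn : n (k + 1) = 0 := by omega
        rw [hn] at r1 r2
        exact ⟨by omega, Or.inr ⟨by omega, by omega⟩⟩

/-- Read from the start. In the first phase the direction is `(1, -j)`, where `j` counts the turns
so far. In the second phase it is `(0, -1)` or has `X = -1` and `Y ≥ j - 2`. The form `(j - 1) * X +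
Y` is at least `-1` on all of these, with `j` frozen when the first phase ends. -/
lemma forward {k : ℕ} (h1 : 1 ≤ k) : k ≤ K → ∃ j : ℤ, 0 ≤ j ∧
    ((X k = 1 ∧ Y k = -j ∧ ((j = 0 ∧ A k = 0 ∧ B k = 1 ∧ 1 ≤ n k) ∨ (A k = 1 ∧ B k = 1 - j)) ∧
        ∀ i, 1 ≤ i → i ≤ k → X i = 1 ∧ -j ≤ Y i) ∨
      (((X k = 0 ∧ Y k = -1 ∧ A k = 1 ∧ B k = -j) ∨ (X k = -1 ∧ j - 2 ≤ Y k)) ∧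
        ∀ i, 1 ≤ i → i ≤ k → -1 ≤ (j - 1) * X i + Y i)) := by
  induction k, h1 using Nat.le_induction with
  | base =>
    refine fun _ => ⟨0, le_rfl, Or.inl ⟨h.X_one, by simp [h.Y_one],
      Or.inl ⟨rfl, h.A_one, h.B_one, h.n_one⟩, fun i hi hi' => ?_⟩⟩
    obtain rfl : i = 1 := by omega
    simp [h.X_one, h.Y_one]
  | succ k h1 ih =>
    intro hk
    obtain ⟨j, hj, hst⟩ := ih (by omega)
    have r1 := h.rel_X k (by omega) (by omega)
    have r2 := h.rel_Y k (by omega) (by omega)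
    have r3 := h.n_nonneg k (by omega) (by omega)
    have hb := h.backward hk (by omega)
    rcases hst with ⟨a1, a2, a3, a4⟩ | ⟨a1, a4⟩
    · have a5 : ∀ i, 1 ≤ i → i ≤ k → -1 ≤ (j - 1) * X i + Y i := by
        intro i hi hi'
        obtain ⟨b1, b2⟩ := a4 i hi hi'
        rw [b1]; omega
      rcases h.step k h1 hk with ⟨s1, s2, s3, s4, s5, s6, s7⟩ | ⟨s1, s2, s3, s4⟩
      · refine ⟨j, hj, Or.inl ⟨by omega, by omega, by omega, fun i hi hi' => ?_⟩⟩
        rcases hi'.eq_or_lt with rfl | hi'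
        · omega
        · exact a4 i hi (by omega)
      · rw [a1, s1] at r1
        rw [a2, s2] at r2
        -- The first block has previous direction `(0, 1)`, so it turns to `(2 - n, -1)`; the
        -- condition `n ≥ 1` makes the new `X` at most `1`.
        rcases a3 with ⟨rfl, a6, a7, a8⟩ | ⟨a6, a7⟩
        · have hY : Y (k + 1) = -1 := by simp at r2; omega
          rcases lt_trichotomy (X (k + 1)) 0 with hX | hX | hX
          · have hX := (hb hX).1
            refine ⟨0, le_rfl, Or.inr ⟨Or.inr ⟨hX, by omega⟩, fun i hi hi' => ?_⟩⟩
            rcases hi'.eq_or_lt with rfl | hi'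
            · omega
            · exact a5 i hi (by omega)
          · refine ⟨0, le_rfl, Or.inr ⟨Or.inl ⟨hX, hY, by omega, by omega⟩, fun i hi hi' => ?_⟩⟩
            rcases hi'.eq_or_lt with rfl | hi'
            · omega
            · exact a5 i hi (by omega)
          · refine ⟨1, by omega, Or.inl ⟨by omega, by omega, Or.inr ⟨by omega, by omega⟩,
              fun i hi hi' => ?_⟩⟩
            rcases hi'.eq_or_lt with rfl | hi'
            · omega
            · have := a4 i hi (by omega)
              omega
        -- In later blocks the new `X` is `1 - n`, so `n = 0, 1, 2` give `1, 0, -1`. Larger `n` is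
        -- impossible because `backward` allows no negative value except `-1`.
        · rcases lt_trichotomy (X (k + 1)) 0 with hX | hX | hX
          · have hX := (hb hX).1
            have hn : n k = 2 := by omega
            rw [hn] at r2
            refine ⟨j, hj, Or.inr ⟨Or.inr ⟨hX, by omega⟩, fun i hi hi' => ?_⟩⟩
            rcases hi'.eq_or_lt with rfl | hi'
            · rw [hX]; omega
            · exact a5 i hi (by omega)
          · have hn : n k = 1 := by omega
            rw [hn] at r2
            refine ⟨j, hj, Or.inr ⟨Or.inl ⟨hX, by omega, by omega, by omega⟩, fun i hi hi' => ?_⟩⟩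
            rcases hi'.eq_or_lt with rfl | hi'
            · rw [hX]; omega
            · exact a5 i hi (by omega)
          · have hn : n k = 0 := by omega
            rw [hn] at r1 r2
            refine ⟨j + 1, by omega, Or.inl ⟨by omega, by omega, Or.inr ⟨by omega, by omega⟩,
              fun i hi hi' => ?_⟩⟩
            rcases hi'.eq_or_lt with rfl | hi'
            · omega
            · have := a4 i hi (by omega)
              omega
    · refine ⟨j, hj, Or.inr ?_⟩
      rcases h.step k h1 hk with ⟨s1, s2, s3, s4, s5, s6, s7⟩ | ⟨s1, s2, s3, s4⟩
      · refine ⟨by omega, fun i hi hi' => ?_⟩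
        rcases hi'.eq_or_lt with rfl | hi'
        · rw [s1, s2]
          exact a4 k h1 le_rfl
        · exact a4 i hi (by omega)
      · have key : X (k + 1) = -1 ∧ j - 2 ≤ Y (k + 1) := by
          rcases a1 with ⟨b1, b2, b3, b4⟩ | ⟨b1, b2⟩
          · rw [b1] at r1
            rw [b2] at r2
            omega
          · have hX := h.sign k h1 hk (by omega)
            have := h.backward (k := k) (by omega) h1 (by omega)
            omega
        refine ⟨Or.inr key, fun i hi hi' => ?_⟩
        rcases hi'.eq_or_lt with rfl | hi'
        · rw [key.1]; omega
        · exact a4 i hi (by omega)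

/-- All directions lie on one side of a lattice line at distance one from the origin. -/
theorem exists_bound : ∃ c : ℤ, ∀ i, 1 ≤ i → i ≤ K → -1 ≤ c * X i + Y i := by
  obtain ⟨j, -, ⟨a1, -, -, -⟩ | ⟨-, h2⟩⟩ := h.forward h.one_le le_rfl
  · have := h.X_last
    omega
  · exact ⟨j - 1, h2⟩

end TurnSequence

/-- Decomposition of a difference of two complements of a primitive vector. -/
lemma sub_eq_cross_smul {v W W' : Fin 2 → ℤ} (h : cross v W = 1) (h' : cross v W' = 1) :
    W' = W + cross W' W • v := by
  have h1 := cross_smul_eq v W W'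
  rw [h, h', one_smul, one_smul] at h1
  nth_rewrite 1 [h1]
  exact add_comm _ _

lemma eq_zero_of_cross_eq_zero {v W : Fin 2 → ℤ} (h : cross v W = 1) {r : Plane}
    (h1 : cross (toPlane v) r = 0) (h2 : cross (toPlane W) r = 0) : r = 0 := by
  have := cross_smul_eq (toPlane v) (toPlane W) r
  rw [cross_toPlane, h, h1, cross_comm r, h2] at this
  simpa using this

lemma cross_add_smul_toPlane (v W : Fin 2 → ℤ) (n : ℤ) (r : Plane) :
    cross (toPlane (W + n • v)) r = cross (toPlane W) r + n * cross (toPlane v) r := by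
  rw [toPlane_add, toPlane_smul, cross_add_left, cross_smul_left]

/-- A recession direction of the region outside an edge `v` lies between the legs `W` and `W + n •
v` at its ends. For negative `n` the legs converge, and only `r = 0` would remain. -/
lemma nonneg_of_rec {v W : Fin 2 → ℤ} (h : cross v W = 1) {n : ℤ} {r : Plane} (hr : r ≠ 0)
    (h1 : 0 ≤ cross (toPlane v) r) (h2 : cross (toPlane W) r ≤ 0)
    (h3 : 0 ≤ cross (toPlane (W + n • v)) r) : 0 ≤ n := by
  by_contra hn
  have hn' : (n : ℝ) ≤ -1 := by exact_mod_cast (by omega : n ≤ -1)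
  rw [cross_add_smul_toPlane] at h3
  have e1 : cross (toPlane v) r = 0 := by nlinarith
  have e2 : cross (toPlane W) r = 0 := by rw [e1] at h3; linarith
  exact hr (eq_zero_of_cross_eq_zero h e1 e2)

/-- If `n` were not positive, then `r` would have to be parallel to `W`; the further leg `v + m • W`
excludes this. -/
lemma one_le_of_rec {v W : Fin 2 → ℤ} (h : cross v W = 1) {n m : ℤ} {r : Plane} (hr : r ≠ 0)
    (h1 : 0 ≤ cross (toPlane v) r) (h2 : cross (toPlane W) r ≤ 0)
    (h3 : 0 ≤ cross (toPlane (W + n • v)) r) (h4 : cross (toPlane (v + m • W)) r ≤ 0) :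
    1 ≤ n := by
  by_contra hn
  have hn' : (n : ℝ) ≤ 0 := by exact_mod_cast (by omega : n ≤ 0)
  rw [cross_add_smul_toPlane] at h3 h4
  have e2 : cross (toPlane W) r = 0 := by nlinarith
  have e1 : cross (toPlane v) r = 0 := by rw [e2] at h4; linarith
  exact hr (eq_zero_of_cross_eq_zero h e1 e2)

lemma one_le_of_rec' {v W : Fin 2 → ℤ} (h : cross v W = 1) {n m : ℤ} {r : Plane} (hr : r ≠ 0)
    (h1 : 0 ≤ cross (toPlane v) r) (h2 : 0 ≤ cross (toPlane W) r)
    (h3 : cross (toPlane (W + (-n) • v)) r ≤ 0) (h4 : 0 ≤ cross (toPlane (-v + m • W)) r) :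
    1 ≤ n := by
  by_contra hn
  have hn' : (n : ℝ) ≤ 0 := by exact_mod_cast (by omega : n ≤ 0)
  rw [cross_add_smul_toPlane] at h3 h4
  push_cast at h3
  rw [toPlane_neg, cross_neg_left] at h4
  have e2 : cross (toPlane W) r = 0 := by nlinarith
  have e1 : cross (toPlane v) r = 0 := by rw [e2] at h4; linarith
  exact hr (eq_zero_of_cross_eq_zero h e1 e2)

/-- Vertices of valence two repeat a direction. The functions `p` and `s` skip such repetitions:
they stay constant along each block and record the directions before and after it, with `u` at both
ends. -/
lemma exists_prev_next {α : Type*} [DecidableEq α] (v : ℕ → α) (u : α) (K : ℕ) :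
    ∃ p s : ℕ → α, p 1 = u ∧ s K = u ∧ ∀ k, 1 ≤ k → k < K →
      (v (k + 1) = v k ∧ p (k + 1) = p k ∧ s (k + 1) = s k) ∨
      (v (k + 1) ≠ v k ∧ s k = v (k + 1) ∧ p (k + 1) = v k) := by
  -- The clause `k = 0` ignores `v 0`, so that `p 1 = u`; the function `t` below runs backwards,
  -- counted from `K`.
  let p : ℕ → α := Nat.rec u fun k q => if v (k + 1) = v k ∨ k = 0 then q else v k
  let t : ℕ → α := Nat.rec u fun i q => if v (K - i) = v (K - (i + 1)) then q else v (K - i)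
  refine ⟨p, fun k => t (K - k), by simp [p], by simp [t], fun k h1 hk => ?_⟩
  have h2 : t (K - k) = if v (k + 1) = v k then t (K - (k + 1)) else v (k + 1) := by
    obtain ⟨i, rfl⟩ : ∃ i, K = k + 1 + i := ⟨K - (k + 1), by omega⟩
    have e1 : k + 1 + i - k = i + 1 := by omega
    have e2 : k + 1 + i - (k + 1) = i := by omega
    have e3 : k + 1 + i - i = k + 1 := by omega
    have e4 : k + 1 + i - (i + 1) = k := by omega
    rw [e1, e2]
    simp only [t, e3, e4]
  have h3 : p (k + 1) = if v (k + 1) = v k ∨ k = 0 then p k else v k := rfl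
  by_cases hv : v (k + 1) = v k
  · left
    simp [h2, h3, hv]
  · right
    simp [h2, h3, hv, show k ≠ 0 by omega]

end PlaneTropical

/-! ### Chains: the strand of a face with unbounded regions beyond it. -/

namespace PlaneTropical
namespace Drawing

variable {V E : Type} (D : Drawing V E)

lemma pos_mem_closure_arc [Finite V] [Finite E] {δ : E × Bool} {v : V} (h : D.src δ = some v) :
    D.pos v ∈ closure (D.arc δ.1) := by
  rw [mem_closure_iff_nhds]
  intro t ht
  obtain ⟨ε, hε, hε', h1⟩ := exists_small_pos
    (eventually_add_smul (p := D.pos v) ht (toPlane (D.vec δ))) (D.len_pos δ.1)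
  exact ⟨_, h1, D.mem_arc_of_small h hε hε'⟩

lemma arc_closure_left_rev [Finite V] [Finite E] (δ : E × Bool) :
    D.arc δ.1 ⊆ closure (D.left (rev δ)) := by
  simpa using D.arc_subset_closure_left (rev δ)

/-- Consecutive directions, with the previous and the next different direction, along a stretch of
the boundary of a region; the regions on the other side are `O 1, …, O K`. -/
structure Chain (u : Fin 2 → ℤ) (K : ℕ) (v p s : ℕ → Fin 2 → ℤ) (O : ℕ → Set Plane) : Prop where
  one_le : 1 ≤ K
  p_one : p 1 = u
  s_last : s K = u
  step : ∀ k, 1 ≤ k → k < K → (v (k + 1) = v k ∧ p (k + 1) = p k ∧ s (k + 1) = s k) ∨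
    (s k = v (k + 1) ∧ p (k + 1) = v k)
  cross_p : ∀ k, 1 ≤ k → k ≤ K → cross (p k) (v k) = -1
  cross_s : ∀ k, 1 ≤ k → k ≤ K → cross (v k) (s k) = -1
  exists_rec : ∀ k, 1 ≤ k → k ≤ K → ∃ r, IsRec (O k) r
  rec_v : ∀ k, 1 ≤ k → k ≤ K → ∀ r, IsRec (O k) r → 0 ≤ cross (toPlane (v k)) r
  rec_p : ∀ k, 1 ≤ k → k ≤ K → ∀ r, IsRec (O k) r → cross (toPlane (p k - v k)) r ≤ 0
  rec_s : ∀ k, 1 ≤ k → k ≤ K → ∀ r, IsRec (O k) r → 0 ≤ cross (toPlane (v k - s k)) r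
  sign : ∀ k, 1 ≤ k → k < K → cross (v k) u < 0 → cross (v (k + 1)) u < 0

/-- Two chains which meet the same regions at their ends. -/
lemma Chain.exists_bound {u u' : Fin 2 → ℤ} {K K' : ℕ} {v p s v' p' s' : ℕ → Fin 2 → ℤ}
    {O O' : ℕ → Set Plane} (c : Chain u K v p s O) (c' : Chain u' K' v' p' s' O')
    (h1 : v' 1 = v K - u) (h2 : v' K' = v 1 - u) (hO1 : O' 1 = O K) (hO2 : O' K' = O 1) :
    ∃ a : ℤ, (∀ i, 1 ≤ i → i ≤ K → -1 ≤ a * cross (v i) u + cross (v 1) (v i)) ∧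
      cross (v 1) u = 1 ∧ cross (v K) u = -1 := by
  have hK := c.one_le
  have hK' := c'.one_le
  have hv1 : cross (v 1) u = 1 := by
    have := c.cross_p 1 le_rfl hK
    rw [c.p_one, cross_comm] at this
    linarith
  have hvK : cross (v K) u = -1 := by
    have := c.cross_s K hK le_rfl
    rwa [c.s_last] at this
  have hWp : ∀ k, 1 ≤ k → k ≤ K → cross (v k) (p k - v k) = 1 := by
    intro k h1 h2
    rw [cross_sub_right, cross_self, cross_comm, c.cross_p k h1 h2]; rfl
  have hWs : ∀ k, 1 ≤ k → k ≤ K → cross (v k) (v k - s k) = 1 := by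
    intro k h1 h2
    rw [cross_sub_right, cross_self, c.cross_s k h1 h2]; rfl
  -- The outward legs at the two ends of a block are `p k - v k` and `v k - s k`. Both complete `v
  -- k` to a unimodular basis, so they differ by the multiple `n k` of `v k`.
  set n : ℕ → ℤ := fun k => cross (v k - s k) (p k - v k) with hn
  have hW : ∀ k, 1 ≤ k → k ≤ K → v k - s k = (p k - v k) + n k • v k := fun k h1 h2 =>
    sub_eq_cross_smul (hWp k h1 h2) (hWs k h1 h2)
  have hps : ∀ k, 1 ≤ k → k ≤ K → p k + s k = (2 - n k) • v k := by
    intro k h1 h2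
    have := hW k h1 h2
    have e : p k + s k = (2 : ℤ) • v k - ((v k - s k) - (p k - v k)) := by
      ext i; simp; ring
    rw [e, this, sub_smul]
    abel
  have hcoord : ∀ w : Fin 2 → ℤ, w = cross w u • v 1 + cross (v 1) w • u := by
    intro w
    have := cross_smul_eq (v 1) u w
    rwa [hv1, one_smul] at this
  -- The cross products with `u` and with `v 1` are the coordinates in the basis `(v 1, u)`.
  refine ⟨_, (TurnSequence.exists_bound (K := K) (X := fun k => cross (v k) u)
    (Y := fun k => cross (v 1) (v k)) (A := fun k => cross (p k) u) (B := fun k => cross (v 1) (p k))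
    (S := fun k => cross (s k) u) (T := fun k => cross (v 1) (s k)) (n := n) ?_).choose_spec, hv1, hvK⟩
  refine ⟨hK, hv1, by simp, by simp [c.p_one], by simp [c.p_one, hv1], hvK, by simp [c.s_last],
    by simp [c.s_last, hv1], ?_, ?_, ?_, ?_, ?_, ?_, c.sign⟩
  · intro k h1 h2
    rw [← cross_add_left, hps k h1 h2, cross_smul_left]
  · intro k h1 h2
    rw [← cross_add_right, hps k h1 h2, cross_smul_right]
  · intro k h1 h2
    obtain ⟨r, hr⟩ := c.exists_rec k h1 h2
    exact nonneg_of_rec (hWp k h1 h2) hr.1 (c.rec_v k h1 h2 r hr) (c.rec_p k h1 h2 r hr)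
      (by rw [← hW k h1 h2]; exact c.rec_s k h1 h2 r hr)
  -- The region beyond the first edge also lies beyond the last edge of the other chain. The leg at
  -- the far end of that edge is the additional constraint which gives `n 1 ≥ 1`.
  · obtain ⟨r, hr⟩ := c.exists_rec 1 le_rfl hK
    have e1 : cross (v' K') (v 1) = 1 := by
      rw [h2, cross_sub_left, cross_self, cross_comm u, hv1]; rfl
    have e2 : cross (v' K') (p' K' - v' K') = 1 := by
      rw [cross_sub_right, cross_self, cross_comm, c'.cross_p K' hK' le_rfl]; rfl
    have e3 := sub_eq_cross_smul e1 e2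
    refine one_le_of_rec (hWp 1 le_rfl hK) hr.1 (c.rec_v 1 le_rfl hK r hr)
      (c.rec_p 1 le_rfl hK r hr) (by rw [← hW 1 le_rfl hK]; exact c.rec_s 1 le_rfl hK r hr)
      (m := -cross (p' K' - v' K') (v 1)) ?_
    have := c'.rec_p K' hK' le_rfl r (hO2 ▸ hr)
    rw [e3] at this
    rw [c.p_one, neg_smul, ← smul_neg, neg_sub, ← h2]
    exact this
  -- The same at the other end, where the first edge of the other chain supplies the additional leg.
  · obtain ⟨r, hr⟩ := c.exists_rec K hK le_rfl
    have hWK := hWs K hK le_rfl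
    rw [c.s_last, ← h1] at hWK
    have e1 : cross (v' 1) (-v K) = 1 := by
      rw [cross_neg_right, cross_comm, hWK]; rfl
    have e2 : cross (v' 1) (v' 1 - s' 1) = 1 := by
      rw [cross_sub_right, cross_self, c'.cross_s 1 le_rfl hK']; rfl
    have e3 := sub_eq_cross_smul e1 e2
    have e4 := c.rec_s K hK le_rfl r hr
    have e5 := c.rec_p K hK le_rfl r hr
    have e6 := c'.rec_s 1 le_rfl hK' r (hO1 ▸ hr)
    have e7 : p K - v K = v' 1 + (-n K) • v K := by
      rw [h1, ← c.s_last, hW K hK le_rfl]; simp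
    rw [c.s_last, ← h1] at e4
    rw [e7] at e5
    rw [e3] at e6
    exact one_le_of_rec' hWK hr.1 (c.rec_v K hK le_rfl r hr) e4 e5 e6
  · intro k h1 h2
    rcases c.step k h1 h2 with ⟨e1, e2, e3⟩ | ⟨e1, e2⟩
    · left
      simp [hn, e1, e2, e3]
    · right
      simp [e1, e2]

end Drawing
end PlaneTropical

/-! ### Closing up the boundary of a face, and the contradiction. -/

namespace PlaneTropical
namespace Drawing

variable {V E : Type} {D : Drawing V E} [Finite V]

/-- Edges which separate the same two regions are parallel. -/
lemma vec_eq_of_left_eq [Finite E] (hs : ∀ p ∈ D.support, IsSmoothAt D.support p)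
    {δ ε : E × Bool} (h : D.left δ = D.left ε) (h' : D.left (rev δ) = D.left (rev ε)) :
    D.vec δ = D.vec ε := by
  obtain ⟨m, hm⟩ := D.arc_nonempty δ.1
  -- The second arc is in the closure of both regions, hence in both closed half-planes bounded by
  -- the line of the first.
  have key : ∀ q ∈ D.arc ε.1, cross (toPlane (D.vec δ)) (q - m) = 0 := by
    intro q hq
    have h1 := D.cross_nonneg_of_mem_closure hs (h ▸ D.arc_subset_closure_left ε hq)
      (subset_closure hm)
    have h2 := D.cross_nonneg_of_mem_closure hs (δ := rev δ)
      (h' ▸ D.arc_closure_left_rev ε hq) (subset_closure hm)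
    rw [vec_rev, toPlane_neg, cross_neg_left] at h2
    linarith
  have hsrc : D.src (ε.1, true) = some (D.tail ε.1) := rfl
  have hl := D.len_pos ε.1
  have h3 := key _ (D.mem_arc_of_small hsrc (t := D.len ε.1 / 2) (by positivity) (by simp; linarith))
  have h4 := key _ (D.mem_arc_of_small hsrc (t := D.len ε.1 / 3) (by positivity) (by simp; linarith))
  have h5 : cross (D.vec δ) (D.dir ε.1) = 0 := by
    have : (D.len ε.1 / 6) * cross (toPlane (D.vec δ)) (toPlane (D.dir ε.1)) = 0 := by
      have hve : D.vec (ε.1, true) = D.dir ε.1 := rfl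
      rw [hve] at h3 h4
      rw [add_sub_right_comm, cross_add_right, cross_smul_right] at h3 h4
      linarith
    rw [cross_toPlane] at this
    rcases mul_eq_zero.1 this with h | h
    · linarith
    · exact_mod_cast h
  have h6 : cross (D.vec δ) (D.vec ε) = 0 := by
    rcases D.vec_eq_or ε with h | h <;> rw [h] at h5
    · exact h5
    · rw [cross_neg_right] at h5; linarith
  rcases (D.vec_prim δ).eq_or_neg (D.vec_prim ε) h6 with h7 | h7
  · exact h7
  -- With opposite vectors the common left region would lie on both sides of this line.
  · exfalso
    obtain ⟨z, hz⟩ := D.left_nonempty δ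
    obtain ⟨q, hq⟩ := D.arc_nonempty ε.1
    have e1 := D.left_cross_pos hs hz hm
    have e2 := D.left_cross_pos hs (h ▸ hz) hq
    have e3 := key q hq
    rw [h7, toPlane_neg, cross_neg_left] at e1 e3
    rw [cross_sub_right] at e1 e2 e3
    linarith

variable [Fintype E]

section
variable {L : ℝ} {T : D.ThetaData L} (hs : ∀ p ∈ D.support, IsSmoothAt D.support p)
  {F F' : Set Plane} {k k' m : Fin 3}
include hs

omit hs [Finite V] in
lemma ThetaData.IsFace.left_eq (hF' : T.IsFace F' k') (hne : F ≠ F') {δ : E × Bool} {i : Fin 3}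
    (hi : i ≠ k') (hδ : D.left (rev δ) = F) (hc : T.cls δ.1 = some i) : D.left δ = F' := by
  obtain ⟨b, hb⟩ := hF'.exists_left hi hc
  have : (δ.1, b) = δ ∨ (δ.1, b) = rev δ := by
    obtain ⟨e, c⟩ := δ
    cases b <;> cases c <;> simp [rev]
  rcases this with h | h
  · rwa [h] at hb
  · rw [h, hδ] at hb
    exact absurd hb hne

lemma ThetaData.IsFace.ne (hF : T.IsFace F k) (hF' : T.IsFace F' k') (hL : 0 < L) (h : k ≠ k') :
    F ≠ F' := by
  rintro rfl
  obtain ⟨e, he⟩ := T.exists_cls hL k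
  obtain ⟨b, hb⟩ := hF'.exists_left h he
  obtain ⟨i, hi, hi'⟩ := hF.exists_cls hs hb
  rw [he, Option.some.injEq] at hi'
  exact hi hi'.symm

/-- The boundary of a face closes up. -/
lemma ThetaData.IsFace.eq_neg_one_of_bound (hinj : Function.Injective D.pos) (hF : T.IsFace F k)
    (hmk : m ≠ k') (hm : m ≠ k) (hkk : k ≠ k') (φ : Plane →ₗ[ℝ] ℝ)
    (h1 : ∀ δ, D.left (rev δ) = F → T.cls δ.1 = some m → φ (toPlane (D.vec δ)) = 1)
    (h2 : ∀ δ, D.left (rev δ) = F → T.cls δ.1 = some k' → -1 ≤ φ (toPlane (D.vec δ)))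
    {δ : E × Bool} (hδ : D.left (rev δ) = F) (hcl : T.cls δ.1 = some k') :
    φ (toPlane (D.vec δ)) = -1 := by
  classical
  have hfl := D.isFlow_boundary hs hinj hF.bdd
  have h0 := hfl.sum_mul (fun v => φ (D.pos v))
  -- The increments of `φ` along the closed boundary of `F`; their sum is zero by `IsFlow.sum_mul`.
  set f : E → ℝ := fun e => D.boundary F e * (φ (D.pos (D.tail e)) -
    (D.head e).elim 0 fun v => φ (D.pos v)) with hf
  have hterm : ∀ ε, D.left (rev ε) = F → f ε.1 = D.len ε.1 * φ (toPlane (D.vec ε)) := by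
    intro ε hε
    have hd : dval (D.boundary F) ε = -1 := by
      rw [dval_boundary, if_pos hε, if_neg]
      · norm_num
      · rw [← hε]; exact D.left_ne_left_rev hs _
    obtain ⟨w, hw⟩ : ∃ w, D.head ε.1 = some w := by
      cases hh : D.head ε.1 with
      | some w => exact ⟨w, rfl⟩
      | none =>
        have := hfl.1 _ hh
        simp [dval, this] at hd
    have hp := D.pos_head _ w hw
    obtain ⟨e, b⟩ := ε
    simp only at hw hp
    cases b
    · simp only [dval, Bool.false_eq_true, if_false, neg_inj] at hd
      simp [hf, hw, hp, hd, vec, toPlane_neg]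
    · simp only [dval, if_true] at hd
      simp [hf, hw, hp, hd, vec]
  have hdart : ∀ e i, i ≠ k → T.cls e = some i → ∃ ε : E × Bool, ε.1 = e ∧ D.left (rev ε) = F := by
    intro e i hi he
    obtain ⟨b, hb⟩ := hF.exists_left hi he
    exact ⟨rev (e, b), rfl, by rwa [rev_rev]⟩
  -- The strands `m` and `k'` both have length `L`, so the correction leaves the sum zero while
  -- every summand becomes nonnegative. This is where the equality of the lengths enters.
  set G : E → ℝ := fun e => f e - (if T.cls e = some m then D.len e else 0) +
    (if T.cls e = some k' then D.len e else 0) with hG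
  have hGs : ∑ e, G e = 0 := by
    rw [Finset.sum_add_distrib, Finset.sum_sub_distrib, h0, T.len_sum, T.len_sum]; ring
  have hmk' : ∀ e, T.cls e = some k' → T.cls e ≠ some m := by
    intro e he he'
    rw [he, Option.some.injEq] at he'
    exact hmk he'.symm
  have hGr : ∀ ε : E × Bool, D.left (rev ε) = F → T.cls ε.1 = some k' →
      G ε.1 = D.len ε.1 * (φ (toPlane (D.vec ε)) + 1) := by
    intro ε hε he
    rw [hG]
    simp only
    rw [hterm ε hε, if_neg (hmk' _ he), if_pos he]
    ring
  have hG0 : ∀ e ∈ Finset.univ, 0 ≤ G e := by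
    intro e _
    cases hc : T.cls e with
    | none =>
      have : D.boundary F e = 0 := by
        obtain ⟨x, -, -, -, hx⟩ := hF.exists_coeff
        rw [hx, hc]; simp
      simp [hG, hf, hc, this]
    | some i =>
      have hi : i = k ∨ i = k' ∨ i = m := by clear hc; omega
      rcases hi with rfl | rfl | rfl
      · have : D.boundary F e = 0 := by
          obtain ⟨x, -, hx0, -, hx⟩ := hF.exists_coeff
          rw [hx, hc]; simp [hx0]
        simp [hG, hf, hc, this, hm.symm, hkk]
      · obtain ⟨ε, rfl, hε⟩ := hdart e i hkk.symm hc
        rw [hGr ε hε hc]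
        exact mul_nonneg (D.len_pos _).le (by linarith [h2 ε hε hc])
      · obtain ⟨ε, rfl, hε⟩ := hdart e i hm hc
        simp [hG, hterm ε hε, h1 ε hε hc, hc, hmk]
  have := (Finset.sum_eq_zero_iff_of_nonneg hG0).1 hGs δ.1 (Finset.mem_univ _)
  rw [hGr δ hδ hcl] at this
  rcases mul_eq_zero.1 this with h | h
  · exact absurd h (D.len_pos _).ne'
  · linarith

namespace Circuit

variable (hinj : Function.Injective D.pos) (hL : 0 < L)
  (hF : T.IsFace F k) (hF' : T.IsFace F' k') (hkk : k ≠ k') (hmk : m ≠ k') (c : Circuit T F m k')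

include hF hF' hkk hmk hL in
lemma left_zero : D.left (c.dart 0) = F' :=
  hF'.left_eq (hF.ne hs hF' hL hkk) hmk (c.right 0) c.cls_zero

include hF hF' hkk hmk hL in
lemma left_last : D.left (c.dart (c.K + 1)) = F' :=
  hF'.left_eq (hF.ne hs hF' hL hkk) hmk (c.right _) c.cls_last

include hF' in
lemma left_ne {n : ℕ} (h1 : 1 ≤ n) (h2 : n ≤ c.K) : D.left (c.dart n) ≠ F' := by
  intro h
  obtain ⟨i, hi, hi'⟩ := hF'.exists_cls hs h
  rw [c.cls_mid n h1 h2, Option.some.injEq] at hi'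
  exact hi hi'.symm

include hF hF' hkk hmk hL

lemma vec_eq {δ : E × Bool} (hδ : D.left (rev δ) = F) (hc : T.cls δ.1 = some m) :
    D.vec δ = D.vec (c.dart 0) := by
  apply vec_eq_of_left_eq hs
  · rw [hF'.left_eq (hF.ne hs hF' hL hkk) hmk hδ hc, c.left_zero hs hL hF hF' hkk hmk]
  · rw [hδ, c.right 0]

lemma turn_zero : D.src (rev (c.dart 0)) = some c.a ∧
    cross (D.vec (c.dart 0)) (D.vec (c.dart 1)) = -1 ∧ ∃ g, D.src g = some c.a ∧
      D.vec g = D.vec (c.dart 0) - D.vec (c.dart 1) ∧ D.left g = F' ∧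
      D.left (rev g) = D.left (c.dart 1) := by
  obtain ⟨v, h1, h2, h3, h4 | h4⟩ := c.succ 0
  · rw [c.left_zero hs hL hF hF' hkk hmk] at h4
    exact absurd h4.2 (c.left_ne hs hF' le_rfl c.one_le)
  · have h5 := c.src_a
    rw [zero_add] at h2 h4
    rw [h5, Option.some.injEq] at h2
    subst h2
    rw [c.left_zero hs hL hF hF' hkk hmk] at h4
    exact ⟨h1, h4⟩

lemma turn_last : D.src (rev (c.dart c.K)) = some c.b ∧
    cross (D.vec (c.dart c.K)) (D.vec (c.dart 0)) = -1 ∧ ∃ g, D.src g = some c.b ∧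
      D.vec g = D.vec (c.dart c.K) - D.vec (c.dart 0) ∧ D.left g = D.left (c.dart c.K) ∧
      D.left (rev g) = F' := by
  have hl := c.left_last hs hL hF hF' hkk hmk
  obtain ⟨v, h1, h2, h3, h4 | h4⟩ := c.succ c.K
  · rw [hl] at h4
    exact absurd h4.2.symm (c.left_ne hs hF' c.one_le le_rfl)
  · rw [c.src_b, Option.some.injEq] at h2
    subst h2
    rw [hl, c.vec_eq hs hL hF hF' hkk hmk (c.right _) c.cls_last] at h4
    exact ⟨h1, h4⟩

include hinj

/-- A bounded region beyond the strand would be a face bordering `F` along all of it, so the first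
and last directions would agree. But the cross products with `u` at the two ends have opposite
signs. -/
lemma not_isBounded {n : ℕ} (h1 : 1 ≤ n) (h2 : n ≤ c.K) :
    ¬ Bornology.IsBounded (D.left (c.dart n)) := by
  intro hb
  obtain ⟨i, hi, hG⟩ := T.exists_isFace hs hinj hL (c.cls_mid n h1 h2) hb
  have hne : F ≠ D.left (c.dart n) := fun h =>
    D.left_ne_left_rev hs (c.dart n) (h.symm.trans (c.right n).symm)
  have e : D.vec (c.dart 1) = D.vec (c.dart c.K) := by
    apply vec_eq_of_left_eq hs
    · rw [hG.left_eq hne hi (c.right _) (c.cls_mid 1 le_rfl c.one_le),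
        hG.left_eq hne hi (c.right _) (c.cls_mid _ c.one_le le_rfl)]
    · rw [c.right, c.right]
  have t1 := (c.turn_zero hs hL hF hF' hkk hmk).2.1
  have t2 := (c.turn_last hs hL hF hF' hkk hmk).2.1
  rw [e, cross_comm, t2] at t1
  norm_num at t1

/-- The closure of the convex region `F` contains the turning point `v` and the end `b` of the
strand, and lies to the right of every boundary edge. If the sign changed back at `v`, the
half-planes of the four edges at `v` and `b` would force these points to coincide. -/
lemma sign {n : ℕ} (h1 : 1 ≤ n) (h2 : n < c.K)
    (hX : cross (D.vec (c.dart n)) (D.vec (c.dart 0)) < 0) :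
    cross (D.vec (c.dart (n + 1))) (D.vec (c.dart 0)) < 0 := by
  obtain ⟨v, hv, hv', -, h4 | h4⟩ := c.succ n
  · rwa [h4.1]
  by_contra hX'
  push Not at hX'
  obtain ⟨hb, hbc, -⟩ := c.turn_last hs hL hF hF' hkk hmk
  have hR : ∀ {i z y}, z ∈ closure F → y ∈ closure (D.arc (c.dart i).1) →
      cross (toPlane (D.vec (c.dart i))) (z - y) ≤ 0 := by
    intro i z y hz hy
    have := D.cross_nonneg_of_mem_closure hs (δ := rev (c.dart i)) (by rwa [c.right i]) hy
    rw [vec_rev, toPlane_neg, cross_neg_left] at this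
    linarith
  have hvF : D.pos v ∈ closure F := by
    have := D.pos_mem_closure_left hv
    rwa [c.right n] at this
  have hbF : D.pos c.b ∈ closure F := by
    have := D.pos_mem_closure_left hb
    rwa [c.right c.K] at this
  have hvn : D.pos v ∈ closure (D.arc (c.dart n).1) := D.pos_mem_closure_arc (δ := rev (c.dart n)) hv
  have hvn' : D.pos v ∈ closure (D.arc (c.dart (n + 1)).1) := D.pos_mem_closure_arc hv'
  have hbK : D.pos c.b ∈ closure (D.arc (c.dart c.K).1) := D.pos_mem_closure_arc (δ := rev (c.dart c.K)) hb
  have hbK' : D.pos c.b ∈ closure (D.arc (c.dart (c.K + 1)).1) := D.pos_mem_closure_arc c.src_b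
  have i1 := hR hbF hvn
  have i2 := hR hbF hvn'
  have i3 := hR hvF hbK
  have i4 := hR hvF hbK'
  rw [c.vec_eq hs hL hF hF' hkk hmk (c.right _) c.cls_last] at i4
  set a := D.vec (c.dart n)
  set b := D.vec (c.dart (n + 1))
  set u := D.vec (c.dart 0) with hu
  set w := D.pos c.b - D.pos v with hw
  have hw' : D.pos v - D.pos c.b = -w := by rw [hw]; abel
  rw [hw', cross_neg_right] at i3 i4
  have hXr : cross (toPlane a) (toPlane u) < 0 := by rw [cross_toPlane]; exact_mod_cast hX
  have hXr' : 0 ≤ cross (toPlane b) (toPlane u) := by rw [cross_toPlane]; exact_mod_cast hX'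
  have hab : cross (toPlane a) (toPlane b) = -1 := by rw [cross_toPlane, h4.1]; norm_num
  have hKu : cross (toPlane (D.vec (c.dart c.K))) (toPlane u) = -1 := by
    rw [cross_toPlane, hbc]; norm_num
  have hdec := cross_smul_eq (toPlane a) (toPlane b) (toPlane u)
  -- Expanding `u` in the two directions at the turning point shows that `cross u w` is nonpositive;
  -- the edge of direction `u` leaving `b` shows that it is nonnegative.
  have hcu : cross (toPlane u) w = cross (toPlane b) (toPlane u) * cross (toPlane a) w -
      cross (toPlane a) (toPlane u) * cross (toPlane b) w := by
    have := congrArg (fun z => cross z w) hdec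
    simp only [cross_add_left, cross_smul_left, hab] at this
    rw [cross_comm (toPlane u) (toPlane b)] at this
    linarith
  have hz : cross (toPlane u) w = 0 := by nlinarith
  have hu0 : toPlane u ≠ 0 := D.toPlane_vec_ne_zero _
  have hwu : cross w (toPlane u) = 0 := by rw [cross_comm, hz, neg_zero]
  obtain ⟨t, ht⟩ := eq_smul_of_cross_eq_zero hu0 hwu
  rw [ht, cross_smul_right] at i1 i3
  rw [hKu] at i3
  have ht0 : t = 0 := by nlinarith
  rw [ht0, zero_smul, hw, sub_eq_zero] at ht
  have hvb := hinj ht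
  rw [← hvb] at hv hv'
  have e := D.dart_eq_of_left_rev_eq hs hinj hv' c.src_b ((c.right _).trans (c.right _).symm)
  have e1 := c.cls_mid (n + 1) (by omega) h2
  rw [e, c.cls_last, Option.some.injEq] at e1
  exact hmk e1

/-- At each turn the third leg separates the outer regions of the two consecutive darts, so
`cross_isRec_nonneg` on both sides of this leg gives the inequalities for recession directions.
Straight passages keep the outer region. -/
lemma chain : ∃ p s, Chain (D.vec (c.dart 0)) c.K (fun n => D.vec (c.dart n)) p s
    (fun n => D.left (c.dart n)) := by
  obtain ⟨p, s, hp, hs', hst⟩ := exists_prev_next (fun n => D.vec (c.dart n)) (D.vec (c.dart 0)) c.K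
  have hstep : ∀ n, (D.vec (c.dart (n + 1)) = D.vec (c.dart n) ∧
      D.left (c.dart (n + 1)) = D.left (c.dart n)) ∨
      (D.vec (c.dart (n + 1)) ≠ D.vec (c.dart n) ∧
        cross (D.vec (c.dart n)) (D.vec (c.dart (n + 1))) = -1 ∧
        (∀ r, IsRec (D.left (c.dart n)) r →
          0 ≤ cross (toPlane (D.vec (c.dart n) - D.vec (c.dart (n + 1)))) r) ∧
        (∀ r, IsRec (D.left (c.dart (n + 1))) r →
          cross (toPlane (D.vec (c.dart n) - D.vec (c.dart (n + 1)))) r ≤ 0)) := by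
    intro n
    obtain ⟨v, -, -, -, h4 | ⟨h4, g, -, hg, hg', hg''⟩⟩ := c.succ n
    · exact Or.inl h4
    · refine Or.inr ⟨fun h => ?_, h4, fun r hr => ?_, fun r hr => ?_⟩
      · rw [h, cross_self] at h4
        norm_num at h4
      · rw [← hg]
        exact D.cross_isRec_nonneg hs (hg' ▸ hr)
      · have := D.cross_isRec_nonneg hs (δ := rev g) (hg'' ▸ hr)
        rw [vec_rev, toPlane_neg, cross_neg_left] at this
        rw [← hg]
        linarith
  have t1 := (c.turn_zero hs hL hF hF' hkk hmk).2.1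
  have t2 := (c.turn_last hs hL hF hF' hkk hmk).2.1
  have hP : ∀ n, 1 ≤ n → n ≤ c.K → cross (p n) (D.vec (c.dart n)) = -1 ∧
      ∀ r, IsRec (D.left (c.dart n)) r → cross (toPlane (p n - D.vec (c.dart n))) r ≤ 0 := by
    intro n h1
    induction n, h1 using Nat.le_induction with
    | base =>
      intro _
      rw [hp]
      refine ⟨t1, ?_⟩
      rcases hstep 0 with h | h
      · rw [zero_add] at h
        rw [h.1, cross_self] at t1
        norm_num at t1
      · exact h.2.2.2
    | succ n h1 ih =>
      intro hn
      obtain ⟨i1, i2⟩ := ih (by omega)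
      rcases hst n h1 hn with ⟨e1, e2, e3⟩ | ⟨e1, e2, e3⟩
      · rcases hstep n with h | h
        · rw [h.1, h.2, e2]
          exact ⟨i1, i2⟩
        · exact absurd e1 h.1
      · rcases hstep n with h | h
        · exact absurd h.1 e1
        · rw [e3]
          exact ⟨h.2.1, h.2.2.2⟩
  have hS : ∀ n, n ≤ c.K → 1 ≤ n → cross (D.vec (c.dart n)) (s n) = -1 ∧
      ∀ r, IsRec (D.left (c.dart n)) r → 0 ≤ cross (toPlane (D.vec (c.dart n) - s n)) r := by
    intro n hn
    induction hn using Nat.decreasingInduction with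
    | self =>
      intro _
      rw [hs']
      refine ⟨t2, ?_⟩
      have hl := c.vec_eq hs hL hF hF' hkk hmk (c.right (c.K + 1)) c.cls_last
      rcases hstep c.K with h | h
      · rw [hl] at h
        rw [← h.1, cross_self] at t2
        norm_num at t2
      · rw [hl] at h
        exact h.2.2.1
    | of_succ n hn ih =>
      intro h1
      obtain ⟨i1, i2⟩ := ih (by omega)
      rcases hst n h1 hn with ⟨e1, e2, e3⟩ | ⟨e1, e2, e3⟩
      · rcases hstep n with h | h
        · rw [h.1, h.2, e3] at i2
          rw [h.1, e3] at i1
          exact ⟨i1, i2⟩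
        · exact absurd e1 h.1
      · rcases hstep n with h | h
        · exact absurd h.1 e1
        · rw [e2]
          exact ⟨h.2.1, h.2.2.1⟩
  refine ⟨p, s, ⟨c.one_le, hp, hs', ?_, fun n h1 h2 => (hP n h1 h2).1,
    fun n h1 h2 => (hS n h2 h1).1, ?_, ?_, fun n h1 h2 => (hP n h1 h2).2,
    fun n h1 h2 => (hS n h2 h1).2, fun n h1 h2 => c.sign hs hinj hL hF hF' hkk hmk h1 h2⟩⟩
  · intro n h1 h2
    rcases hst n h1 h2 with h | h
    · exact Or.inl h
    · exact Or.inr h.2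
  · intro n h1 h2
    exact D.exists_isRec_left hs (c.not_isBounded hs hinj hL hF hF' hkk hmk h1 h2)
  · intro n _ _ r hr
    exact D.cross_isRec_nonneg hs hr

/-- The boundary walks of two adjacent faces continue each other. -/
lemma match_ends (hm : m ≠ k) (c' : Circuit T F' m k) :
    D.vec (c'.dart 0) = -D.vec (c.dart 0) ∧
    D.vec (c'.dart 1) = D.vec (c.dart c.K) - D.vec (c.dart 0) ∧
    D.vec (c'.dart c'.K) = D.vec (c.dart 1) - D.vec (c.dart 0) ∧
    D.left (c'.dart 1) = D.left (c.dart c.K) ∧ D.left (c'.dart c'.K) = D.left (c.dart 1) := by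
  have h0 := c'.left_zero hs hL hF' hF hkk.symm hm
  have hu : D.vec (c'.dart 0) = -D.vec (c.dart 0) := by
    have := c.vec_eq hs hL hF hF' hkk hmk (δ := rev (c'.dart 0)) (by rwa [rev_rev]) c'.cls_zero
    rw [← this, vec_rev, neg_neg]
  obtain ⟨z1, -, g, hg1, hg2, hg3, hg4⟩ := c.turn_zero hs hL hF hF' hkk hmk
  obtain ⟨l1, -, g', hg1', hg2', hg3', hg4'⟩ := c.turn_last hs hL hF hF' hkk hmk
  obtain ⟨z2, -⟩ := c'.turn_zero hs hL hF' hF hkk.symm hm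
  obtain ⟨l2, -⟩ := c'.turn_last hs hL hF' hF hkk.symm hm
  -- If both walks began their strands at the same vertex, the third leg `g` there would be the
  -- reverse of the first dart of `c'`, which forces `D.vec (c.dart 1) = 0`.
  have hne : c'.a ≠ c.a := by
    intro h
    rw [h] at z2
    have := D.dart_eq_of_left_eq hs hinj z2 hg1 ((c'.right 0).trans hg3.symm)
    rw [← this, vec_rev, hu, neg_neg, eq_comm, sub_eq_self] at hg2
    exact (D.vec_prim _).ne_zero hg2
  have hab : c'.a = c.b ∧ c'.b = c.a := by
    rcases c.ends with ⟨h1, h2⟩ | ⟨h1, h2⟩ <;> rcases c'.ends with ⟨h3, h4⟩ | ⟨h3, h4⟩ <;>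
      rw [h1, h3] at hne <;> first | exact absurd rfl hne | exact ⟨by rw [h2, h3], by rw [h1, h4]⟩
  have e1 : c'.dart 1 = g' := by
    refine D.dart_eq_of_left_rev_eq hs hinj c'.src_a (hab.1 ▸ hg1') ?_
    rw [c'.right, hg4']
  have e2 : rev (c'.dart c'.K) = g := by
    refine D.dart_eq_of_left_eq hs hinj l2 (hab.2 ▸ hg1) ?_
    rw [c'.right, hg3]
  refine ⟨hu, by rw [e1, hg2'], ?_, by rw [e1, hg3'], ?_⟩
  · rw [← rev_rev (c'.dart c'.K), e2, vec_rev, hg2]; abel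
  · rw [← rev_rev (c'.dart c'.K), e2, hg4]

/-- The form `φ` is `1` on the direction of the common strand and at least `-1` on the other, so
equality of lengths makes it `-1` there. The first dart gives `a = -1`; the last then has
coordinates `(-1, -2)` in the basis of the first dart and `u`. -/
lemma vec_sum (hm : m ≠ k) (c' : Circuit T F' m k) :
    D.vec (c.dart 1) + D.vec (c.dart c.K) = -(2 : ℤ) • D.vec (c.dart 0) := by
  obtain ⟨p, s, hc⟩ := c.chain hs hinj hL hF hF' hkk hmk
  obtain ⟨p', s', hc'⟩ := c'.chain hs hinj hL hF' hF hkk.symm hm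
  obtain ⟨-, e1, e2, e3, e4⟩ := c.match_ends hs hinj hL hF hF' hkk hmk hm c'
  obtain ⟨a, ha, hv1, hvK⟩ := hc.exists_bound hc' e1 e2 e3 e4
  set u := D.vec (c.dart 0) with hu
  set v := D.vec (c.dart 1)
  let φ : Plane →ₗ[ℝ] ℝ :=
    { toFun := fun x => a * cross x (toPlane u) + cross (toPlane v) x
      map_add' := fun x y => by rw [cross_add_left, cross_add_right]; ring
      map_smul' := fun r x => by
        rw [cross_smul_left, cross_smul_right]; simp; ring }
  have hφ : ∀ w : Fin 2 → ℤ, φ (toPlane w) = ((a * cross w u + cross v w : ℤ) : ℝ) := by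
    intro w
    change a * cross (toPlane w) (toPlane u) + cross (toPlane v) (toPlane w) = _
    rw [cross_toPlane, cross_toPlane]; push_cast; ring
  have key := fun (δ : E × Bool) (hδ : D.left (rev δ) = F) => hF.eq_neg_one_of_bound hs hinj
    hmk hm hkk φ (fun δ hδ hcl => by
      rw [c.vec_eq hs hL hF hF' hkk hmk hδ hcl, hφ, cross_self, hv1]; norm_num)
    (fun δ hδ hcl => by
      obtain ⟨i, h1, h2, rfl⟩ := c.cover δ hδ hcl
      rw [hφ]
      exact_mod_cast ha i h1 h2) hδ
  have k1 := key _ (c.right 1) (c.cls_mid 1 le_rfl c.one_le)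
  have k2 := key _ (c.right c.K) (c.cls_mid _ c.one_le le_rfl)
  rw [hφ] at k1 k2
  have k1' : a * cross v u + cross v v = -1 := by exact_mod_cast k1
  have k2' : a * cross (D.vec (c.dart c.K)) u + cross v (D.vec (c.dart c.K)) = -1 := by
    exact_mod_cast k2
  rw [cross_self, hv1] at k1'
  rw [hvK] at k2'
  have hdec := cross_smul_eq v u (D.vec (c.dart c.K))
  rw [hv1, hvK, one_smul, show cross v (D.vec (c.dart c.K)) = -2 by linarith] at hdec
  rw [hdec]
  simp

end Circuit

/-- A smooth plane tropical curve does not contain an equilateral theta graph. -/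
theorem ThetaData.false (T : D.ThetaData L) (hinj : Function.Injective D.pos) (hL : 0 < L) :
    False := by
  obtain ⟨F, F', k, k', hkk, hF, hF'⟩ := T.exists_two_faces hs hinj hL
  obtain ⟨m, hmk, hmk'⟩ : ∃ m, m ≠ k ∧ m ≠ k' := by
    clear hF hF'
    revert k k'
    decide
  obtain ⟨c⟩ := hF.exists_circuit hs hinj hL hmk hkk.symm hmk'
  obtain ⟨c'⟩ := hF'.exists_circuit hs hinj hL hmk' hkk hmk
  have h1 := c.vec_sum hs hinj hL hF hF' hkk hmk' hmk c'
  have h2 := c'.vec_sum hs hinj hL hF' hF hkk.symm hmk hmk' c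
  obtain ⟨e0, e1, e2, -, -⟩ := c.match_ends hs hinj hL hF hF' hkk hmk' hmk c'
  rw [e0, e1, e2] at h2
  -- The sum of the first and last directions is `-2u` by the walk around `F`, and `4u` by the walk
  -- around `F'`.
  apply (D.vec_prim (c.dart 0)).ne_zero
  ext i
  have h3 := congrFun h1 i
  have h4 := congrFun h2 i
  simp at h3 h4 ⊢
  linarith

end

end Drawing
end PlaneTropical

/-! ### Flows on abstract curves and invariance under modification. -/

namespace AbstractTropicalCurve

noncomputable instance fintypeE (Γ : AbstractTropicalCurve) : Fintype Γ.E := Fintype.ofFinite _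

/-- An orientation of all edges. -/
def IsOrientation (Γ : AbstractTropicalCurve) (o : Γ.E → Γ.V × Γ.V) : Prop :=
  ∀ e, Γ.ends e = s((o e).1, (o e).2)

/-- A flow, with respect to an orientation: the pairing with every coboundary vanishes. -/
def IsFlow (Γ : AbstractTropicalCurve) (o : Γ.E → Γ.V × Γ.V) (ω : Γ.E → ℝ) : Prop :=
  ∀ σ : Γ.V → ℝ, ∑ e, ω e * (σ (o e).2 - σ (o e).1) = 0

/-- The edges which carry flow form a theta graph all of whose three strands have length `L`. -/
structure ThetaLike (Γ : AbstractTropicalCurve) (L : ℝ) (o : Γ.E → Γ.V × Γ.V)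
    (cls : Γ.E → Option (Fin 3)) (sgn : Γ.E → ℝ) : Prop where
  ends : Γ.IsOrientation o
  sgn_eq : ∀ e, sgn e = 1 ∨ sgn e = -1
  flow_iff : ∀ ω, Γ.IsFlow o ω ↔
    ∃ x : Fin 3 → ℝ, x 0 + x 1 + x 2 = 0 ∧ ∀ e, ω e = sgn e * (cls e).elim 0 x
  len_sum : ∀ i, ∑ e, (if cls e = some i then Γ.length e else 0) = ENNReal.ofReal L
  uniform : ∃ P Q, ∀ v e e' i j, v ∈ Γ.ends e → v ∈ Γ.ends e' → cls e = some i → cls e' = some j →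
    i ≠ j → v = P ∨ v = Q

variable {Γ Γ' : AbstractTropicalCurve} {L : ℝ}

/-- Reversing an edge changes the sign of every flow on it, which `sgn` absorbs. -/
lemma ThetaLike.reorient {o o' : Γ.E → Γ.V × Γ.V} {cls : Γ.E → Option (Fin 3)} {sgn : Γ.E → ℝ}
    (h : Γ.ThetaLike L o cls sgn) (h' : Γ.IsOrientation o') : ∃ sgn', Γ.ThetaLike L o' cls sgn' := by
  have hτ : ∀ e, ∃ τ : ℝ, (τ = 1 ∨ τ = -1) ∧ ∀ σ : Γ.V → ℝ,
      σ (o' e).2 - σ (o' e).1 = τ * (σ (o e).2 - σ (o e).1) := by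
    intro e
    have := (h.ends e).symm.trans (h' e)
    rcases Sym2.eq_iff.1 this with ⟨h1, h2⟩ | ⟨h1, h2⟩
    · exact ⟨1, Or.inl rfl, fun σ => by rw [h1, h2, one_mul]⟩
    · exact ⟨-1, Or.inr rfl, fun σ => by rw [h1, h2]; ring⟩
  choose τ hτ1 hτ2 using hτ
  have hττ : ∀ e, τ e * τ e = 1 := by
    intro e; rcases hτ1 e with h | h <;> rw [h] <;> norm_num
  refine ⟨fun e => τ e * sgn e, h', fun e => ?_, fun ω => ?_, h.len_sum, h.uniform⟩
  · rcases hτ1 e with h1 | h1 <;> rcases h.sgn_eq e with h2 | h2 <;> simp [h1, h2]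
  · have h1 : Γ.IsFlow o' ω ↔ Γ.IsFlow o fun e => τ e * ω e := by
      refine forall_congr' fun σ => ?_
      simp_rw [hτ2]
      rw [Finset.sum_congr rfl fun e _ => show ω e * (τ e * (σ (o e).2 - σ (o e).1)) =
        τ e * ω e * (σ (o e).2 - σ (o e).1) by ring]
    rw [h1, h.flow_iff]
    refine exists_congr fun x => and_congr_right fun _ => forall_congr' fun e => ?_
    constructor <;> intro h2
    · rw [mul_assoc, ← h2, ← mul_assoc, hττ, one_mul]
    · rw [h2, ← mul_assoc, ← mul_assoc, hττ, one_mul]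

lemma exists_isOrientation (Γ : AbstractTropicalCurve) : ∃ o, Γ.IsOrientation o := by
  have : ∀ e, ∃ p : Γ.V × Γ.V, Γ.ends e = s(p.1, p.2) := fun e =>
    Sym2.ind (f := fun z => ∃ p : Γ.V × Γ.V, z = s(p.1, p.2)) (fun a b => ⟨(a, b), rfl⟩) _
  choose o ho using this
  exact ⟨o, ho⟩

/-- `Γ` has an equilateral theta graph as its essential part. -/
def HasTheta (Γ : AbstractTropicalCurve) (L : ℝ) : Prop :=
  ∀ o, Γ.IsOrientation o → ∃ cls sgn, Γ.ThetaLike L o cls sgn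

lemma ThetaLike.hasTheta {o : Γ.E → Γ.V × Γ.V} {cls : Γ.E → Option (Fin 3)} {sgn : Γ.E → ℝ}
    (h : Γ.ThetaLike L o cls sgn) : Γ.HasTheta L := fun _ ho =>
  ⟨cls, h.reorient ho⟩

lemma IsIso.hasTheta (h : IsIso Γ Γ') (hT : Γ.HasTheta L) : Γ'.HasTheta L := by
  obtain ⟨f, g, hends, hlen, -⟩ := h
  obtain ⟨o, ho⟩ := Γ.exists_isOrientation
  obtain ⟨cls, sgn, T⟩ := hT o ho
  obtain ⟨P, Q, hPQ⟩ := T.uniform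
  refine ThetaLike.hasTheta (o := fun e => (f (o (g.symm e)).1, f (o (g.symm e)).2))
    (cls := cls ∘ g.symm) (sgn := sgn ∘ g.symm) ⟨fun e => ?_, fun e => T.sgn_eq _, fun ω => ?_,
      fun i => ?_, f P, f Q, ?_⟩
  · obtain ⟨e, rfl⟩ := g.surjective e
    rw [hends, ho]; simp
  · have : Γ'.IsFlow (fun e => (f (o (g.symm e)).1, f (o (g.symm e)).2)) ω ↔
        Γ.IsFlow o (ω ∘ g) := by
      constructor
      · intro h σ
        rw [← h (σ ∘ f.symm)]
        exact Fintype.sum_equiv g _ _ fun e => by simp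
      · intro h σ
        rw [← h (σ ∘ f)]
        exact (Fintype.sum_equiv g _ _ fun e => by simp).symm
    rw [this, T.flow_iff]
    refine exists_congr fun x => and_congr_right fun _ => ?_
    constructor
    · intro h e
      simpa using h (g.symm e)
    · intro h e
      simpa using h (g e)
  · rw [← T.len_sum i]
    exact (Fintype.sum_equiv g _ _ fun e => by simp [hlen]).symm
  · intro v e e' i j hv hv' hi hj hij
    obtain ⟨e, rfl⟩ := g.surjective e
    obtain ⟨e', rfl⟩ := g.surjective e'
    obtain ⟨v, rfl⟩ := f.surjective v
    rw [hends, Sym2.mem_map] at hv hv'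
    obtain ⟨a, ha, ha'⟩ := hv
    obtain ⟨b, hb, hb'⟩ := hv'
    obtain rfl := f.injective ha'
    obtain rfl := f.injective hb'
    simpa using hPQ _ e e' i j ha hb (by simpa using hi) (by simpa using hj) hij

section Option

variable (f : Option Γ.V ≃ Γ'.V) (g : Option Γ.E ≃ Γ'.E)

lemma sum_option_equiv {M : Type*} [AddCommMonoid M] (F : Γ'.E → M) :
    ∑ e, F e = F (g none) + ∑ e, F (g (some e)) := by
  rw [← Fintype.sum_equiv g (fun e => F (g e)) F fun _ => rfl]
  have : (Fintype.ofFinite (Option Γ.E)) = instFintypeOption := Subsingleton.elim _ _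
  exact Fintype.sum_option _

variable {f g}

/-- Flows on a subdivision. -/
lemma isFlow_subdivision_iff [DecidableEq Γ.E] {o : Γ.E → Γ.V × Γ.V} {o' : Γ'.E → Γ'.V × Γ'.V}
    {e₀ : Γ.E} (h1 : o' (g (some e₀)) = (f (some (o e₀).1), f none))
    (h2 : o' (g none) = (f none, f (some (o e₀).2)))
    (h3 : ∀ e, e ≠ e₀ → o' (g (some e)) = (f (some (o e).1), f (some (o e).2))) (ω : Γ'.E → ℝ) :
    Γ'.IsFlow o' ω ↔ ω (g none) = ω (g (some e₀)) ∧ Γ.IsFlow o fun e => ω (g (some e)) := by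
  have key : ∀ σ : Γ'.V → ℝ, ∑ e, ω e * (σ (o' e).2 - σ (o' e).1) =
      (ω (g none) - ω (g (some e₀))) * (σ (f (some (o e₀).2)) - σ (f none)) +
      ∑ e, ω (g (some e)) * (σ (f (some (o e).2)) - σ (f (some (o e).1))) := by
    intro σ
    rw [sum_option_equiv g, h2, ← Finset.add_sum_erase _ _ (Finset.mem_univ e₀),
      ← Finset.add_sum_erase (a := e₀) Finset.univ
        (fun e => ω (g (some e)) * (σ (f (some (o e).2)) - σ (f (some (o e).1))))
        (Finset.mem_univ e₀), h1]
    rw [Finset.sum_congr rfl fun e he => by rw [h3 e (Finset.ne_of_mem_erase he)]]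
    simp only
    ring
  constructor
  · intro h
    -- The indicator of the new vertex tests conservation there; test functions extended by zero to
    -- it then recover the flow condition on `Γ`.
    have e1 : ω (g none) = ω (g (some e₀)) := by
      classical
      have := (key fun v => if v = f none then 1 else 0).symm.trans
        (h fun v => if v = f none then 1 else 0)
      simp at this
      linarith
    refine ⟨e1, fun σ => ?_⟩
    have := (key fun v => (f.symm v).elim 0 σ).symm.trans
      (h fun v => (f.symm v).elim 0 σ)
    rw [e1] at this
    simpa using this
  · rintro ⟨e1, h⟩ σ
    rw [key, e1, sub_self, zero_mul, zero_add]
    exact h fun v => σ (f (some v))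

/-- Flows on a curve with an additional infinite edge. -/
lemma isFlow_attach_iff {o : Γ.E → Γ.V × Γ.V} {o' : Γ'.E → Γ'.V × Γ'.V} {v : Γ.V}
    (h2 : o' (g none) = (f (some v), f none))
    (h3 : ∀ e, o' (g (some e)) = (f (some (o e).1), f (some (o e).2))) (ω : Γ'.E → ℝ) :
    Γ'.IsFlow o' ω ↔ ω (g none) = 0 ∧ Γ.IsFlow o fun e => ω (g (some e)) := by
  classical
  have key : ∀ σ : Γ'.V → ℝ, ∑ e, ω e * (σ (o' e).2 - σ (o' e).1) =
      ω (g none) * (σ (f none) - σ (f (some v))) +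
      ∑ e, ω (g (some e)) * (σ (f (some (o e).2)) - σ (f (some (o e).1))) := by
    intro σ
    rw [sum_option_equiv g, h2]
    simp_rw [h3]
  constructor
  · intro h
    have e1 : ω (g none) = 0 := by
      classical
      have := (key fun v => if v = f none then 1 else 0).symm.trans
        (h fun v => if v = f none then 1 else 0)
      simpa using this
    refine ⟨e1, fun σ => ?_⟩
    have := (key fun v => (f.symm v).elim 0 σ).symm.trans
      (h fun v => (f.symm v).elim 0 σ)
    rw [e1] at this
    simpa using this
  · rintro ⟨e1, h⟩ σ
    rw [key, e1, zero_mul, zero_add]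
    exact h fun v => σ (f (some v))

end Option

/-- A value on the edges of a subdivision or attachment. -/
def extend {α : Type*} (g : Option Γ.E ≃ Γ'.E) (a : α) (c : Γ.E → α) (e : Γ'.E) : α :=
  (g.symm e).elim a c

@[simp] lemma extend_none {α : Type*} (g : Option Γ.E ≃ Γ'.E) (a : α) (c : Γ.E → α) :
    extend g a c (g none) = a := by simp [extend]
@[simp] lemma extend_some {α : Type*} (g : Option Γ.E ≃ Γ'.E) (a : α) (c : Γ.E → α) (e : Γ.E) :
    extend g a c (g (some e)) = c e := by simp [extend]

/-- The new edge ends in a leaf and carries no flow, so it belongs to no class. -/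
lemma IsElementaryModification.hasTheta (h : IsElementaryModification Γ Γ') (hT : Γ.HasTheta L) :
    Γ'.HasTheta L := by
  obtain ⟨v, f, g, -, hn, -, hends, hlen, -, -⟩ := h
  obtain ⟨o, ho⟩ := Γ.exists_isOrientation
  obtain ⟨cls, sgn, T⟩ := hT o ho
  obtain ⟨P, Q, hPQ⟩ := T.uniform
  have hall : ∀ {p : Γ'.E → Prop}, p (g none) → (∀ e, p (g (some e))) → ∀ e, p e := by
    intro p h1 h2 e
    obtain ⟨e, rfl⟩ := g.surjective e
    cases e
    · exact h1
    · exact h2 _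
  refine ThetaLike.hasTheta (o := extend g (f (some v), f none)
      fun e => (f (some (o e).1), f (some (o e).2)))
    (cls := extend g none cls) (sgn := extend g 1 sgn) ⟨?_, ?_, fun ω => ?_,
      fun i => ?_, f (some P), f (some Q), ?_⟩
  · refine hall ?_ fun e => ?_
    · rw [hn]; simp
    · rw [hends, ho]; simp
  · exact hall (by simp) fun e => by simpa using T.sgn_eq e
  · rw [isFlow_attach_iff (o := o) (f := f) (g := g) (v := v) (by simp) (by simp), T.flow_iff]
    constructor
    · rintro ⟨h1, x, hx, h2⟩
      exact ⟨x, hx, hall (by simp [h1]) fun e => by simp [h2]⟩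
    · rintro ⟨x, hx, h2⟩
      exact ⟨by simpa using h2 (g none), x, hx, fun e => by simpa using h2 (g (some e))⟩
  · rw [← T.len_sum i, sum_option_equiv g]
    simp [hlen]
  · intro w e e' i j hv hv' hi hj hij
    obtain ⟨e, rfl⟩ := g.surjective e
    obtain ⟨e', rfl⟩ := g.surjective e'
    cases e with
    | none => simp at hi
    | some e =>
    cases e' with
    | none => simp at hj
    | some e' =>
    rw [hends, Sym2.mem_map] at hv hv'
    obtain ⟨a, ha, rfl⟩ := hv
    obtain ⟨b, hb, hb'⟩ := hv'
    have hb' := f.injective hb'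
    rw [Option.some.injEq] at hb'
    subst hb'
    simpa using hPQ _ e e' i j ha hb (by simpa using hi) (by simpa using hj) hij

/-- An orientation of a subdivision which is compatible with an orientation of the curve. -/
lemma IsSubdivision.exists_orientation (h : IsSubdivision Γ Γ') :
    ∃ (e₀ : Γ.E) (f : Option Γ.V ≃ Γ'.V) (g : Option Γ.E ≃ Γ'.E) (o : Γ.E → Γ.V × Γ.V)
      (o' : Γ'.E → Γ'.V × Γ'.V), Γ.IsOrientation o ∧ Γ'.IsOrientation o' ∧
      o' (g (some e₀)) = (f (some (o e₀).1), f none) ∧ o' (g none) = (f none, f (some (o e₀).2)) ∧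
      (∀ e, e ≠ e₀ → o' (g (some e)) = (f (some (o e).1), f (some (o e).2))) ∧
      Γ'.length (g (some e₀)) + Γ'.length (g none) = Γ.length e₀ ∧
      ∀ e, e ≠ e₀ → Γ'.length (g (some e)) = Γ.length e := by
  classical
  obtain ⟨e₀, u, v, f, g, h1, h2, h3, h4, h5, h6, -, -⟩ := h
  obtain ⟨o, ho⟩ := Γ.exists_isOrientation
  refine ⟨e₀, f, g, Function.update o e₀ (u, v), extend g (f none, f (some v))
    (Function.update (fun e => (f (some (o e).1), f (some (o e).2))) e₀ (f (some u), f none)),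
    ?_, ?_, by simp, by simp, ?_, h4, h6⟩
  · intro e
    by_cases he : e = e₀
    · subst he; simp [h1]
    · simp [he, ho e]
  · intro e
    obtain ⟨e, rfl⟩ := g.surjective e
    cases e with
    | none => simp [h3]
    | some e =>
      by_cases he : e = e₀
      · subst he; simp [h2]
      · simp [he, h5 e he, ho e]
  · intro e he
    simp [he]

/-- Both halves carry the flow of the old edge and inherit its class and sign; at the new vertex no
two classes meet. -/
lemma IsSubdivision.hasTheta (h : IsSubdivision Γ Γ') (hT : Γ.HasTheta L) : Γ'.HasTheta L := by
  classical
  obtain ⟨e₀, f, g, o, o', ho, ho', h1, h2, h3, h4, h5⟩ := h.exists_orientation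
  obtain ⟨cls, sgn, T⟩ := hT o ho
  obtain ⟨P, Q, hPQ⟩ := T.uniform
  have hall : ∀ {p : Γ'.E → Prop}, p (g none) → (∀ e, p (g (some e))) → ∀ e, p e := by
    intro p h1 h2 e
    obtain ⟨e, rfl⟩ := g.surjective e
    cases e
    · exact h1
    · exact h2 _
  refine ThetaLike.hasTheta (o := o')
    (cls := extend g (cls e₀) cls) (sgn := extend g (sgn e₀) sgn) ⟨ho', ?_, fun ω => ?_,
      fun i => ?_, f (some P), f (some Q), ?_⟩
  · exact hall (by simpa using T.sgn_eq e₀) fun e => by simpa using T.sgn_eq e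
  · rw [isFlow_subdivision_iff h1 h2 h3, T.flow_iff]
    constructor
    · rintro ⟨e1, x, hx, e2⟩
      exact ⟨x, hx, hall (by simp [e1, e2]) fun e => by simp [e2]⟩
    · rintro ⟨x, hx, e2⟩
      refine ⟨?_, x, hx, fun e => by simpa using e2 (g (some e))⟩
      rw [e2, e2]; simp
  · rw [← T.len_sum i, sum_option_equiv g, ← Finset.add_sum_erase _ _ (Finset.mem_univ e₀),
      ← Finset.add_sum_erase (a := e₀) Finset.univ
        (fun e => if cls e = some i then Γ.length e else 0) (Finset.mem_univ e₀), ← add_assoc]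
    congr 1
    · simp only [extend_none, extend_some, ← h4]
      split_ifs
      · rw [add_comm]
      · simp
    · refine Finset.sum_congr rfl fun e he => ?_
      rw [extend_some, h5 e (Finset.ne_of_mem_erase he)]
  · intro w e e' i j hv hv' hi hj hij
    have key : ∀ e w i, w ∈ Γ'.ends (g e) → extend g (cls e₀) cls (g e) = some i →
        ((w = f none ∧ cls e₀ = some i) ∨ ∃ d v, w = f (some v) ∧ v ∈ Γ.ends d ∧ cls d = some i) := by
      intro e w i hw hc
      rw [ho' (g e), Sym2.mem_iff] at hw
      cases e with
      | none =>
        rw [extend_none] at hc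
        rw [h2] at hw
        rcases hw with rfl | rfl
        · exact Or.inl ⟨rfl, hc⟩
        · exact Or.inr ⟨e₀, _, rfl, by rw [ho e₀]; simp, hc⟩
      | some e =>
        rw [extend_some] at hc
        by_cases he : e = e₀
        · subst he
          rw [h1] at hw
          rcases hw with rfl | rfl
          · exact Or.inr ⟨e, _, rfl, by rw [ho e]; simp, hc⟩
          · exact Or.inl ⟨rfl, hc⟩
        · rw [h3 e he] at hw
          rcases hw with rfl | rfl
          · exact Or.inr ⟨e, _, rfl, by rw [ho e]; simp, hc⟩
          · exact Or.inr ⟨e, _, rfl, by rw [ho e]; simp, hc⟩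
    obtain ⟨e, rfl⟩ := g.surjective e
    obtain ⟨e', rfl⟩ := g.surjective e'
    rcases key e w i hv hi with ⟨k1, k2⟩ | ⟨d, y, k1, k2, k3⟩
    · rcases key e' w j hv' hj with ⟨k1', k2'⟩ | ⟨d', y', k1', k2', k3'⟩
      · rw [k2, Option.some.injEq] at k2'
        exact absurd k2' hij
      · rw [k1] at k1'
        simp at k1'
    · rcases key e' w j hv' hj with ⟨k1', k2'⟩ | ⟨d', y', k1', k2', k3'⟩
      · rw [k1] at k1'
        simp at k1'
      · rw [k1] at k1'
        simp at k1'
        subst k1'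
        rw [k1]
        simpa using hPQ _ d d' i j k2 k2' k3 k3' hij

/-- The vector `(2, -1, -1)` tells a class from no class; the other three vanish on exactly one
class each and tell the classes apart. -/
lemma eq_of_forall_elim_eq {c d : Option (Fin 3)} {s t : ℝ} (hs : s ≠ 0) (ht : t ≠ 0)
    (h : ∀ x : Fin 3 → ℝ, x 0 + x 1 + x 2 = 0 → s * c.elim 0 x = t * d.elim 0 x) : c = d := by
  have h0 := h (fun i => if i = 0 then 2 else -1) (by simp; norm_num)
  have h1 := h (fun i => if i = 0 then 0 else if i = 1 then 1 else -1) (by simp)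
  have h2 := h (fun i => if i = 1 then 0 else if i = 0 then 1 else -1) (by simp)
  have h3 := h (fun i => if i = 2 then 0 else if i = 0 then 1 else -1) (by simp)
  rcases c with _ | c <;> rcases d with _ | d
  · rfl
  · fin_cases d <;> simp [ht] at h0 h1 h2 h3 ⊢
  · fin_cases c <;> simp [hs] at h0 h1 h2 h3 ⊢
  · fin_cases c <;> fin_cases d <;> simp [hs, ht, ht.symm] at h0 h1 h2 h3 ⊢

/-- All flows agree on the two halves, so by `eq_of_forall_elim_eq` the halves lie in the same class
and can be merged. -/
lemma IsSubdivision.hasTheta_symm (h : IsSubdivision Γ Γ') (hT : Γ'.HasTheta L) :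
    Γ.HasTheta L := by
  classical
  obtain ⟨e₀, f, g, o, o', ho, ho', h1, h2, h3, h4, h5⟩ := h.exists_orientation
  obtain ⟨cls, sgn, T⟩ := hT o' ho'
  obtain ⟨P, Q, hPQ⟩ := T.uniform
  have hne : ∀ e, sgn e ≠ 0 := fun e => by
    rcases T.sgn_eq e with h | h <;> rw [h] <;> norm_num
  have hx : ∀ x : Fin 3 → ℝ, x 0 + x 1 + x 2 = 0 →
      sgn (g none) * (cls (g none)).elim 0 x = sgn (g (some e₀)) * (cls (g (some e₀))).elim 0 x := by
    intro x hx
    have := (T.flow_iff fun e => sgn e * (cls e).elim 0 x).2 ⟨x, hx, fun _ => rfl⟩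
    rw [isFlow_subdivision_iff h1 h2 h3] at this
    exact this.1
  have hcls := eq_of_forall_elim_eq (hne _) (hne _) hx
  -- A default in case `P` or `Q` is the vertex that disappears, which corresponds to no vertex of
  -- `Γ`.
  have v₀ : Γ.V := (o e₀).1
  refine ThetaLike.hasTheta (o := o) (cls := fun e => cls (g (some e)))
    (sgn := fun e => sgn (g (some e))) ⟨ho, fun e => T.sgn_eq _, fun ω => ?_,
      fun i => ?_, (f.symm P).getD v₀, (f.symm Q).getD v₀, ?_⟩
  · have e1 := isFlow_subdivision_iff h1 h2 h3 (extend g (ω e₀) ω)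
    simp only [extend_none, extend_some, true_and] at e1
    rw [← e1, T.flow_iff]
    refine exists_congr fun x => and_congr_right fun hx0 => ?_
    constructor
    · intro h e
      simpa using h (g (some e))
    · intro h e
      obtain ⟨e, rfl⟩ := g.surjective e
      cases e with
      | none => rw [extend_none, h, hx x hx0]
      | some e => rw [extend_some, h]
  · rw [← T.len_sum i, sum_option_equiv g, ← Finset.add_sum_erase _ _ (Finset.mem_univ e₀),
      ← Finset.add_sum_erase (a := e₀) Finset.univ
        (fun e => if cls (g (some e)) = some i then Γ'.length (g (some e)) else 0)
        (Finset.mem_univ e₀), ← add_assoc]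
    congr 1
    · rw [hcls, ← h4]
      split_ifs
      · rw [add_comm]
      · simp
    · refine Finset.sum_congr rfl fun e he => ?_
      rw [h5 e (Finset.ne_of_mem_erase he)]
  · intro v e e' i j hv hv' hi hj hij
    have key : ∀ e i, v ∈ Γ.ends e → cls (g (some e)) = some i →
        ∃ d, f (some v) ∈ Γ'.ends d ∧ cls d = some i := by
      intro e i hv hi
      rw [ho e, Sym2.mem_iff] at hv
      by_cases he : e = e₀
      · subst he
        rcases hv with rfl | rfl
        · exact ⟨g (some e), by rw [ho', h1]; simp, hi⟩
        · exact ⟨g none, by rw [ho', h2]; simp, by rw [hcls, hi]⟩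
      · refine ⟨g (some e), ?_, hi⟩
        rw [ho', h3 e he]
        rcases hv with rfl | rfl <;> simp
    obtain ⟨d, k1, k2⟩ := key e i hv hi
    obtain ⟨d', k1', k2'⟩ := key e' j hv' hj
    rcases hPQ _ d d' i j k1 k1' k2 k2' hij with h | h
    · left; simp [← h]
    · right; simp [← h]

/-- Tropical modifications keep the essential part. -/
theorem IsModification.hasTheta (h : Γ.IsModification Γ') (hT : Γ.HasTheta L) : Γ'.HasTheta L := by
  induction h with
  | refl => exact hT
  | tail _ h ih =>
    rcases h with h | h | h | h
    · exact h.hasTheta ih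
    · exact h.hasTheta ih
    · exact h.hasTheta_symm ih
    · exact h.hasTheta ih

lemma IsStable.infVerts_eq (h : Γ.IsStable) : Γ.infVerts = ∅ := by
  ext v
  simp only [Set.mem_empty_iff_false, iff_false]
  intro hv
  have h1 := h v
  rw [degree, Γ.infVert_degree v hv] at h1
  norm_num at h1

lemma IsStable.length_ne_top (h : Γ.IsStable) (e : Γ.E) : Γ.length e ≠ ∞ := by
  intro he
  obtain ⟨v, -, hv⟩ := Γ.exists_infVert e he
  rw [h.infVerts_eq] at hv
  exact hv

/-- With all edges oriented from `u` to `v`, conservation says only that the three values add up to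
zero. -/
lemma IsTheta.hasTheta (h : Γ.IsTheta) (hs : Γ.IsStable) (he : Γ.IsEquilateral) :
    ∃ L, 0 < L ∧ Γ.HasTheta L := by
  obtain ⟨u, v, huv, -, hE, hends⟩ := h
  have hne : Nonempty Γ.E := (Nat.card_pos_iff.1 (by omega)).1
  obtain ⟨e₀⟩ := hne
  let κ : Γ.E ≃ Fin 3 := Finite.equivFinOfCardEq hE
  refine ⟨(Γ.length e₀).toReal, ENNReal.toReal_pos (Γ.length_pos e₀).ne' (hs.length_ne_top e₀),
    ThetaLike.hasTheta (o := fun _ => (u, v)) (cls := fun e => some (κ e)) (sgn := fun _ => 1)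
    ⟨hends, fun _ => Or.inl rfl, fun ω => ?_, fun i => ?_, u, v, ?_⟩⟩
  · have h1 : Γ.IsFlow (fun _ => (u, v)) ω ↔ ∑ e, ω e = 0 := by
      constructor
      · intro h
        classical
        have := h fun w => if w = v then 1 else 0
        simpa [huv] using this
      · intro h σ
        rw [← Finset.sum_mul, h, zero_mul]
    have h2 : ∑ e, ω e = ω (κ.symm 0) + ω (κ.symm 1) + ω (κ.symm 2) := by
      rw [Fintype.sum_equiv κ ω (fun i => ω (κ.symm i)) (by simp), Fin.sum_univ_three]
    rw [h1, h2]
    constructor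
    · intro h
      exact ⟨fun i => ω (κ.symm i), h, fun e => by simp⟩
    · rintro ⟨x, hx, h⟩
      simpa [h] using hx
  · rw [Finset.sum_eq_single (κ.symm i)]
    · simp [he _ e₀, ENNReal.ofReal_toReal (hs.length_ne_top e₀)]
    · intro e _ h
      rw [if_neg]
      intro h'
      apply h
      simpa [Equiv.eq_symm_apply] using h'
    · simp
  · intro w e _ _ _ hw _ _ _ _
    simpa [hends] using hw

end AbstractTropicalCurve

/-! ### From a resolution to a drawing; the lower bound. -/

namespace PlaneTropical

lemma openSegment_eq_track (p d : Plane) {ℓ : ℝ} (hℓ : 0 < ℓ) :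
    openSegment ℝ p (p + ℓ • d) = track p d ℓ true := by
  ext q
  rw [openSegment_eq_image']
  constructor
  · rintro ⟨t, ⟨h0, h1⟩, rfl⟩
    exact ⟨t * ℓ, by positivity, fun _ => by nlinarith, by simp [smul_smul]⟩
  · rintro ⟨t, h0, h1, rfl⟩
    refine ⟨t / ℓ, ⟨by positivity, (div_lt_one hℓ).2 (h1 rfl)⟩, ?_⟩
    simp [smul_smul, div_mul_cancel₀ _ hℓ.ne']

open AbstractTropicalCurve

variable {C : Set Plane} {G : AbstractTropicalCurve}

lemma Resolution.exists_edge_data (R : Resolution C G) (e : G.E) : ∃ (u v : G.V) (d : Fin 2 → ℤ)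
    (ℓ : ℝ), G.ends e = s(u, v) ∧ u ∉ G.infVerts ∧ IsPrimitive d ∧ 0 < ℓ ∧
      ((v ∉ G.infVerts ∧ ENNReal.ofReal ℓ = G.length e ∧ R.pos v = R.pos u + ℓ • toPlane d ∧
          R.arc e = track (R.pos u) (toPlane d) ℓ true) ∨
        (v ∈ G.infVerts ∧ G.length e = ∞ ∧ R.arc e = track (R.pos u) (toPlane d) ℓ false)) := by
  obtain ⟨⟨u, v⟩, huv⟩ : ∃ p : G.V × G.V, G.ends e = s(p.1, p.2) := by
    obtain ⟨o, ho⟩ := G.exists_isOrientation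
    exact ⟨o e, ho e⟩
  simp only at huv
  have hinf : ∀ u v, G.ends e = s(u, v) → v ∈ G.infVerts → ∃ (u v : G.V) (d : Fin 2 → ℤ)
      (ℓ : ℝ), G.ends e = s(u, v) ∧ u ∉ G.infVerts ∧ IsPrimitive d ∧ 0 < ℓ ∧
      ((v ∉ G.infVerts ∧ ENNReal.ofReal ℓ = G.length e ∧ R.pos v = R.pos u + ℓ • toPlane d ∧
          R.arc e = track (R.pos u) (toPlane d) ℓ true) ∨
        (v ∈ G.infVerts ∧ G.length e = ∞ ∧ R.arc e = track (R.pos u) (toPlane d) ℓ false)) := by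
    intro u v huv hv
    obtain ⟨hu, d, hd, ha⟩ := R.infinite_arc e u v huv hv
    refine ⟨u, v, d, 1, huv, hu, hd, one_pos, Or.inr ⟨hv, G.infVert_length v hv e ?_, ?_⟩⟩
    · rw [huv]; simp
    · rw [ha]; ext q; simp [track]
  by_cases hv : v ∈ G.infVerts
  · exact hinf u v huv hv
  by_cases hu : u ∈ G.infVerts
  · exact hinf v u (by rw [huv, Sym2.eq_swap]) hu
  obtain ⟨ha, d, hd, hp⟩ := R.finite_arc e u v huv hu hv
  have hfin : G.length e ≠ ∞ := by
    intro h
    obtain ⟨w, hw, hw'⟩ := G.exists_infVert e h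
    rw [huv, Sym2.mem_iff] at hw
    rcases hw with rfl | rfl
    · exact hu hw'
    · exact hv hw'
  have hpos := ENNReal.toReal_pos (G.length_pos e).ne' hfin
  have hp' : R.pos v = R.pos u + (G.length e).toReal • toPlane d := by rw [← hp]; abel
  refine ⟨u, v, d, (G.length e).toReal, huv, hu, hd, hpos, Or.inl ⟨hv,
    ENNReal.ofReal_toReal hfin, hp', ?_⟩⟩
  rw [ha, hp', openSegment_eq_track _ _ hpos]

/-- The drawing underlying the resolution of a curve without nodes. -/
lemma Resolution.exists_drawing (R : Resolution C G) (hs : ∀ p ∈ C, IsSmoothAt C p) :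
    ∃ (D : Drawing {v // v ∉ G.infVerts} G.E) (o : G.E → G.V × G.V), D.support = C ∧
      Function.Injective D.pos ∧ G.IsOrientation o ∧ (∀ e, (o e).1 = D.tail e) ∧
      ∀ e, (∃ v, D.head e = some v ∧ (o e).2 = v ∧ ENNReal.ofReal (D.len e) = G.length e) ∨
        (D.head e = none ∧ (o e).2 ∈ G.infVerts ∧ G.length e = ∞) := by
  classical
  choose u v d ℓ h1 h2 h3 h4 h5 using R.exists_edge_data
  have harc : ∀ e, R.arc e = track (R.pos (u e)) (toPlane (d e)) (ℓ e)
      (if h : v e ∉ G.infVerts then some (⟨v e, h⟩ : {v // v ∉ G.infVerts}) else none).isSome := by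
    intro e
    rcases h5 e with ⟨a1, -, -, a2⟩ | ⟨a1, -, a2⟩
    · simpa [a1] using a2
    · simpa [a1] using a2
  let D : Drawing {v // v ∉ G.infVerts} G.E :=
    { pos := fun v => R.pos v
      tail := fun e => ⟨u e, h2 e⟩
      head := fun e => if h : v e ∉ G.infVerts then some ⟨v e, h⟩ else none
      dir := d
      len := ℓ
      prim := h3
      len_pos := h4
      pos_head := by
        intro e w hw
        rcases h5 e with ⟨a1, -, a3, -⟩ | ⟨a1, -, -⟩
        · rw [dif_pos a1, Option.some.injEq] at hw
          rw [← hw]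
          exact a3
        · simp [a1] at hw
      disj := by
        intro e e' hne
        have := R.arc_disjoint e e' hne
        rwa [harc, harc] at this
      notMem := by
        intro w e
        have := R.pos_notMem_arc w.1 w.2 e
        rwa [harc] at this }
  have hsup : D.support = C := by
    have e1 : ∀ e, D.arc e = R.arc e := fun e => (harc e).symm
    rw [R.cover, Drawing.support]
    simp_rw [e1]
    congr 1
    ext q
    simp [D]
  refine ⟨D, fun e => (u e, v e), hsup, ?_, h1, fun _ => rfl, fun e => ?_⟩
  · intro w w' hw
    have hmem : R.pos w.1 ∈ C := hsup.subset (D.pos_mem w)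
    exact Subtype.ext (R.pos_smooth w.1 w'.1 w.2 w'.2 hw (hs _ hmem))
  · rcases h5 e with ⟨a1, a2, -, -⟩ | ⟨a1, a2, -⟩
    · exact Or.inl ⟨⟨v e, a1⟩, by simp [D, a1], rfl, a2⟩
    · exact Or.inr ⟨by simp [D, a1], a1, a2⟩

/-- A smooth plane tropical curve does not resolve to a modification of an equilateral theta
graph. -/
theorem Resolution.false_of_hasTheta (R : Resolution C G) (hs : ∀ p ∈ C, IsSmoothAt C p) {L : ℝ}
    (hL : 0 < L) (hT : G.HasTheta L) : False := by
  classical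
  obtain ⟨D, o, hsup, hinj, ho, htail, hhead⟩ := R.exists_drawing hs
  obtain ⟨cls, sgn, T⟩ := hT o ho
  obtain ⟨P, Q, hPQ⟩ := T.uniform
  -- A class has finite total length, so it contains no infinite edge.
  have hcls : ∀ e i, cls e = some i → G.length e ≠ ∞ := by
    intro e i he htop
    have h1 := T.len_sum i
    have h2 : (if cls e = some i then G.length e else 0) ≤
        ∑ e, (if cls e = some i then G.length e else 0) :=
      Finset.single_le_sum (f := fun e => if cls e = some i then G.length e else 0)
        (fun _ _ => zero_le) (Finset.mem_univ e)
    rw [h1, if_pos he, htop] at h2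
    exact ENNReal.ofReal_ne_top (top_le_iff.1 h2)
  have hinf : ∀ e, D.head e = none → (o e).2 ∈ G.infVerts := by
    intro e he
    rcases hhead e with ⟨v, h1, -, -⟩ | ⟨-, h, -⟩
    · rw [he] at h1; cases h1
    · exact h
  have hray : ∀ e, D.head e = none → ∀ e', (o e).2 ∈ G.ends e' → e' = e := by
    intro e he e' he'
    have h1 := G.infVert_degree _ (hinf e he)
    have h2 : {e' | (o e).2 ∈ G.ends e'}.ncard ≤ 1 := by omega
    exact (Set.ncard_le_one (Set.toFinite _)).1 h2 e' he' e (by simp [ho e])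
  have hmem : ∀ δ v, D.src δ = some v → v.1 ∈ G.ends δ.1 := by
    rintro ⟨e, b⟩ v hv
    rw [ho, Sym2.mem_iff]
    cases b
    · rcases hhead e with ⟨w, h1, h2, -⟩ | ⟨h1, -, -⟩
      · simp only [Drawing.src, Bool.false_eq_true, if_false, h1, Option.some.injEq] at hv
        exact Or.inr (by rw [h2, hv])
      · simp [Drawing.src, h1] at hv
    · simp only [Drawing.src, if_true, Option.some.injEq] at hv
      exact Or.inl (by rw [htail, hv])
  have hflow : ∀ ω, D.IsFlow ω ↔ G.IsFlow o ω := by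
    intro ω
    constructor
    · intro h σ
      rw [← neg_eq_zero, ← h.sum_mul fun v => σ v.1, ← Finset.sum_neg_distrib]
      refine Finset.sum_congr rfl fun e _ => ?_
      rcases hhead e with ⟨w, h1, h2, -⟩ | ⟨h1, -, -⟩
      · rw [h1, h2, htail, Option.elim_some]; ring
      · rw [h.1 e h1]; ring
    · intro h
      constructor
      -- An infinite vertex lies on a single edge, so its indicator function isolates the flow on
      -- that edge.
      · intro e he
        have h1 := h fun v => if v = (o e).2 then 1 else 0
        rw [Finset.sum_eq_single e] at h1
        · have : (o e).1 ≠ (o e).2 := by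
            intro h2
            have h3 := hinf e he
            rw [← h2, htail] at h3
            exact (D.tail e).2 h3
          simpa [this] using h1
        · intro e' _ hne
          have h2 : ¬ ((o e').1 = (o e).2 ∨ (o e').2 = (o e).2) := by
            intro h3
            apply hne (hray e he e' _)
            rw [ho e', Sym2.mem_iff]
            rcases h3 with h3 | h3 <;> simp [h3]
          push Not at h2
          simp [h2.1, h2.2]
        · simp
      · intro v
        have h1 := h fun w => if w = v.1 then 1 else 0
        refine neg_eq_zero.1 (Eq.trans ?_ h1)
        rw [Fintype.sum_prod_type, ← Finset.sum_neg_distrib]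
        refine Finset.sum_congr rfl fun e _ => ?_
        have e1 : ((D.tail e : G.V) = v.1) ↔ D.tail e = v := by rw [Subtype.ext_iff]
        rcases hhead e with ⟨w, h1, h2, -⟩ | ⟨h1, h2, -⟩
        · have e2 : ((w : G.V) = v.1) ↔ w = v := by rw [Subtype.ext_iff]
          simp only [Fintype.sum_bool, Drawing.src, dval, if_true, Bool.false_eq_true, if_false,
            Option.some.injEq, h1, h2, htail, e1, e2]
          split_ifs <;> ring
        · have e2 : (o e).2 ≠ v.1 := fun h => v.2 (h ▸ h2)
          simp only [Fintype.sum_bool, Drawing.src, dval, if_true, Bool.false_eq_true, if_false,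
            Option.some.injEq, h1, e2, htail, e1, reduceCtorEq]
          split_ifs <;> ring
  have hlen : ∀ i, ∑ e, (if cls e = some i then D.len e else 0) = L := by
    intro i
    have h1 := congrArg ENNReal.toReal (T.len_sum i)
    rw [ENNReal.toReal_ofReal hL.le, ENNReal.toReal_sum] at h1
    · rw [← h1]
      refine Finset.sum_congr rfl fun e _ => ?_
      split_ifs with hc
      · rcases hhead e with ⟨w, -, -, h2⟩ | ⟨-, -, h2⟩
        · rw [← h2, ENNReal.toReal_ofReal (D.len_pos e).le]
        · exact absurd h2 (hcls e i hc)
      · simp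
    · intro e _
      split_ifs with hc
      · exact hcls e i hc
      · simp
  obtain ⟨e₀, -⟩ : ∃ e, cls e = some 0 := by
    by_contra h
    push Not at h
    have := hlen 0
    simp [h] at this
    linarith
  -- An infinite `P` or `Q` may be replaced by any finite vertex, because only finite vertices are
  -- tested in the drawing.
  have hsub : ∀ v : G.V, ∃ w : {v // v ∉ G.infVerts}, v ∉ G.infVerts → w.1 = v := by
    intro v
    by_cases hv : v ∉ G.infVerts
    · exact ⟨⟨v, hv⟩, fun _ => rfl⟩
    · exact ⟨D.tail e₀, fun h => absurd h hv⟩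
  obtain ⟨P', hP'⟩ := hsub P
  obtain ⟨Q', hQ'⟩ := hsub Q
  refine Drawing.ThetaData.false (D := D) (L := L) (by rwa [hsup])
    { cls := cls, sgn := sgn, sgn_eq := T.sgn_eq, flow_iff := fun ω => by rw [hflow, T.flow_iff],
      len_sum := hlen, P := P', Q := Q', uniform := ?_ } hinj hL
  intro v δ δ' i j hδ hδ' hi hj hij
  rcases hPQ v.1 δ.1 δ'.1 i j (hmem δ v hδ) (hmem δ' v hδ') hi hj hij with h | h
  · exact Or.inl (Subtype.ext (h.trans (hP' (h ▸ v.2)).symm))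
  · exact Or.inr (Subtype.ext (h.trans (hQ' (h ▸ v.2)).symm))

lemma natAbs_nodeMultiplicity_ne_zero {C : Set Plane} {p : Plane} {a b : Fin 2 → ℤ}
    (h : IsNodeAt C p a b) : nodeMultiplicity C p ≠ 0 := by
  intro h0
  have hne : {m | ∃ a b, IsNodeAt C p a b ∧ m = (a 0 * b 1 - a 1 * b 0).natAbs}.Nonempty :=
    ⟨_, a, b, h, rfl⟩
  obtain ⟨a', b', h', hm⟩ := Nat.sInf_mem hne
  rw [nodeMultiplicity] at h0
  rw [h0, eq_comm, Int.natAbs_eq_zero] at hm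
  exact h'.2.2.1 hm

/-- A nodal curve without nodes is smooth. -/
lemma isSmoothAt_of_nodeCount_eq_zero (hC : IsNodalTropicalCurve C) (h : nodeCount C = 0) :
    ∀ p ∈ C, IsSmoothAt C p := by
  intro p hp
  rcases hC.2 p hp with h1 | ⟨a, b, h1⟩
  · exact h1
  · exfalso
    have h2 : (nodeMultiplicity C p : ℕ∞) ≤ nodeCount C := by
      have := le_iSup (fun s : Finset Plane => ∑ p ∈ s, (nodeMultiplicity C p : ℕ∞)) {p}
      rw [Finset.sum_singleton] at this
      exact this
    rw [h] at h2
    exact natAbs_nodeMultiplicity_ne_zero h1 (by exact_mod_cast nonpos_iff_eq_zero.1 h2)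

/-- The crossing number of an equilateral theta graph is not zero. -/
theorem one_le_crossingNumber {Γ : AbstractTropicalCurve} (hs : Γ.IsStable) (hT : Γ.IsTheta)
    (he : Γ.IsEquilateral) : 1 ≤ Γ.crossingNumber := by
  obtain ⟨L, hL, hΓ⟩ := hT.hasTheta hs he
  rw [AbstractTropicalCurve.crossingNumber]
  refine le_iInf fun C => le_iInf fun ⟨hC, G, hG, ⟨R⟩⟩ => ?_
  rw [Order.one_le_iff_ne_zero]
  intro h0
  exact R.false_of_hasTheta (isSmoothAt_of_nodeCount_eq_zero hC h0) hL (hG.hasTheta hΓ)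

end PlaneTropical

/-! ### Curves given by incidence tables and their layouts in coordinates. -/

namespace PlaneTropical

/-- A connected graph with `n` vertices, `m` finite edges and `r` infinite edges. -/
structure Comb (n m r : ℕ) where
  tail : Fin m → Fin n
  head : Fin m → Fin n
  len : Fin m → ℝ
  base : Fin r → Fin n
  len_pos : ∀ e, 0 < len e
  vertex : Fin n
  conn : ∀ f : Fin n → Prop, (∀ e, f (tail e) ↔ f (head e)) → ∀ i j, f i ↔ f j

namespace Comb

variable {n m r : ℕ} (c : Comb n m r)

/-- The ends of the edges of the abstract tropical curve. -/
def ends : Fin m ⊕ Fin r → Sym2 (Fin n ⊕ Fin r)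
  | .inl e => s(.inl (c.tail e), .inl (c.head e))
  | .inr j => s(.inl (c.base j), .inr j)

/-- The lengths of the edges of the abstract tropical curve. -/
noncomputable def length : Fin m ⊕ Fin r → ℝ≥0∞
  | .inl e => ENNReal.ofReal (c.len e)
  | .inr _ => ∞

lemma connected :
    (SimpleGraph.fromRel fun u v : Fin n ⊕ Fin r => ∃ e, c.ends e = s(u, v)).Connected := by
  set G := SimpleGraph.fromRel fun u v : Fin n ⊕ Fin r => ∃ e, c.ends e = s(u, v) with hG
  have h1 : ∀ e u v, c.ends e = s(u, v) → G.Reachable u v := by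
    intro e u v h
    by_cases huv : u = v
    · rw [huv]
    · exact SimpleGraph.Adj.reachable ((SimpleGraph.fromRel_adj _ _ _).2 ⟨huv, Or.inl ⟨e, h⟩⟩)
  have h2 : ∀ i, G.Reachable (.inl c.vertex) (.inl i) := by
    intro i
    refine (c.conn (fun i => G.Reachable (.inl c.vertex) (.inl i)) (fun e => ?_) c.vertex i).1
      (SimpleGraph.Reachable.refl _)
    have := h1 (.inl e) _ _ rfl
    exact ⟨fun h => h.trans this, fun h => h.trans this.symm⟩
  have h3 : ∀ v, G.Reachable (.inl c.vertex) v := by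
    rintro (i | j)
    · exact h2 i
    · exact (h2 _).trans (h1 (.inr j) _ _ rfl)
  exact { preconnected := fun u v => (h3 u).symm.trans (h3 v), nonempty := ⟨.inl c.vertex⟩ }

lemma inr_mem_ends {e : Fin m ⊕ Fin r} {j : Fin r} : Sum.inr j ∈ c.ends e ↔ e = .inr j := by
  rcases e with e | i <;> simp [ends, eq_comm]

/-- The abstract tropical curve. -/
noncomputable def curve : AbstractTropicalCurve where
  V := Fin n ⊕ Fin r
  E := Fin m ⊕ Fin r
  finite_V := inferInstance
  finite_E := inferInstance
  ends := c.ends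
  length := c.length
  infVerts := Set.range Sum.inr
  connected := c.connected
  length_pos := by
    rintro (e | j)
    · exact ENNReal.ofReal_pos.2 (c.len_pos e)
    · exact ENNReal.zero_lt_top
  exists_infVert := by
    rintro (e | j) h
    · simp [length] at h
    · exact ⟨.inr j, by simp [ends], j, rfl⟩
  infVert_degree := by
    rintro _ ⟨j, rfl⟩
    have h1 : {e | Sum.inr j ∈ c.ends e} = {Sum.inr j} := by
      ext e; simp [inr_mem_ends]
    have h2 : {e | c.ends e = s(Sum.inr j, Sum.inr j)} = ∅ := by
      ext e
      rcases e with e | i <;> simp [ends]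
    rw [h1, h2]
    simp
  infVert_length := by
    rintro _ ⟨j, rfl⟩ e he
    rw [inr_mem_ends] at he
    rw [he]; rfl

/-- Subdivision of an edge. -/
noncomputable def subdiv (e : Fin m) (s t : ℝ) (hs : 0 < s) (ht : 0 < t) :
    Comb (n + 1) (m + 1) r where
  -- Edge `e` keeps its index and tail but now ends at the new last vertex; the new last edge
  -- continues to the old head.
  tail := Fin.snoc (fun i => (c.tail i).castSucc) (Fin.last n)
  head := Fin.snoc (Function.update (fun i => (c.head i).castSucc) e (Fin.last n))
    (c.head e).castSucc
  len := Fin.snoc (Function.update c.len e s) t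
  base := fun j => (c.base j).castSucc
  len_pos := by
    intro i
    refine Fin.lastCases ?_ (fun i => ?_) i
    · simpa using ht
    · by_cases h : i = e
      · subst h; simpa using hs
      · simpa [h] using c.len_pos i
  vertex := c.vertex.castSucc
  conn := by
    intro f hf
    have h1 : f (c.tail e).castSucc ↔ f (Fin.last n) := by simpa using hf e.castSucc
    have h2 : f (Fin.last n) ↔ f (c.head e).castSucc := by simpa using hf (Fin.last m)
    have h3 := c.conn (fun i => f i.castSucc) (fun i => by
      by_cases h : i = e
      · subst h; exact h1.trans h2
      · simpa [h] using hf i.castSucc)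
    have h4 : ∀ i, f i ↔ f (c.tail e).castSucc := by
      intro i
      refine Fin.lastCases h1.symm (fun i => h3 i _) i
    exact fun i j => (h4 i).trans (h4 j).symm

/-- Attachment of an infinite edge. -/
def attach (v : Fin n) : Comb n m (r + 1) where
  tail := c.tail
  head := c.head
  len := c.len
  base := Fin.snoc c.base v
  len_pos := c.len_pos
  vertex := c.vertex
  conn := c.conn

/-- Adjoining an element as the last one of the first summand. -/
def optionSumLeft (k r : ℕ) : Option (Fin k ⊕ Fin r) ≃ Fin (k + 1) ⊕ Fin r where
  toFun x := x.elim (.inl (Fin.last k)) (Sum.map Fin.castSucc id)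
  invFun := Sum.elim (Fin.lastCases none fun i => some (.inl i)) fun j => some (.inr j)
  left_inv := by rintro (_ | i | j) <;> simp
  right_inv := by
    rintro (i | j)
    · refine Fin.lastCases ?_ (fun i => ?_) i <;> simp
    · simp

/-- Adjoining an element as the last one of the second summand. -/
def optionSumRight (k r : ℕ) : Option (Fin k ⊕ Fin r) ≃ Fin k ⊕ Fin (r + 1) where
  toFun x := x.elim (.inr (Fin.last r)) (Sum.map id Fin.castSucc)
  invFun := Sum.elim (fun i => some (.inl i)) (Fin.lastCases none fun j => some (.inr j))
  left_inv := by rintro (_ | i | j) <;> simp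
  right_inv := by
    rintro (i | j)
    · simp
    · refine Fin.lastCases ?_ (fun i => ?_) j <;> simp

lemma inl_notMem_infVerts (i : Fin n) : (Sum.inl i : Fin n ⊕ Fin r) ∉ c.curve.infVerts := by
  rintro ⟨k, hk⟩
  cases hk

lemma inr_mem_infVerts (j : Fin r) : (Sum.inr j : Fin n ⊕ Fin r) ∈ c.curve.infVerts := ⟨j, rfl⟩

lemma isSubdivision_subdiv {e : Fin m} {s t : ℝ} {hs : 0 < s} {ht : 0 < t} (h : s + t = c.len e) :
    AbstractTropicalCurve.IsSubdivision c.curve (c.subdiv e s t hs ht).curve := by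
  set c' := c.subdiv e s t hs ht with hc'
  refine ⟨.inl e, .inl (c.tail e), .inl (c.head e), optionSumLeft n r, optionSumLeft m r, rfl,
    ?_, ?_, ?_, ?_, ?_, ?_, ?_⟩
  · change c'.ends (.inl e.castSucc) = s(.inl (c.tail e).castSucc, .inl (Fin.last n))
    simp [hc', ends, subdiv]
  · change c'.ends (.inl (Fin.last m)) = s(.inl (Fin.last n), .inl (c.head e).castSucc)
    simp [hc', ends, subdiv, Function.update_of_ne (Fin.castSucc_lt_last e).ne']
  · change c'.length (.inl e.castSucc) + c'.length (.inl (Fin.last m)) = c.length (.inl e)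
    simp [hc', subdiv, length, Function.update_of_ne (Fin.castSucc_lt_last e).ne',
      ← ENNReal.ofReal_add hs.le ht.le, h]
  · rintro (i | j) hi
    · have : i ≠ e := fun h => hi (h ▸ rfl)
      change c'.ends (.inl i.castSucc) = s(.inl (c.tail i).castSucc, .inl (c.head i).castSucc)
      simp [hc', subdiv, ends, this]
    · rfl
  · rintro (i | j) hi
    · have : i ≠ e := fun h => hi (h ▸ rfl)
      change c'.length (.inl i.castSucc) = c.length (.inl i)
      simp [hc', subdiv, length, this]
    · rfl
  · rintro (i | j)
    · exact iff_of_false (c'.inl_notMem_infVerts _) (c.inl_notMem_infVerts _)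
    · exact iff_of_true (c'.inr_mem_infVerts _) (c.inr_mem_infVerts _)
  · exact c'.inl_notMem_infVerts _

lemma isElementaryModification_attach (v : Fin n) :
    AbstractTropicalCurve.IsElementaryModification c.curve (c.attach v).curve := by
  refine ⟨.inl v, optionSumRight n r, optionSumRight m r, c.inl_notMem_infVerts v,
    ?_, rfl, ?_, ?_, ?_, ?_⟩
  · change (c.attach v).ends (.inr (Fin.last r)) = s(.inl v, .inr (Fin.last r))
    simp [attach, ends]
  · rintro (i | j)
    · rfl
    · change (c.attach v).ends (.inr j.castSucc) = s(.inl (c.base j), .inr j.castSucc)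
      simp [attach, ends]
  · rintro (i | j) <;> rfl
  · rintro (i | j)
    · exact iff_of_false ((c.attach v).inl_notMem_infVerts _) (c.inl_notMem_infVerts _)
    · exact iff_of_true ((c.attach v).inr_mem_infVerts _) (c.inr_mem_infVerts _)
  · exact (c.attach v).inr_mem_infVerts _

/-- The chosen vertex and the proofs in the tables do not enter the data of the curve. -/
lemma ext' {c c' : Comb n m r} (h1 : c.tail = c'.tail) (h2 : c.head = c'.head)
    (h3 : c.len = c'.len) (h4 : c.base = c'.base) : c.curve = c'.curve := by
  have h5 : c.ends = c'.ends := by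
    funext e
    rcases e with e | j <;> simp [ends, h1, h2, h4]
  have h6 : c.length = c'.length := by
    funext e
    rcases e with e | j <;> simp [length, h3]
  simp only [curve, h5, h6]

end Comb

/-- A drawing of a graph in the plane, in coordinates. -/
structure Layout {n m r : ℕ} (c : Comb n m r) where
  pos : Fin n → Plane
  dir : Fin m → Fin 2 → ℤ
  rdir : Fin r → Fin 2 → ℤ
  prim : ∀ e, IsPrimitive (dir e)
  rprim : ∀ j, IsPrimitive (rdir j)
  pos_head : ∀ e, pos (c.head e) = pos (c.tail e) + c.len e • toPlane (dir e)
  edge_edge : ∀ e e', e < e' → ∀ t s : ℝ, 0 < t → t < c.len e → 0 < s → s < c.len e' →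
    pos (c.tail e) 0 + t * dir e 0 = pos (c.tail e') 0 + s * dir e' 0 →
    pos (c.tail e) 1 + t * dir e 1 = pos (c.tail e') 1 + s * dir e' 1 → False
  edge_ray : ∀ e j, ∀ t s : ℝ, 0 < t → t < c.len e → 0 < s →
    pos (c.tail e) 0 + t * dir e 0 = pos (c.base j) 0 + s * rdir j 0 →
    pos (c.tail e) 1 + t * dir e 1 = pos (c.base j) 1 + s * rdir j 1 → False
  ray_ray : ∀ i j, i < j → ∀ t s : ℝ, 0 < t → 0 < s →
    pos (c.base i) 0 + t * rdir i 0 = pos (c.base j) 0 + s * rdir j 0 →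
    pos (c.base i) 1 + t * rdir i 1 = pos (c.base j) 1 + s * rdir j 1 → False
  vertex_edge : ∀ v e, ∀ t : ℝ, 0 < t → t < c.len e → pos v 0 = pos (c.tail e) 0 + t * dir e 0 →
    pos v 1 = pos (c.tail e) 1 + t * dir e 1 → False
  vertex_ray : ∀ v j, ∀ t : ℝ, 0 < t → pos v 0 = pos (c.base j) 0 + t * rdir j 0 →
    pos v 1 = pos (c.base j) 1 + t * rdir j 1 → False

namespace Layout

variable {n m r : ℕ} {c : Comb n m r} (l : Layout c)

/-- The underlying drawing. -/
noncomputable def drawing : Drawing (Fin n) (Fin m ⊕ Fin r) where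
  pos := l.pos
  tail := Sum.elim c.tail c.base
  head := Sum.elim (fun e => some (c.head e)) fun _ => none
  dir := Sum.elim l.dir l.rdir
  -- Rays receive a dummy length.
  len := Sum.elim c.len fun _ => 1
  prim := by rintro (e | j); exacts [l.prim e, l.rprim j]
  len_pos := by rintro (e | j); exacts [c.len_pos e, one_pos]
  pos_head := by
    rintro (e | j) v h
    · obtain rfl : c.head e = v := by simpa using h
      exact l.pos_head e
    · simp at h
  disj := by
    have ee : ∀ e e', e < e' → Disjoint (track (l.pos (c.tail e)) (toPlane (l.dir e)) (c.len e) true)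
        (track (l.pos (c.tail e')) (toPlane (l.dir e')) (c.len e') true) := by
      intro e e' h
      rw [Set.disjoint_left]
      rintro q ⟨t, h1, h2, rfl⟩ ⟨s, h3, h4, h5⟩
      exact l.edge_edge e e' h t s h1 (h2 rfl) h3 (h4 rfl) (congrFun h5 0) (congrFun h5 1)
    have er : ∀ e j, Disjoint (track (l.pos (c.tail e)) (toPlane (l.dir e)) (c.len e) true)
        (track (l.pos (c.base j)) (toPlane (l.rdir j)) 1 false) := by
      intro e j
      rw [Set.disjoint_left]
      rintro q ⟨t, h1, h2, rfl⟩ ⟨s, h3, -, h5⟩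
      exact l.edge_ray e j t s h1 (h2 rfl) h3 (congrFun h5 0) (congrFun h5 1)
    have rr : ∀ i j, i < j → Disjoint (track (l.pos (c.base i)) (toPlane (l.rdir i)) 1 false)
        (track (l.pos (c.base j)) (toPlane (l.rdir j)) 1 false) := by
      intro i j h
      rw [Set.disjoint_left]
      rintro q ⟨t, h1, -, rfl⟩ ⟨s, h3, -, h5⟩
      exact l.ray_ray i j h t s h1 h3 (congrFun h5 0) (congrFun h5 1)
    rintro (e | i) (e' | j) hne
    · rcases lt_trichotomy e e' with h | rfl | h
      · exact ee e e' h
      · exact absurd rfl hne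
      · exact (ee e' e h).symm
    · exact er e j
    · exact (er e' i).symm
    · rcases lt_trichotomy i j with h | rfl | h
      · exact rr i j h
      · exact absurd rfl hne
      · exact (rr j i h).symm
  notMem := by
    rintro v (e | j) ⟨t, h1, h2, h3⟩
    · exact l.vertex_edge v e t h1 (h2 rfl) (congrFun h3 0) (congrFun h3 1)
    · exact l.vertex_ray v j t h1 (congrFun h3 0) (congrFun h3 1)

/-- The source of a dart. -/
def dartSrc (c : Comb n m r) : (Fin m ⊕ Fin r) × Bool → Option (Fin n)
  | (.inl e, true) => some (c.tail e)
  | (.inl e, false) => some (c.head e)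
  | (.inr j, true) => some (c.base j)
  | (.inr _, false) => none

/-- The direction of a dart. -/
def dartVec : (Fin m ⊕ Fin r) × Bool → Fin 2 → ℤ
  | (.inl e, true) => l.dir e
  | (.inl e, false) => -l.dir e
  | (.inr j, true) => l.rdir j
  | (.inr j, false) => -l.rdir j

lemma drawing_src (δ : (Fin m ⊕ Fin r) × Bool) : l.drawing.src δ = dartSrc c δ := by
  rcases δ with ⟨e | j, _ | _⟩ <;> rfl

lemma drawing_vec (δ : (Fin m ⊕ Fin r) × Bool) : l.drawing.vec δ = l.dartVec δ := by
  rcases δ with ⟨e | j, _ | _⟩ <;> rfl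

/-- Three darts leave the vertex `v`, and they form a unimodular tripod. -/
def IsTripod (v : Fin n) : Prop :=
  ∃ α β γ, dartSrc c α = some v ∧ dartSrc c β = some v ∧ dartSrc c γ = some v ∧
    cross (l.dartVec α) (l.dartVec β) = 1 ∧ l.dartVec γ = -(l.dartVec α + l.dartVec β) ∧
    ∀ ε, dartSrc c ε = some v → ε = α ∨ ε = β ∨ ε = γ

/-- No other vertex has this position, so the germ of the curve consists of the three given legs. -/
lemma isSmoothAt_pos {v : Fin n} (hv : l.IsTripod v) (hinj : ∀ w, l.pos w = l.pos v → w = v) :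
    IsSmoothAt l.drawing.support (l.pos v) := by
  obtain ⟨α, β, γ, h1, h2, h3, h4, h5, h6⟩ := hv
  rw [isSmoothAt_iff]
  refine Or.inr ⟨l.dartVec α, l.dartVec β, h4, ?_⟩
  filter_upwards [l.drawing.eventually_mem_support_pos v] with q hq
  rw [hq]
  simp only [drawing_src, drawing_vec, tripod, Set.mem_ofPred_eq]
  change (q = l.pos v ∨ ∃ δ w, dartSrc c δ = some w ∧ l.pos w = l.pos v ∧ ∃ t : ℝ, 0 < t ∧
    q = l.pos v + t • toPlane (l.dartVec δ)) ↔ _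
  rw [← h5]
  constructor
  · rintro (rfl | ⟨δ, w, h7, h8, t, ht, rfl⟩)
    · exact ⟨0, le_rfl, Or.inl (by simp)⟩
    · rw [hinj w h8] at h7
      refine ⟨t, ht.le, ?_⟩
      rcases h6 δ h7 with rfl | rfl | rfl <;> simp
  · rintro ⟨t, ht, h⟩
    rcases ht.eq_or_lt with rfl | ht
    · left
      simpa using h
    · right
      rcases h with h | h | h
      · exact ⟨α, v, h1, rfl, t, ht, h⟩
      · exact ⟨β, v, h2, rfl, t, ht, h⟩
      · exact ⟨γ, v, h3, rfl, t, ht, h⟩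

lemma isSmoothAt_arc {p : Plane} {e : Fin m ⊕ Fin r} (hp : p ∈ l.drawing.arc e) :
    IsSmoothAt l.drawing.support p := by
  rw [isSmoothAt_iff]
  exact Or.inl ⟨_, l.drawing.prim e, l.drawing.eventually_mem_support_of_mem_arc hp⟩

lemma arc_inl (e : Fin m) : l.drawing.arc (.inl e) =
    openSegment ℝ (l.pos (c.tail e)) (l.pos (c.head e)) := by
  rw [l.pos_head, openSegment_eq_track _ _ (c.len_pos e)]
  rfl

lemma isFiniteUnion (hd : ∀ v, ∃ δ, dartSrc c δ = some v) :
    IsFiniteUnionOfSegmentsAndRays l.drawing.support := by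
  let S : Fin m ⊕ Fin r → Set Plane := Sum.elim
    (fun e => segment ℝ (l.pos (c.tail e)) (l.pos (c.head e)))
    (fun j => ray (l.pos (c.base j)) (toPlane (l.rdir j)))
  refine ⟨Set.range S, Set.finite_range S, ?_, ?_⟩
  · apply Set.Subset.antisymm
    · rintro q (⟨v, rfl⟩ | hq)
      · obtain ⟨⟨e | j, _ | _⟩, hδ⟩ := hd v
        · obtain rfl : c.head e = v := by simpa [dartSrc] using hδ
          exact ⟨S (.inl e), ⟨_, rfl⟩, right_mem_segment ℝ _ _⟩
        · obtain rfl : c.tail e = v := by simpa [dartSrc] using hδ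
          exact ⟨S (.inl e), ⟨_, rfl⟩, left_mem_segment ℝ _ _⟩
        · simp [dartSrc] at hδ
        · obtain rfl : c.base j = v := by simpa [dartSrc] using hδ
          exact ⟨S (.inr j), ⟨_, rfl⟩, 0, le_rfl, by simp [drawing]⟩
      · obtain ⟨e | j, he⟩ := Set.mem_iUnion.1 hq
        · rw [arc_inl] at he
          exact ⟨S (.inl e), ⟨_, rfl⟩, openSegment_subset_segment _ _ _ he⟩
        · obtain ⟨t, ht, -, rfl⟩ := he
          exact ⟨S (.inr j), ⟨_, rfl⟩, t, ht.le, rfl⟩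
    · rintro q ⟨_, ⟨e | j, rfl⟩, hq⟩
      · have hq : q ∈ segment ℝ (l.pos (c.tail e)) (l.pos (c.head e)) := hq
        rcases l.drawing.exists_src_eq_of_mem_segment (e := .inl e) rfl hq with h | h | h
        · exact h ▸ l.drawing.pos_mem _
        · exact h ▸ l.drawing.pos_mem _
        · exact l.drawing.arc_subset _ h
      · obtain ⟨t, ht, rfl⟩ := hq
        rcases ht.eq_or_lt with rfl | ht
        · rw [zero_smul, add_zero]
          exact l.drawing.pos_mem _
        · exact l.drawing.arc_subset (.inr j) ⟨t, ht, by simp [drawing], rfl⟩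
  · rintro _ ⟨e | j, rfl⟩
    · left
      refine ⟨_, _, ?_, rfl⟩
      rw [l.pos_head]
      intro h
      have h1 := left_eq_add.1 h
      rcases smul_eq_zero.1 h1 with h2 | h2
      · exact (c.len_pos e).ne' h2
      · exact (l.prim e).toPlane_ne_zero h2
    · right
      exact ⟨_, _, (l.rprim j).toPlane_ne_zero, rfl⟩

/-- The support of a layout resolves to the abstract curve. -/
noncomputable def resolution
    (h1 : ∀ v w, l.pos v = l.pos w → IsSmoothAt l.drawing.support (l.pos v) → v = w)
    (h2 : ∀ p a b, IsNodeAt l.drawing.support p a b → ∃ v w, v ≠ w ∧ (∀ x, l.pos x = p ↔ x = v ∨ x = w) ∧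
      (∀ δ, dartSrc c δ = some v → ∀ q ∈ l.drawing.arc δ.1, ∃ t : ℝ, q = p + t • toPlane a) ∧
      (∀ δ, dartSrc c δ = some w → ∀ q ∈ l.drawing.arc δ.1, ∃ t : ℝ, q = p + t • toPlane b)) :
    Resolution l.drawing.support c.curve where
  -- The position of an infinite vertex is arbitrary.
  pos := Sum.elim l.pos fun _ => 0
  arc := l.drawing.arc
  finite_arc := by
    rintro (e | j) u v h hu hv
    · have hlen : (c.curve.length (.inl e)).toReal = c.len e :=
        ENNReal.toReal_ofReal (c.len_pos e).le
      rw [hlen, l.arc_inl]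
      rcases Sym2.eq_iff.1 h with ⟨rfl, rfl⟩ | ⟨rfl, rfl⟩
      · exact ⟨rfl, _, l.prim e, by simp [l.pos_head]⟩
      · refine ⟨openSegment_symm _ _ _, _, (l.prim e).neg, ?_⟩
        simp [l.pos_head, toPlane_neg]
    · rcases Sym2.eq_iff.1 h with ⟨rfl, rfl⟩ | ⟨rfl, rfl⟩
      · exact absurd ⟨j, rfl⟩ hv
      · exact absurd ⟨j, rfl⟩ hu
  infinite_arc := by
    rintro (e | j) u _ h ⟨i, rfl⟩
    · rcases Sym2.eq_iff.1 h with ⟨-, h⟩ | ⟨h, -⟩ <;> cases h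
    · rcases Sym2.eq_iff.1 h with ⟨rfl, -⟩ | ⟨h, -⟩
      · refine ⟨c.inl_notMem_infVerts _, _, l.rprim j, ?_⟩
        ext q
        constructor
        · rintro ⟨t, ht, -, rfl⟩
          exact ⟨t, ht, rfl⟩
        · rintro ⟨t, ht, rfl⟩
          exact ⟨t, ht, by simp [drawing], rfl⟩
      · cases h
  cover := by
    rw [Drawing.support]
    congr 1
    ext q
    constructor
    · rintro ⟨v, rfl⟩
      exact ⟨.inl v, c.inl_notMem_infVerts v, rfl⟩
    · rintro ⟨v | j, hv, rfl⟩
      · exact ⟨v, rfl⟩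
      · exact absurd ⟨j, rfl⟩ hv
  arc_disjoint := fun e e' h => l.drawing.arc_disjoint h
  pos_notMem_arc := by
    rintro (v | j) hv e
    · exact l.drawing.pos_notMem_arc v e
    · exact absurd ⟨j, rfl⟩ hv
  pos_smooth := by
    rintro (v | j) (w | k) hv hw h hs
    · rw [h1 v w h hs]
    · exact absurd ⟨k, rfl⟩ hw
    · exact absurd ⟨j, rfl⟩ hv
    · exact absurd ⟨j, rfl⟩ hv
  pos_node := by
    intro p a b hp
    obtain ⟨v, w, hvw, h3, h4, h5⟩ := h2 p a b hp
    have key : ∀ e v, Sum.inl v ∈ c.ends e → ∃ b, dartSrc c (e, b) = some v := by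
      rintro (e | j) v hv
      · simp only [Comb.ends, Sym2.mem_iff, Sum.inl.injEq] at hv
        rcases hv with rfl | rfl
        · exact ⟨true, rfl⟩
        · exact ⟨false, rfl⟩
      · simp only [Comb.ends, Sym2.mem_iff, Sum.inl.injEq, reduceCtorEq, or_false] at hv
        rw [hv]
        exact ⟨true, rfl⟩
    refine ⟨.inl v, .inl w, fun h => hvw (Sum.inl.inj h), Set.ext ?_, ?_, ?_⟩
    · rintro (x | j)
      · constructor
        · rintro ⟨-, hx⟩
          exact ((h3 x).1 hx).imp (congrArg Sum.inl) (congrArg Sum.inl)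
        · intro hx
          exact ⟨c.inl_notMem_infVerts x, (h3 x).2 (hx.imp Sum.inl.inj Sum.inl.inj)⟩
      · constructor
        · rintro ⟨hx, -⟩
          exact absurd (c.inr_mem_infVerts j) hx
        · rintro (hx | hx) <;> cases hx
    · intro e he q hq
      obtain ⟨b, hb⟩ := key e v he
      exact h4 _ hb q hq
    · intro e he q hq
      obtain ⟨b, hb⟩ := key e w he
      exact h5 _ hb q hq

/-- A layout all of whose vertices are unimodular tripods is a planar embedding. -/
lemma isEmbedding (hv : ∀ v, l.IsTripod v) (hinj : Function.Injective l.pos)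
    {Γ : AbstractTropicalCurve} (hΓ : Γ.IsModification c.curve) :
    IsEmbedding l.drawing.support Γ := by
  have hs : ∀ p ∈ l.drawing.support, IsSmoothAt l.drawing.support p := by
    rintro p (⟨v, rfl⟩ | hp)
    · exact l.isSmoothAt_pos (hv v) fun w hw => hinj hw
    · obtain ⟨e, he⟩ := Set.mem_iUnion.1 hp
      exact l.isSmoothAt_arc he
  refine ⟨⟨l.isFiniteUnion fun v => ?_, hs⟩, _, hΓ, ⟨l.resolution (fun v w h _ => hinj h) ?_⟩⟩
  · obtain ⟨α, -, -, hα, -⟩ := hv v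
    exact ⟨α, hα⟩
  · intro p a b hp
    exact absurd (hs p hp.mem) hp.not_isSmoothAt

end Layout

/-- A planar embedding shows that the crossing number vanishes. -/
lemma IsEmbedding.crossingNumber_eq_zero {C : Set Plane} {Γ : AbstractTropicalCurve}
    (h : IsEmbedding C Γ) : Γ.crossingNumber = 0 := by
  have h0 : nodeCount C = 0 := by
    rw [nodeCount, ← bot_eq_zero, iSup_eq_bot]
    intro s
    rw [bot_eq_zero]
    apply Finset.sum_eq_zero
    intro p _
    have : {m | ∃ a b, IsNodeAt C p a b ∧ m = (a 0 * b 1 - a 1 * b 0).natAbs} = ∅ := by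
      ext m
      simp only [Set.mem_ofPred_eq, Set.mem_empty_iff_false, iff_false]
      rintro ⟨a, b, hab, -⟩
      exact hab.not_isSmoothAt (h.1.2 p hab.mem)
    rw [nodeMultiplicity, this]
    simp
  rw [← nonpos_iff_eq_zero, ← h0]
  exact iInf₂_le C ⟨⟨h.1.1, fun p hp => Or.inl (h.1.2 p hp)⟩, h.2⟩

end PlaneTropical

/-! ### Finite checks on incidence and direction tables. -/

namespace PlaneTropical

namespace Comb

variable {n m r : ℕ}

lemma isModification_subdiv {Γ : AbstractTropicalCurve} {c : Comb n m r} {e : Fin m} {s t : ℝ}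
    {hs : 0 < s} {ht : 0 < t} (hΓ : Γ.IsModification c.curve) (h : s + t = c.len e) :
    Γ.IsModification (c.subdiv e s t hs ht).curve :=
  hΓ.tail (Or.inr (Or.inl (c.isSubdivision_subdiv h)))

lemma isModification_attach {Γ : AbstractTropicalCurve} {c : Comb n m r} {v : Fin n}
    (hΓ : Γ.IsModification c.curve) : Γ.IsModification (c.attach v).curve :=
  hΓ.tail (Or.inr (Or.inr (Or.inr (c.isElementaryModification_attach v))))

end Comb

/-- The source of a dart, from the incidence tables. -/
def tableSrc {n m r : ℕ} (tail head : Fin m → Fin n) (base : Fin r → Fin n) :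
    (Fin m ⊕ Fin r) × Bool → Option (Fin n)
  | (.inl e, true) => some (tail e)
  | (.inl e, false) => some (head e)
  | (.inr j, true) => some (base j)
  | (.inr _, false) => none

/-- The direction of a dart, from the direction tables. -/
def tableVec {m r : ℕ} (dir : Fin m → Fin 2 → ℤ) (rdir : Fin r → Fin 2 → ℤ) :
    (Fin m ⊕ Fin r) × Bool → Fin 2 → ℤ
  | (.inl e, true) => dir e
  | (.inl e, false) => -dir e
  | (.inr j, true) => rdir j
  | (.inr j, false) => -rdir j

/-- The three darts `τ` form a unimodular tripod at `v`. -/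
def TableTripod {n m r : ℕ} (tail head : Fin m → Fin n) (base : Fin r → Fin n)
    (dir : Fin m → Fin 2 → ℤ) (rdir : Fin r → Fin 2 → ℤ)
    (τ : Fin 3 → (Fin m ⊕ Fin r) × Bool) (v : Fin n) : Prop :=
  (∀ i, tableSrc tail head base (τ i) = some v) ∧
    tableVec dir rdir (τ 0) 0 * tableVec dir rdir (τ 1) 1 -
      tableVec dir rdir (τ 0) 1 * tableVec dir rdir (τ 1) 0 = 1 ∧
    (∀ i, tableVec dir rdir (τ 2) i =
      -(tableVec dir rdir (τ 0) i + tableVec dir rdir (τ 1) i)) ∧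
    (∀ e b, tableSrc tail head base (.inl e, b) = some v → ∃ i, (.inl e, b) = τ i) ∧
    ∀ j, base j = v → ∃ i, (.inr j, true) = τ i

instance {n m r : ℕ} (tail head : Fin m → Fin n) (base : Fin r → Fin n)
    (dir : Fin m → Fin 2 → ℤ) (rdir : Fin r → Fin 2 → ℤ)
    (τ : Fin 3 → (Fin m ⊕ Fin r) × Bool) (v : Fin n) :
    Decidable (TableTripod tail head base dir rdir τ v) := by
  unfold TableTripod
  infer_instance

namespace Layout

variable {n m r : ℕ} {c : Comb n m r} (l : Layout c)

lemma tableSrc_eq (δ : (Fin m ⊕ Fin r) × Bool) :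
    tableSrc c.tail c.head c.base δ = dartSrc c δ := by
  rcases δ with ⟨e | j, _ | _⟩ <;> rfl

lemma tableVec_eq (δ : (Fin m ⊕ Fin r) × Bool) : tableVec l.dir l.rdir δ = l.dartVec δ := by
  rcases δ with ⟨e | j, _ | _⟩ <;> rfl

lemma isTripod_of_table {v : Fin n} (τ : Fin 3 → (Fin m ⊕ Fin r) × Bool)
    (h : TableTripod c.tail c.head c.base l.dir l.rdir τ v) : l.IsTripod v := by
  obtain ⟨h1, h2, h3, h4, h5⟩ := h
  simp only [tableSrc_eq, tableVec_eq] at h1 h2 h3 h4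
  refine ⟨τ 0, τ 1, τ 2, h1 0, h1 1, h1 2, h2, funext h3, ?_⟩
  have key : ∀ ε, (∃ i, ε = τ i) → ε = τ 0 ∨ ε = τ 1 ∨ ε = τ 2 := by
    rintro ε ⟨i, rfl⟩
    fin_cases i <;> simp
  rintro ⟨e | j, b⟩ hε
  · exact key _ (h4 e b hε)
  · cases b
    · simp [dartSrc] at hε
    · exact key _ (h5 j (Option.some.inj hε))

end Layout

/-! ### Embeddings of theta graphs with unequal edges. -/

/-- The theta graph. -/
noncomputable def thetaComb (a b c : ℝ) (ha : 0 < a) (hb : 0 < b) (hc : 0 < c) : Comb 2 3 0 where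
  tail := ![0, 0, 0]
  head := ![1, 1, 1]
  len := ![a, b, c]
  base := ![]
  len_pos := by intro e; fin_cases e <;> assumption
  vertex := 0
  conn := by
    intro f hf i j
    have h := hf 0
    simp only [Matrix.cons_val_zero] at h
    fin_cases i <;> fin_cases j <;> simp [h]

lemma isPrimitive_iff_gcd {d : Fin 2 → ℤ} : IsPrimitive d ↔ Int.gcd (d 0) (d 1) = 1 :=
  Int.isCoprime_iff_gcd_eq_one

section Theta

variable (k : ℤ) (a W s : ℝ) (ha : 0 < a) (hW : 0 < W) (hs : 0 < s)
  (hd : 0 < a + 2 * (1 - k) * W)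

/-- The subdivided theta graph, with four infinite edges attached. -/
noncomputable def thetaSubdivided (he : 0 < a + 2 * k * s) : Comb 6 7 4 where
  tail := ![0, 0, 0, 2, 3, 4, 5]
  head := ![1, 2, 4, 3, 1, 5, 1]
  -- The strands have lengths `a`, `a + (4 - 2 * k) * W` and `a + (2 * k + 2) * s`.
  len := ![a, W, s, a + 2 * (1 - k) * W, W, a + 2 * k * s, s]
  base := ![2, 3, 4, 5]
  len_pos := by intro e; fin_cases e <;> assumption
  vertex := 0
  conn := by
    intro f hf
    have h0 : f 0 ↔ f 1 := hf 0
    have h1 : f 0 ↔ f 2 := hf 1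
    have h2 : f 0 ↔ f 4 := hf 2
    have h3 : f 2 ↔ f 3 := hf 3
    have h4 : f 4 ↔ f 5 := hf 5
    have key : ∀ i, f i ↔ f 0 := by
      intro i
      fin_cases i
      exacts [Iff.rfl, h0.symm, h1.symm, (h1.trans h3).symm, h2.symm, (h2.trans h4).symm]
    exact fun i j => (key i).trans (key j).symm

lemma isModification_thetaSubdivided {b c : ℝ} (hb : 0 < b) (hc : 0 < c)
    (hb' : b = a + (4 - 2 * k) * W) (hc' : c = a + (2 * k + 2) * s) (he : 0 < a + 2 * k * s)
    {Γ : AbstractTropicalCurve} (h : Γ.IsModification (thetaComb a b c ha hb hc).curve) :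
    Γ.IsModification (thetaSubdivided k a W s ha hW hs hd he).curve := by
  have h1 := Comb.isModification_subdiv (e := 1) (s := W) (t := a + 2 * (1 - k) * W + W)
    (hs := hW) (ht := by linarith) h (by simp [thetaComb]; linarith)
  -- The first cut appended the remainder of the strand as the last edge, which is now cut in turn.
  have h2 := Comb.isModification_subdiv (e := 3) (s := a + 2 * (1 - k) * W) (t := W)
    (hs := hd) (ht := hW) h1 rfl
  have h3 := Comb.isModification_subdiv (e := 2) (s := s) (t := a + 2 * k * s + s)
    (hs := hs) (ht := by linarith) h2 (by change _ = c; linarith)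
  have h4 := Comb.isModification_subdiv (e := 5) (s := a + 2 * k * s) (t := s)
    (hs := he) (ht := hs) h3 rfl
  have h5 := Comb.isModification_attach (v := 5) <| Comb.isModification_attach (v := 4) <|
    Comb.isModification_attach (v := 3) <| Comb.isModification_attach (v := 2) h4
  convert h5 using 1
  apply Comb.ext' <;> funext i <;> fin_cases i <;> rfl

set_option maxHeartbeats 1000000 in
/-- A drawing of the subdivided theta graph. -/
noncomputable def thetaLayout (hk : k = 1 ∨ k = 2) (he : 0 < a + 2 * k * s) :
    Layout (thetaSubdivided k a W s ha hW hs hd he) where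
  -- Two trapezoids, of widths `W` and `s`, share the vertical segment from `(0, a)` to `(0, 0)`;
  -- the slopes of their other sides depend on `k`.
  pos := ![![0, a], ![0, 0], ![-W, a + (1 - k) * W], ![-W, -((1 - k) * W)], ![s, a + k * s],
    ![s, -(k * s)]]
  dir := ![![0, -1], ![-1, 1 - k], ![1, k], ![0, -1], ![1, 1 - k], ![0, -1], ![-1, k]]
  rdir := ![![-1, 2 - k], ![-1, k - 2], ![1, k + 1], ![1, -k - 1]]
  prim e := by
    rw [isPrimitive_iff_gcd]
    revert e
    rcases hk with rfl | rfl <;> decide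
  rprim e := by
    rw [isPrimitive_iff_gcd]
    revert e
    rcases hk with rfl | rfl <;> decide
  pos_head := by
    intro e
    funext i
    fin_cases e <;> fin_cases i <;> simp [thetaSubdivided, toPlane] <;> ring
  edge_edge := by
    intro e e' h t s' h1 h2 h3 h4 h5 h6
    rcases hk with rfl | rfl <;> fin_cases e <;> fin_cases e' <;>
      simp [thetaSubdivided] at h h2 h4 h5 h6 hd <;> linarith
  edge_ray := by
    intro e e' t s' h1 h2 h3 h5 h6
    rcases hk with rfl | rfl <;> fin_cases e <;> fin_cases e' <;>
      simp [thetaSubdivided] at h2 h5 h6 hd <;> linarith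
  ray_ray := by
    intro e e' h t s' h1 h3 h5 h6
    rcases hk with rfl | rfl <;> fin_cases e <;> fin_cases e' <;>
      simp [thetaSubdivided] at h h5 h6 hd <;> linarith
  vertex_edge := by
    intro e e' t h1 h2 h5 h6
    rcases hk with rfl | rfl <;> fin_cases e <;> fin_cases e' <;>
      simp [thetaSubdivided] at h2 h5 h6 hd <;> linarith
  vertex_ray := by
    intro e e' t h1 h5 h6
    rcases hk with rfl | rfl <;> fin_cases e <;> fin_cases e' <;>
      simp [thetaSubdivided] at h5 h6 hd <;> linarith

lemma isTripod_thetaLayout (hk : k = 1 ∨ k = 2) (he : 0 < a + 2 * k * s) (v : Fin 6) :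
    (thetaLayout k a W s ha hW hs hd hk he).IsTripod v := by
  let τ : Fin 6 → Fin 3 → (Fin 7 ⊕ Fin 4) × Bool := ![
    ![(.inl 0, true), (.inl 2, true), (.inl 1, true)],
    ![(.inl 0, false), (.inl 4, false), (.inl 6, false)],
    ![(.inl 1, false), (.inr 0, true), (.inl 3, true)],
    ![(.inl 4, true), (.inl 3, false), (.inr 1, true)],
    ![(.inl 2, false), (.inl 5, true), (.inr 2, true)],
    ![(.inl 6, true), (.inr 3, true), (.inl 5, false)]]
  apply Layout.isTripod_of_table _ (τ v)
  revert v
  rcases hk with rfl | rfl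
  · change ∀ v, TableTripod ![0, 0, 0, 2, 3, 4, 5] ![1, 2, 4, 3, 1, 5, 1] ![2, 3, 4, 5]
      ![![0, -1], ![-1, 1 - 1], ![1, 1], ![0, -1], ![1, 1 - 1], ![0, -1], ![-1, 1]]
      ![![-1, 2 - 1], ![-1, 1 - 2], ![1, 1 + 1], ![1, -1 - 1]] (τ v) v
    decide
  · change ∀ v, TableTripod ![0, 0, 0, 2, 3, 4, 5] ![1, 2, 4, 3, 1, 5, 1] ![2, 3, 4, 5]
      ![![0, -1], ![-1, 1 - 2], ![1, 2], ![0, -1], ![1, 1 - 2], ![0, -1], ![-1, 2]]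
      ![![-1, 2 - 2], ![-1, 2 - 2], ![1, 2 + 1], ![1, -2 - 1]] (τ v) v
    decide

lemma pos_thetaLayout_injective (hk : k = 1 ∨ k = 2) (he : 0 < a + 2 * k * s) :
    Function.Injective (thetaLayout k a W s ha hW hs hd hk he).pos := by
  intro v w h
  have h0 := congrFun h 0
  have h1 := congrFun h 1
  clear h
  rcases hk with rfl | rfl <;> fin_cases v <;> fin_cases w <;> 
    first | rfl | (simp [thetaLayout] at h0 h1 hd; linarith)

end Theta

/-- A theta graph whose edge lengths `a ≤ b ≤ c` are not all equal has a planar embedding. -/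
lemma exists_isEmbedding_theta {a b c : ℝ} (ha : 0 < a) (hb : 0 < b) (hc : 0 < c) (hab : a ≤ b)
    (hbc : b ≤ c) (hac : a < c) {Γ : AbstractTropicalCurve}
    (h : Γ.IsModification (thetaComb a b c ha hb hc).curve) : ∃ C, IsEmbedding C Γ := by
  rcases hab.lt_or_eq with hab | rfl
  -- For `k = 1` the strands have lengths `a`, `a + 2W`, `a + 4s`, which allows any two lengths
  -- greater than `a`.
  · have hW : 0 < (b - a) / 2 := by linarith
    have hs : 0 < (c - a) / 4 := by linarith
    have hd : 0 < a + 2 * (1 - ((1 : ℤ) : ℝ)) * ((b - a) / 2) := by simpa using ha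
    have he : 0 < a + 2 * ((1 : ℤ) : ℝ) * ((c - a) / 4) := by push_cast; linarith
    exact ⟨_, (thetaLayout 1 a ((b - a) / 2) ((c - a) / 4) ha hW hs hd (Or.inl rfl) he).isEmbedding
      (isTripod_thetaLayout _ _ _ _ _ _ _ _ _ _) (pos_thetaLayout_injective _ _ _ _ _ _ _ _ _ _)
      (isModification_thetaSubdivided _ _ _ _ ha hW hs hd hb hc (by push_cast; ring)
        (by push_cast; ring) he h)⟩
  -- For `k = 2` the second strand has length `a` whatever `W` is; `W = a / 4` keeps its middle edge
  -- `a - 2W` positive. The third has length `a + 6s`.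
  · have hW : 0 < a / 4 := by linarith
    have hs : 0 < (c - a) / 6 := by linarith
    have hd : 0 < a + 2 * (1 - ((2 : ℤ) : ℝ)) * (a / 4) := by push_cast; linarith
    have he : 0 < a + 2 * ((2 : ℤ) : ℝ) * ((c - a) / 6) := by push_cast; linarith
    exact ⟨_, (thetaLayout 2 a (a / 4) ((c - a) / 6) ha hW hs hd (Or.inr rfl) he).isEmbedding
      (isTripod_thetaLayout _ _ _ _ _ _ _ _ _ _) (pos_thetaLayout_injective _ _ _ _ _ _ _ _ _ _)
      (isModification_thetaSubdivided _ _ _ _ ha hW hs hd hb hc (by push_cast; ring)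
        (by push_cast; ring) he h)⟩

end PlaneTropical

/-! ### Embeddings of dumbbell graphs. -/

namespace PlaneTropical

/-- The dumbbell graph. -/
noncomputable def dumbbellComb (a b c : ℝ) (ha : 0 < a) (hb : 0 < b) (hc : 0 < c) : Comb 2 3 0 where
  tail := ![0, 0, 1]
  head := ![0, 1, 1]
  len := ![a, b, c]
  base := ![]
  len_pos := by intro e; fin_cases e <;> assumption
  vertex := 0
  conn := by
    intro f hf i j
    have h : f 0 ↔ f 1 := hf 1
    fin_cases i <;> fin_cases j <;> simp [h]

section Dumbbell

variable (a b c : ℝ) (ha : 0 < a) (hb : 0 < b) (hc : 0 < c)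

/-- The subdivided dumbbell graph, with four infinite edges attached. -/
noncomputable def dumbbellSubdivided : Comb 6 7 4 where
  tail := ![0, 0, 1, 2, 3, 4, 5]
  head := ![2, 1, 4, 3, 0, 5, 1]
  len := ![a, b, c, a, a, c, c]
  base := ![2, 3, 4, 5]
  len_pos := by intro e; fin_cases e <;> assumption
  vertex := 0
  conn := by
    intro f hf
    have h0 : f 0 ↔ f 2 := hf 0
    have h1 : f 0 ↔ f 1 := hf 1
    have h2 : f 1 ↔ f 4 := hf 2
    have h3 : f 2 ↔ f 3 := hf 3
    have h4 : f 4 ↔ f 5 := hf 5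
    have key : ∀ i, f i ↔ f 0 := by
      intro i
      fin_cases i
      exacts [Iff.rfl, h1.symm, h0.symm, (h0.trans h3).symm, (h1.trans h2).symm,
        (h1.trans (h2.trans h4)).symm]
    exact fun i j => (key i).trans (key j).symm

lemma isModification_dumbbellSubdivided {a' c' : ℝ} (ha' : 0 < a') (hc' : 0 < c')
    (haa : a' = 3 * a) (hcc : c' = 3 * c)
    {Γ : AbstractTropicalCurve} (h : Γ.IsModification (dumbbellComb a' b c' ha' hb hc').curve) :
    Γ.IsModification (dumbbellSubdivided a b c ha hb hc).curve := by
  have h1 := Comb.isModification_subdiv (e := 0) (s := a) (t := a + a)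
    (hs := ha) (ht := by linarith) h (by simp [dumbbellComb]; linarith)
  have h2 := Comb.isModification_subdiv (e := 3) (s := a) (t := a)
    (hs := ha) (ht := ha) h1 rfl
  have h3 := Comb.isModification_subdiv (e := 2) (s := c) (t := c + c)
    (hs := hc) (ht := by linarith) h2 (by change _ = c'; linarith)
  have h4 := Comb.isModification_subdiv (e := 5) (s := c) (t := c)
    (hs := hc) (ht := hc) h3 rfl
  have h5 := Comb.isModification_attach (v := 5) <| Comb.isModification_attach (v := 4) <|
    Comb.isModification_attach (v := 3) <| Comb.isModification_attach (v := 2) h4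
  convert h5 using 1
  apply Comb.ext' <;> funext i <;> fin_cases i <;> rfl

set_option maxHeartbeats 1000000 in
/-- A drawing of the subdivided dumbbell graph. -/
noncomputable def dumbbellLayout : Layout (dumbbellSubdivided a b c ha hb hc) where
  -- Each loop becomes a triangle with three sides of equal lattice length, and the bridge is the
  -- horizontal segment between the triangles.
  pos := ![![0, 0], ![b, 0], ![0, a], ![-a, -a], ![b, -c], ![b + c, c]]
  dir := ![![0, 1], ![1, 0], ![0, -1], ![-1, -2], ![1, 1], ![1, 2], ![-1, -1]]
  rdir := ![![1, 3], ![-2, -3], ![-1, -3], ![2, 3]]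
  prim e := by
    rw [isPrimitive_iff_gcd]
    revert e
    decide
  rprim e := by
    rw [isPrimitive_iff_gcd]
    revert e
    decide
  pos_head := by
    intro e
    funext i
    fin_cases e <;> fin_cases i <;> simp [dumbbellSubdivided, toPlane] <;> ring
  edge_edge := by
    intro e e' h t s' h1 h2 h3 h4 h5 h6
    fin_cases e <;> fin_cases e' <;>
      simp [dumbbellSubdivided] at h h2 h4 h5 h6 <;> linarith
  edge_ray := by
    intro e e' t s' h1 h2 h3 h5 h6
    fin_cases e <;> fin_cases e' <;>
      simp [dumbbellSubdivided] at h2 h5 h6 <;> linarith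
  ray_ray := by
    intro e e' h t s' h1 h3 h5 h6
    fin_cases e <;> fin_cases e' <;>
      simp [dumbbellSubdivided] at h h5 h6 <;> linarith
  vertex_edge := by
    intro e e' t h1 h2 h5 h6
    fin_cases e <;> fin_cases e' <;>
      simp [dumbbellSubdivided] at h2 h5 h6 <;> linarith
  vertex_ray := by
    intro e e' t h1 h5 h6
    fin_cases e <;> fin_cases e' <;>
      simp [dumbbellSubdivided] at h5 h6 <;> linarith

lemma isTripod_dumbbellLayout (v : Fin 6) : (dumbbellLayout a b c ha hb hc).IsTripod v := by
  let τ : Fin 6 → Fin 3 → (Fin 7 ⊕ Fin 4) × Bool := ![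
    ![(.inl 0, true), (.inl 4, false), (.inl 1, true)],
    ![(.inl 1, false), (.inl 2, true), (.inl 6, false)],
    ![(.inl 3, true), (.inl 0, false), (.inr 0, true)],
    ![(.inl 4, true), (.inl 3, false), (.inr 1, true)],
    ![(.inl 5, true), (.inl 2, false), (.inr 2, true)],
    ![(.inl 6, true), (.inl 5, false), (.inr 3, true)]]
  apply Layout.isTripod_of_table _ (τ v)
  revert v
  change ∀ v, TableTripod ![0, 0, 1, 2, 3, 4, 5] ![2, 1, 4, 3, 0, 5, 1] ![2, 3, 4, 5]
    ![![0, 1], ![1, 0], ![0, -1], ![-1, -2], ![1, 1], ![1, 2], ![-1, -1]]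
    ![![1, 3], ![-2, -3], ![-1, -3], ![2, 3]] (τ v) v
  decide

lemma pos_dumbbellLayout_injective :
    Function.Injective (dumbbellLayout a b c ha hb hc).pos := by
  intro v w h
  have h0 := congrFun h 0
  have h1 := congrFun h 1
  clear h
  fin_cases v <;> fin_cases w <;>
    first | rfl | (simp [dumbbellLayout] at h0 h1; linarith)

end Dumbbell

/-- A dumbbell graph has a planar embedding. -/
lemma exists_isEmbedding_dumbbell {a b c : ℝ} (ha : 0 < a) (hb : 0 < b) (hc : 0 < c)
    {Γ : AbstractTropicalCurve} (h : Γ.IsModification (dumbbellComb a b c ha hb hc).curve) :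
    ∃ C, IsEmbedding C Γ :=
  ⟨_, (dumbbellLayout (a / 3) b (c / 3) (by linarith) hb (by linarith)).isEmbedding
    (isTripod_dumbbellLayout _ _ _ _ _ _) (pos_dumbbellLayout_injective _ _ _ _ _ _)
    (isModification_dumbbellSubdivided _ _ _ _ _ _ ha hc (by ring) (by ring) h)⟩

end PlaneTropical

/-! ### Nodes, their multiplicity, and layouts with one crossing. -/

namespace PlaneTropical

/-- The directions of the two lines through a node are unique up to sign and order. -/
lemma IsNodeAt.eq_or_neg_or {C : Set Plane} {p : Plane} {a b c d : Fin 2 → ℤ}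
    (h : IsNodeAt C p a b) (h' : IsNodeAt C p c d) :
    ((a = c ∨ a = -c) ∧ (b = d ∨ b = -d)) ∨ ((a = d ∨ a = -d) ∧ (b = c ∨ b = -c)) := by
  have key : ∀ x, IsPrimitive x → (∀ᶠ t in 𝓝 (0 : ℝ), p + t • toPlane x ∈ C) →
      (x = c ∨ x = -c) ∨ (x = d ∨ x = -d) := by
    intro x hx hl
    obtain ⟨t, ht, -, h1, h2⟩ :=
      exists_small_pos ((eventually_add_smul h'.2.2.2 (toPlane x)).and hl) one_pos
    have aux : ∀ y, IsPrimitive y → ∀ s : ℝ, p + t • toPlane x = p + s • toPlane y →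
        x = y ∨ x = -y := by
      intro y hy s hs
      rw [add_right_inj] at hs
      apply hx.eq_or_neg hy
      have h3 : t * cross (toPlane x) (toPlane y) = 0 := by
        rw [← cross_smul_left, hs, cross_smul_left, cross_self, mul_zero]
      have h4 := (mul_eq_zero.1 h3).resolve_left ht.ne'
      rw [cross_toPlane] at h4
      exact_mod_cast h4
    obtain ⟨s, hs | hs⟩ := h1.1 h2
    · exact Or.inl (aux c h'.1 s hs)
    · exact Or.inr (aux d h'.2.1 s hs)
  have hab : cross a b ≠ 0 := h.2.2.1
  have hpar : ∀ y, (a = y ∨ a = -y) → (b = y ∨ b = -y) → False := by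
    intro y h1 h2
    apply hab
    rcases h1 with rfl | rfl <;> rcases h2 with rfl | rfl <;>
      simp [cross_neg_left, cross_neg_right, cross_self]
  rcases key a h.1 h.line_germ_left with h1 | h1 <;>
    rcases key b h.2.1 h.line_germ_right with h2 | h2
  · exact (hpar c h1 h2).elim
  · exact Or.inl ⟨h1, h2⟩
  · exact Or.inr ⟨h1, h2⟩
  · exact (hpar d h1 h2).elim

/-- A curve with a single node of multiplicity one has node count at most one. -/
lemma nodeCount_le_one {C : Set Plane} {p : Plane} {a b : Fin 2 → ℤ} (h : IsNodeAt C p a b)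
    (hab : (a 0 * b 1 - a 1 * b 0).natAbs = 1) (hp : ∀ q a b, IsNodeAt C q a b → q = p) :
    nodeCount C ≤ 1 := by
  refine iSup_le fun s => ?_
  have h1 : ∀ q, (nodeMultiplicity C q : ℕ∞) ≤ if q = p then 1 else 0 := by
    intro q
    split_ifs with hq
    · rw [hq, nodeMultiplicity]
      have h2 : sInf {m | ∃ a b, IsNodeAt C p a b ∧ m = (a 0 * b 1 - a 1 * b 0).natAbs} ≤ 1 :=
        Nat.sInf_le ⟨a, b, h, hab.symm⟩
      exact_mod_cast h2
    · have : {m | ∃ a b, IsNodeAt C q a b ∧ m = (a 0 * b 1 - a 1 * b 0).natAbs} = ∅ := by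
        ext m
        simp only [Set.mem_ofPred_eq, Set.mem_empty_iff_false, iff_false]
        rintro ⟨a', b', h', -⟩
        exact hq (hp q a' b' h')
      rw [nodeMultiplicity, this]
      simp
  refine (Finset.sum_le_sum fun q _ => h1 q).trans ?_
  rw [Finset.sum_ite_eq']
  split_ifs <;> simp

namespace Layout

variable {n m r : ℕ} {c : Comb n m r} (l : Layout c)

/-- Exactly two darts leave the vertex `v`, in the opposite directions `d` and `-d`. -/
def IsThrough (v : Fin n) (d : Fin 2 → ℤ) : Prop :=
  ∃ α β, dartSrc c α = some v ∧ dartSrc c β = some v ∧ l.dartVec α = d ∧ l.dartVec β = -d ∧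
    ∀ ε, dartSrc c ε = some v → ε = α ∨ ε = β

variable {l}

lemma IsThrough.isPrimitive {v : Fin n} {d : Fin 2 → ℤ} (h : l.IsThrough v d) :
    IsPrimitive d := by
  obtain ⟨α, -, -, -, h, -⟩ := h
  rw [← h, ← drawing_vec]
  exact l.drawing.vec_prim α

lemma IsThrough.dartVec_eq {v : Fin n} {d : Fin 2 → ℤ} (h : l.IsThrough v d)
    {ε : (Fin m ⊕ Fin r) × Bool} (hε : dartSrc c ε = some v) :
    l.dartVec ε = d ∨ l.dartVec ε = -d := by
  obtain ⟨α, β, -, -, h1, h2, h3⟩ := h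
  rcases h3 ε hε with rfl | rfl
  · exact Or.inl h1
  · exact Or.inr h2

lemma exists_eq_add_smul {p : Plane} {d d' : Fin 2 → ℤ} (h : d' = d ∨ d' = -d) (t : ℝ) :
    ∃ s : ℝ, p + t • toPlane d = p + s • toPlane d' := by
  rcases h with rfl | rfl
  · exact ⟨t, rfl⟩
  · exact ⟨-t, by rw [toPlane_neg]; simp⟩

lemma IsThrough.exists_eq_of_mem_arc {v : Fin n} {d a : Fin 2 → ℤ} (h : l.IsThrough v d)
    (ha : a = d ∨ a = -d) {δ : (Fin m ⊕ Fin r) × Bool} (hδ : dartSrc c δ = some v) {q : Plane}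
    (hq : q ∈ l.drawing.arc δ.1) : ∃ t : ℝ, q = l.pos v + t • toPlane a := by
  rw [l.drawing.arc_eq ((l.drawing_src δ).trans hδ), drawing_vec] at hq
  obtain ⟨t, -, -, rfl⟩ := hq
  apply exists_eq_add_smul
  rcases h.dartVec_eq hδ with h1 | h1 <;> rcases ha with h2 | h2 <;> simp [h1, h2]

/-- Two strands which pass through the same point form a node. -/
lemma isNodeAt_pos {v w : Fin n} {d d' : Fin 2 → ℤ} (hv : l.IsThrough v d)
    (hw : l.IsThrough w d') (hd : cross d d' ≠ 0) (hpos : l.pos w = l.pos v)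
    (hinj : ∀ x, l.pos x = l.pos v → x = v ∨ x = w) :
    IsNodeAt l.drawing.support (l.pos v) d d' := by
  refine ⟨hv.isPrimitive, hw.isPrimitive, hd, ?_⟩
  filter_upwards [l.drawing.eventually_mem_support_pos v] with q hq
  rw [hq]
  simp only [drawing_src, drawing_vec]
  change (q = l.pos v ∨ ∃ δ w, dartSrc c δ = some w ∧ l.pos w = l.pos v ∧ ∃ t : ℝ, 0 < t ∧
    q = l.pos v + t • toPlane (l.dartVec δ)) ↔ _
  constructor
  · rintro (rfl | ⟨δ, x, h1, h2, t, ht, rfl⟩)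
    · exact ⟨0, Or.inl (by simp)⟩
    · rcases hinj x h2 with rfl | rfl
      · obtain ⟨s, hs⟩ := exists_eq_add_smul (p := l.pos x) (d := l.dartVec δ) (d' := d)
          (by rcases hv.dartVec_eq h1 with h | h <;> simp [h]) t
        exact ⟨s, Or.inl hs⟩
      · obtain ⟨s, hs⟩ := exists_eq_add_smul (p := l.pos v) (d := l.dartVec δ) (d' := d')
          (by rcases hw.dartVec_eq h1 with h | h <;> simp [h]) t
        exact ⟨s, Or.inr hs⟩
  · have key : ∀ x e, l.IsThrough x e → l.pos x = l.pos v → ∀ t : ℝ,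
        q = l.pos v + t • toPlane e → (q = l.pos v ∨ ∃ δ w, dartSrc c δ = some w ∧
          l.pos w = l.pos v ∧ ∃ t : ℝ, 0 < t ∧ q = l.pos v + t • toPlane (l.dartVec δ)) := by
      rintro x e ⟨α, β, h1, h2, h3, h4, -⟩ hx t hq
      rcases lt_trichotomy t 0 with ht | rfl | ht
      · exact Or.inr ⟨β, x, h2, hx, -t, by linarith, by rw [h4, toPlane_neg, hq]; simp⟩
      · exact Or.inl (by simpa using hq)
      · exact Or.inr ⟨α, x, h1, hx, t, ht, by rw [h3, hq]⟩
    rintro ⟨t, h | h⟩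
    · exact key v d hv rfl t h
    · exact key w d' hw hpos t h

variable (l)

/-- A layout with a single crossing of multiplicity one is a planar immersion with at most
one node. -/
lemma isImmersion {v w : Fin n} {d d' : Fin 2 → ℤ} (hvw : v ≠ w) (hv : l.IsThrough v d)
    (hw : l.IsThrough w d') (hd : cross d d' = 1) (hpos : l.pos w = l.pos v)
    (ht : ∀ x, x ≠ v → x ≠ w → l.IsTripod x)
    (hinj : ∀ x y, l.pos x = l.pos y → x = y ∨ ((x = v ∨ x = w) ∧ (y = v ∨ y = w)))
    {Γ : AbstractTropicalCurve} (hΓ : Γ.IsModification c.curve) :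
    IsImmersion l.drawing.support Γ ∧ nodeCount l.drawing.support ≤ 1 := by
  have hx : ∀ x, l.pos x = l.pos v ↔ x = v ∨ x = w := by
    intro x
    constructor
    · intro h
      rcases hinj x v h with h | h
      · exact Or.inl h
      · exact h.1
    · rintro (rfl | rfl)
      · rfl
      · exact hpos
  have hnode : IsNodeAt l.drawing.support (l.pos v) d d' :=
    isNodeAt_pos hv hw (by rw [hd]; exact one_ne_zero) hpos fun x => (hx x).1
  have hsm : ∀ p ∈ l.drawing.support, p ≠ l.pos v → IsSmoothAt l.drawing.support p := by
    rintro p (⟨x, rfl⟩ | hp) hne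
    · have h1 : ¬ (x = v ∨ x = w) := fun h => hne ((hx x).2 h)
      push Not at h1
      exact l.isSmoothAt_pos (ht x h1.1 h1.2) fun y hy => (hinj y x hy).resolve_right
        fun h => hne ((hx x).2 h.2)
    · obtain ⟨e, he⟩ := Set.mem_iUnion.1 hp
      exact l.isSmoothAt_arc he
  have huniq : ∀ q a b, IsNodeAt l.drawing.support q a b → q = l.pos v := by
    intro q a b hq
    by_contra hne
    exact hq.not_isSmoothAt (hsm q hq.mem hne)
  refine ⟨⟨⟨l.isFiniteUnion fun x => ?_, fun p hp => ?_⟩, _, hΓ, ⟨l.resolution ?_ ?_⟩⟩,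
    nodeCount_le_one hnode (by change (cross d d').natAbs = 1; rw [hd]; rfl) huniq⟩
  · by_cases h1 : x = v
    · obtain ⟨α, -, hα, -⟩ := hv
      exact ⟨α, h1 ▸ hα⟩
    · by_cases h2 : x = w
      · obtain ⟨α, -, hα, -⟩ := hw
        exact ⟨α, h2 ▸ hα⟩
      · obtain ⟨α, -, -, hα, -⟩ := ht x h1 h2
        exact ⟨α, hα⟩
  · by_cases h : p = l.pos v
    · exact Or.inr ⟨d, d', h ▸ hnode⟩
    · exact Or.inl (hsm p hp h)
  · intro x y hxy hs
    refine (hinj x y hxy).resolve_right fun h => ?_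
    have h1 := (hx x).2 h.1
    rw [h1] at hs
    exact hnode.not_isSmoothAt hs
  · intro p a b hp
    obtain rfl := huniq p a b hp
    -- The two lines are known only up to order, so the two vertices over the node may have to
    -- exchange their roles.
    rcases hp.eq_or_neg_or hnode with ⟨h1, h2⟩ | ⟨h1, h2⟩
    · refine ⟨v, w, hvw, hx, fun δ hδ q hq => hv.exists_eq_of_mem_arc h1 hδ hq,
        fun δ hδ q hq => ?_⟩
      rw [← hpos]
      exact hw.exists_eq_of_mem_arc h2 hδ hq
    · refine ⟨w, v, hvw.symm, fun x => (hx x).trans or_comm, fun δ hδ q hq => ?_,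
        fun δ hδ q hq => hv.exists_eq_of_mem_arc h2 hδ hq⟩
      rw [← hpos]
      exact hw.exists_eq_of_mem_arc h1 hδ hq

end Layout

end PlaneTropical

/-! ### The equilateral theta graph with one node. -/

namespace PlaneTropical

section Nodal

variable (h : ℝ) (h0 : 0 < h)

/-- The subdivided theta graph with edges of length `8 * h`, with six infinite edges attached. -/
noncomputable def nodalSubdivided : Comb 10 11 6 where
  tail := ![0, 0, 0, 2, 3, 4, 5, 6, 7, 8, 9]
  head := ![2, 4, 7, 3, 1, 5, 6, 1, 8, 9, 1]
  -- Every strand has length `8 * h`: one as `3 + 4 + 1`, the other two as `2 + 2 + 2 + 2`.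
  len := ![3 * h, 2 * h, 2 * h, 4 * h, h, 2 * h, 2 * h, 2 * h, 2 * h, 2 * h, 2 * h]
  base := ![2, 3, 4, 5, 9, 8]
  len_pos := by intro e; fin_cases e <;> simpa using h0
  vertex := 0
  conn := by
    intro f hf
    have e0 : f 0 ↔ f 2 := hf 0
    have e1 : f 0 ↔ f 4 := hf 1
    have e2 : f 0 ↔ f 7 := hf 2
    have e3 : f 2 ↔ f 3 := hf 3
    have e4 : f 3 ↔ f 1 := hf 4
    have e5 : f 4 ↔ f 5 := hf 5
    have e6 : f 5 ↔ f 6 := hf 6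
    have e8 : f 7 ↔ f 8 := hf 8
    have e9 : f 8 ↔ f 9 := hf 9
    have key : ∀ i, f i ↔ f 0 := by
      intro i
      fin_cases i
      exacts [Iff.rfl, (e0.trans (e3.trans e4)).symm, e0.symm, (e0.trans e3).symm, e1.symm,
        (e1.trans e5).symm, (e1.trans (e5.trans e6)).symm, e2.symm, (e2.trans e8).symm,
        (e2.trans (e8.trans e9)).symm]
    exact fun i j => (key i).trans (key j).symm

lemma isModification_nodalSubdivided {L : ℝ} (hL : 0 < L) (hLh : L = 8 * h)
    {Γ : AbstractTropicalCurve} (hΓ : Γ.IsModification (thetaComb L L L hL hL hL).curve) :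
    Γ.IsModification (nodalSubdivided h h0).curve := by
  have p2 : 0 < 2 * h := by linarith
  have p3 : 0 < 3 * h := by linarith
  have p4 : 0 < 4 * h := by linarith
  have p5 : 0 < 5 * h := by linarith
  have p6 : 0 < 6 * h := by linarith
  have h1 := Comb.isModification_subdiv (e := 0) (s := 3 * h) (t := 5 * h)
    (hs := p3) (ht := p5) hΓ (by change _ = L; linarith)
  have h2 := Comb.isModification_subdiv (e := 3) (s := 4 * h) (t := h)
    (hs := p4) (ht := h0) h1 (by change _ = 5 * h; linarith)
  have h3 := Comb.isModification_subdiv (e := 1) (s := 2 * h) (t := 6 * h)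
    (hs := p2) (ht := p6) h2 (by change _ = L; linarith)
  have h4 := Comb.isModification_subdiv (e := 5) (s := 2 * h) (t := 4 * h)
    (hs := p2) (ht := p4) h3 (by change _ = 6 * h; linarith)
  have h5 := Comb.isModification_subdiv (e := 6) (s := 2 * h) (t := 2 * h)
    (hs := p2) (ht := p2) h4 (by change _ = 4 * h; linarith)
  have h6 := Comb.isModification_subdiv (e := 2) (s := 2 * h) (t := 6 * h)
    (hs := p2) (ht := p6) h5 (by change _ = L; linarith)
  have h7 := Comb.isModification_subdiv (e := 8) (s := 2 * h) (t := 4 * h)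
    (hs := p2) (ht := p4) h6 (by change _ = 6 * h; linarith)
  have h8 := Comb.isModification_subdiv (e := 9) (s := 2 * h) (t := 2 * h)
    (hs := p2) (ht := p2) h7 (by change _ = 4 * h; linarith)
  have h9 := Comb.isModification_attach (v := 8) <| Comb.isModification_attach (v := 9) <|
    Comb.isModification_attach (v := 5) <| Comb.isModification_attach (v := 4) <|
    Comb.isModification_attach (v := 3) <| Comb.isModification_attach (v := 2) h8
  convert h9 using 1
  apply Comb.ext' <;> funext i <;> fin_cases i <;> rfl

set_option maxHeartbeats 4000000 in
/-- A drawing of the subdivided theta graph with one crossing. -/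
noncomputable def nodalLayout : Layout (nodalSubdivided h h0) where
  -- Vertices `6` and `7` both lie at the origin, where one strand passes horizontally and another
  -- vertically.
  pos := ![![0, -2 * h], ![-2 * h, 0], ![-3 * h, -5 * h], ![-3 * h, -h], ![2 * h, -2 * h],
    ![2 * h, 0], ![0, 0], ![0, 0], ![0, 2 * h], ![-2 * h, 2 * h]]
  dir := ![![-1, -1], ![1, 0], ![0, 1], ![0, 1], ![1, 1], ![0, 1], ![-1, 0], ![-1, 0], ![0, 1],
    ![-1, 0], ![0, -1]]
  rdir := ![![-1, -2], ![-1, 0], ![1, -1], ![1, 1], ![-1, 1], ![1, 1]]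
  prim e := by
    rw [isPrimitive_iff_gcd]
    revert e
    decide
  rprim e := by
    rw [isPrimitive_iff_gcd]
    revert e
    decide
  pos_head := by
    intro e
    funext i
    fin_cases e <;> fin_cases i <;> simp [nodalSubdivided, toPlane] <;> ring
  edge_edge := by
    intro e e' h t s' h1 h2 h3 h4 h5 h6
    fin_cases e <;> fin_cases e' <;>
      simp [nodalSubdivided] at h h2 h4 h5 h6 <;> linarith
  edge_ray := by
    intro e e' t s' h1 h2 h3 h5 h6
    fin_cases e <;> fin_cases e' <;>
      simp [nodalSubdivided] at h2 h5 h6 <;> linarith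
  ray_ray := by
    intro e e' h t s' h1 h3 h5 h6
    fin_cases e <;> fin_cases e' <;>
      simp [nodalSubdivided] at h h5 h6 <;> linarith
  vertex_edge := by
    intro e e' t h1 h2 h5 h6
    fin_cases e <;> fin_cases e' <;>
      simp [nodalSubdivided] at h2 h5 h6 <;> linarith
  vertex_ray := by
    intro e e' t h1 h5 h6
    fin_cases e <;> fin_cases e' <;>
      simp [nodalSubdivided] at h5 h6 <;> linarith

lemma isTripod_nodalLayout (v : Fin 10) (h6 : v ≠ 6) (h7 : v ≠ 7) :
    (nodalLayout h h0).IsTripod v := by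
  let τ : Fin 10 → Fin 3 → (Fin 11 ⊕ Fin 6) × Bool := ![
    ![(.inl 1, true), (.inl 2, true), (.inl 0, true)],
    ![(.inl 7, false), (.inl 10, false), (.inl 4, false)],
    ![(.inl 0, false), (.inl 3, true), (.inr 0, true)],
    ![(.inl 3, false), (.inl 4, true), (.inr 1, true)],
    ![(.inl 5, true), (.inl 1, false), (.inr 2, true)],
    ![(.inl 6, true), (.inl 5, false), (.inr 3, true)],
    -- Placeholders for the two vertices over the node, which the hypotheses exclude.
    fun _ => (.inl 0, true), fun _ => (.inl 0, true),
    ![(.inl 9, true), (.inl 8, false), (.inr 5, true)],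
    ![(.inl 10, true), (.inl 9, false), (.inr 4, true)]]
  apply Layout.isTripod_of_table _ (τ v)
  revert v
  change ∀ v, v ≠ 6 → v ≠ 7 → TableTripod ![0, 0, 0, 2, 3, 4, 5, 6, 7, 8, 9]
    ![2, 4, 7, 3, 1, 5, 6, 1, 8, 9, 1] ![2, 3, 4, 5, 9, 8]
    ![![-1, -1], ![1, 0], ![0, 1], ![0, 1], ![1, 1], ![0, 1], ![-1, 0], ![-1, 0], ![0, 1],
      ![-1, 0], ![0, -1]]
    ![![-1, -2], ![-1, 0], ![1, -1], ![1, 1], ![-1, 1], ![1, 1]] (τ v) v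
  decide

lemma isThrough_nodalLayout_horizontal : (nodalLayout h h0).IsThrough 6 ![1, 0] := by
  refine ⟨(.inl 6, false), (.inl 7, true), rfl, rfl, ?_, ?_, ?_⟩
  · change -![-1, 0] = ![1, 0]
    decide
  · change ![-1, 0] = -![1, 0]
    decide
  · simp only [← Layout.tableSrc_eq]
    change ∀ ε, tableSrc ![0, 0, 0, 2, 3, 4, 5, 6, 7, 8, 9] ![2, 4, 7, 3, 1, 5, 6, 1, 8, 9, 1]
      ![2, 3, 4, 5, 9, 8] ε = some 6 → ε = (.inl 6, false) ∨ ε = (.inl 7, true)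
    decide

lemma isThrough_nodalLayout_vertical : (nodalLayout h h0).IsThrough 7 ![0, 1] := by
  refine ⟨(.inl 8, true), (.inl 2, false), rfl, rfl, rfl, rfl, ?_⟩
  simp only [← Layout.tableSrc_eq]
  change ∀ ε, tableSrc ![0, 0, 0, 2, 3, 4, 5, 6, 7, 8, 9] ![2, 4, 7, 3, 1, 5, 6, 1, 8, 9, 1]
    ![2, 3, 4, 5, 9, 8] ε = some 7 → ε = (.inl 8, true) ∨ ε = (.inl 2, false)
  decide

lemma pos_nodalLayout_eq {v w : Fin 10} (hvw : (nodalLayout h h0).pos v = (nodalLayout h h0).pos w) :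
    v = w ∨ ((v = 6 ∨ v = 7) ∧ (w = 6 ∨ w = 7)) := by
  have e0 := congrFun hvw 0
  have e1 := congrFun hvw 1
  clear hvw
  fin_cases v <;> fin_cases w <;>
    first | decide | (exfalso; simp [nodalLayout] at e0 e1; done) |
      (exfalso; simp [nodalLayout] at e0 e1; linarith)

end Nodal

/-- An equilateral theta graph has a planar immersion with at most one node. -/
lemma crossingNumber_le_one {L : ℝ} (hL : 0 < L) {Γ : AbstractTropicalCurve}
    (hΓ : Γ.IsModification (thetaComb L L L hL hL hL).curve) : Γ.crossingNumber ≤ 1 := by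
  have h0 : 0 < L / 8 := by linarith
  obtain ⟨h1, h2⟩ := (nodalLayout (L / 8) h0).isImmersion (by decide)
    (isThrough_nodalLayout_horizontal _ _) (isThrough_nodalLayout_vertical _ _) (by decide) rfl
    (isTripod_nodalLayout _ _) (fun _ _ => pos_nodalLayout_eq _ _)
    (isModification_nodalSubdivided _ h0 hL (by ring) hΓ)
  rw [AbstractTropicalCurve.crossingNumber]
  exact (iInf₂_le (nodalLayout (L / 8) h0).drawing.support h1).trans h2

end PlaneTropical

/-! ### Classification of stable curves of genus two. -/

namespace AbstractTropicalCurve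

open PlaneTropical

variable {Γ : AbstractTropicalCurve}

-- A loop at `v` contributes through both of its ends, in accordance with the second set in
-- `degree`.
open Classical in
lemma degree_eq_sum [Fintype Γ.E] {o : Γ.E → Γ.V × Γ.V} (ho : ∀ e, Γ.ends e = s((o e).1, (o e).2))
    (v : Γ.V) : Γ.degree v =
      ∑ e, ((if (o e).1 = v then 1 else 0) + (if (o e).2 = v then 1 else 0)) := by
  have h : ∀ P : Γ.E → Prop, {e | P e}.ncard = ∑ e, if P e then 1 else 0 := by
    intro P
    rw [← Finset.card_filter, ← Set.ncard_coe_finset]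
    simp
  rw [degree, h, h, ← Finset.sum_add_distrib]
  refine Finset.sum_congr rfl fun e _ => ?_
  rw [ho e]
  by_cases h1 : (o e).1 = v <;> by_cases h2 : (o e).2 = v <;>
    simp [Prod.ext_iff, h1, h2, eq_comm (a := v)]

lemma exists_orientation (Γ : AbstractTropicalCurve) :
    ∃ o : Γ.E → Γ.V × Γ.V, ∀ e, Γ.ends e = s((o e).1, (o e).2) :=
  ⟨fun e => (Γ.ends e).out, fun e => ((Γ.ends e).out_eq).symm⟩

/-- A stable curve of genus two has two vertices and three edges. -/
lemma IsStable.card_eq (hs : Γ.IsStable) (hg : Γ.genus = 2) :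
    Nat.card Γ.V = 2 ∧ Nat.card Γ.E = 3 := by
  classical
  have := Fintype.ofFinite Γ.V
  have := Fintype.ofFinite Γ.E
  obtain ⟨o, ho⟩ := Γ.exists_orientation
  -- Counting edge ends in two ways gives `3 |V| = 2 |E|`, while genus two means `|E| = |V| + 1`.
  have h1 : ∑ v, Γ.degree v = 2 * Nat.card Γ.E := by
    simp_rw [degree_eq_sum ho]
    rw [Finset.sum_comm]
    simp [Finset.sum_add_distrib, mul_comm]
  have h2 : ∑ v, Γ.degree v = 3 * Nat.card Γ.V := by
    rw [Finset.sum_congr rfl fun v _ => hs v]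
    simp [mul_comm]
  rw [genus] at hg
  omega

/-- An abstract tropical curve without infinite vertices is given by its incidence tables. -/
lemma isModification_comb {n m : ℕ} (c : Comb n m 0) (f : Γ.V ≃ Fin n) (g : Γ.E ≃ Fin m)
    (hi : Γ.infVerts = ∅) (h1 : ∀ e, s(c.tail (g e), c.head (g e)) = (Γ.ends e).map f)
    (h2 : ∀ e, ENNReal.ofReal (c.len (g e)) = Γ.length e) : Γ.IsModification c.curve := by
  refine Relation.ReflTransGen.single (Or.inl
    ⟨f.trans (Equiv.sumEmpty _ _).symm, g.trans (Equiv.sumEmpty _ _).symm, ?_, h2, ?_⟩)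
  · intro e
    change c.ends (.inl (g e)) = Sym2.map (fun x => Sum.inl (f x)) (Γ.ends e)
    have h3 := congrArg (Sym2.map (Sum.inl : Fin n → Fin n ⊕ Fin 0)) (h1 e)
    rw [Sym2.map_map] at h3
    exact h3
  · intro v
    rw [hi]
    exact iff_of_false (c.inl_notMem_infVerts _) (Set.notMem_empty v)

lemma IsStable.ofReal_toReal_length (hs : Γ.IsStable) (e : Γ.E) :
    ENNReal.ofReal (Γ.length e).toReal = Γ.length e :=
  ENNReal.ofReal_toReal (hs.length_ne_top e)

lemma IsStable.toReal_length_pos (hs : Γ.IsStable) (e : Γ.E) : 0 < (Γ.length e).toReal :=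
  ENNReal.toReal_pos (Γ.length_pos e).ne' (hs.length_ne_top e)

/-- An enumeration of the edges of a theta graph yields its incidence tables. -/
lemma IsTheta.isModification_thetaComb (hT : Γ.IsTheta) (hs : Γ.IsStable) (g : Γ.E ≃ Fin 3)
    {ℓ : Fin 3 → ℝ} (hℓ : ∀ i, ℓ i = (Γ.length (g.symm i)).toReal) (h0 : 0 < ℓ 0) (h1 : 0 < ℓ 1)
    (h2 : 0 < ℓ 2) : Γ.IsModification (thetaComb (ℓ 0) (ℓ 1) (ℓ 2) h0 h1 h2).curve := by
  classical
  obtain ⟨u, v, huv, hV, -, hends⟩ := hT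
  let f : Γ.V ≃ Fin 2 :=
    { toFun := fun w => if w = u then 0 else 1
      invFun := ![u, v]
      left_inv := by
        intro w
        rcases hV w with rfl | rfl
        · simp
        · simp [huv.symm]
      right_inv := by
        intro i
        fin_cases i
        · simp
        · simp [huv.symm] }
  refine isModification_comb _ f g hs.infVerts_eq ?_ ?_
  · intro e
    rw [hends e, Sym2.map_mk]
    have hu : f u = 0 := by simp [f]
    have hv : f v = 1 := by simp [f, huv.symm]
    rw [hu, hv]
    generalize g e = i
    fin_cases i <;> rfl
  · intro e
    have h3 : (thetaComb (ℓ 0) (ℓ 1) (ℓ 2) h0 h1 h2).len (g e) = ℓ (g e) := by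
      generalize g e = i
      fin_cases i <;> rfl
    rw [h3, hℓ, Equiv.symm_apply_apply, hs.ofReal_toReal_length]

/-- A theta graph whose edges do not all have the same length has a planar embedding. -/
lemma IsTheta.exists_isEmbedding (hT : Γ.IsTheta) (hs : Γ.IsStable) (he : ¬ Γ.IsEquilateral) :
    ∃ C, IsEmbedding C Γ := by
  obtain ⟨-, -, -, -, hE, -⟩ := id hT
  let g : Γ.E ≃ Fin 3 := Finite.equivFinOfCardEq hE
  let ℓ : Fin 3 → ℝ := fun i => (Γ.length (g.symm i)).toReal
  -- Sorting supplies the order of the lengths assumed in `exists_isEmbedding_theta`.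
  let σ := Tuple.sort ℓ
  have hm : Monotone (ℓ ∘ σ) := Tuple.monotone_sort ℓ
  have hp : ∀ i, 0 < (ℓ ∘ σ) i := fun i => hs.toReal_length_pos _
  have h01 : (ℓ ∘ σ) 0 ≤ (ℓ ∘ σ) 1 := hm (by decide)
  have h12 : (ℓ ∘ σ) 1 ≤ (ℓ ∘ σ) 2 := hm (by decide)
  refine exists_isEmbedding_theta (hp 0) (hp 1) (hp 2) h01 h12 ?_
    (hT.isModification_thetaComb hs (g.trans σ.symm) (fun i => rfl) _ _ _)
  by_contra h
  apply he
  have h3 : ∀ i, (ℓ ∘ σ) i = (ℓ ∘ σ) 0 := by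
    intro i
    fin_cases i
    · rfl
    · exact le_antisymm (h12.trans (not_lt.1 h)) h01
    · exact le_antisymm (not_lt.1 h) (h01.trans h12)
  have h4 : ∀ e, (Γ.length e).toReal = (ℓ ∘ σ) 0 := by
    intro e
    rw [← h3 (σ.symm (g e))]
    simp [ℓ]
  intro e e'
  rw [← hs.ofReal_toReal_length e, ← hs.ofReal_toReal_length e', h4, h4]

/-- An equilateral theta graph has crossing number at most one. -/
lemma IsTheta.crossingNumber_le_one (hT : Γ.IsTheta) (hs : Γ.IsStable) (he : Γ.IsEquilateral) :
    Γ.crossingNumber ≤ 1 := by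
  obtain ⟨-, -, -, -, hE, -⟩ := id hT
  let g : Γ.E ≃ Fin 3 := Finite.equivFinOfCardEq hE
  have hL := hs.toReal_length_pos (g.symm 0)
  exact PlaneTropical.crossingNumber_le_one hL (hT.isModification_thetaComb hs g
    (ℓ := fun _ => (Γ.length (g.symm 0)).toReal) (fun i => by rw [he (g.symm i) (g.symm 0)])
    hL hL hL)

/-- Three edges on two vertices which all have degree three form a theta graph or a dumbbell. -/
lemma theta_or_dumbbell_table : ∀ x : Fin 3 → Fin 2 × Fin 2,
    (∀ v, ∑ e, ((if (x e).1 = v then 1 else 0) + (if (x e).2 = v then 1 else 0)) = 3) →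
    (∀ e, x e = (0, 1) ∨ x e = (1, 0)) ∨ ∃ i j k, i ≠ j ∧ i ≠ k ∧ j ≠ k ∧ x i = (0, 0) ∧
      (x j = (0, 1) ∨ x j = (1, 0)) ∧ x k = (1, 1) := by
  decide

/-- A stable curve of genus two is a theta graph or a dumbbell. -/
lemma IsStable.isTheta_or_dumbbell (hs : Γ.IsStable) (hg : Γ.genus = 2) :
    Γ.IsTheta ∨ ∃ a b c, ∃ (ha : 0 < a) (hb : 0 < b) (hc : 0 < c),
      Γ.IsModification (dumbbellComb a b c ha hb hc).curve := by
  classical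
  have := Fintype.ofFinite Γ.E
  obtain ⟨hV, hE⟩ := hs.card_eq hg
  let f : Γ.V ≃ Fin 2 := Finite.equivFinOfCardEq hV
  let g : Γ.E ≃ Fin 3 := Finite.equivFinOfCardEq hE
  obtain ⟨o, ho⟩ := Γ.exists_orientation
  let x : Fin 3 → Fin 2 × Fin 2 := fun i => (f (o (g.symm i)).1, f (o (g.symm i)).2)
  have hx : ∀ i, (Γ.ends (g.symm i)).map f = s((x i).1, (x i).2) := by
    intro i
    rw [ho, Sym2.map_mk]
  have hdeg : ∀ v, ∑ e, ((if (x e).1 = v then 1 else 0) + (if (x e).2 = v then 1 else 0)) = 3 := by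
    intro v
    have h := hs (f.symm v)
    rw [degree_eq_sum ho, ← Equiv.sum_comp g.symm] at h
    simpa only [Equiv.eq_symm_apply] using h
  rcases theta_or_dumbbell_table x hdeg with h | ⟨i, j, k, hij, hik, hjk, h1, h2, h3⟩
  · left
    refine ⟨f.symm 0, f.symm 1, by simp, fun w => ?_, hE, fun e => ?_⟩
    · rw [Equiv.eq_symm_apply, Equiv.eq_symm_apply]
      generalize f w = i
      revert i
      decide
    · apply Sym2.map.injective f.injective
      have h4 := hx (g e)
      rw [Equiv.symm_apply_apply] at h4
      rw [h4, Sym2.map_mk]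
      rcases h (g e) with h | h <;> simp [h, Sym2.eq_swap]
  · right
    -- The edges are renumbered as loop, bridge, loop, the order used in `dumbbellComb`.
    have hinj : Function.Injective ![i, j, k] := by
      intro a b hab
      fin_cases a <;> fin_cases b <;> simp_all
    let σ : Fin 3 ≃ Fin 3 := Equiv.ofBijective _ (Finite.injective_iff_bijective.1 hinj)
    have hp : ∀ i, 0 < (Γ.length (g.symm (σ i))).toReal := fun i => hs.toReal_length_pos _
    refine ⟨_, _, _, hp 0, hp 1, hp 2, isModification_comb _ f (g.trans σ.symm) hs.infVerts_eq ?_ ?_⟩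
    · intro e
      obtain ⟨t, rfl⟩ := (g.trans σ.symm).symm.surjective e
      rw [Equiv.apply_symm_apply]
      change _ = Sym2.map f (Γ.ends (g.symm (σ t)))
      rw [hx]
      fin_cases t
      · change s(0, 0) = s((x i).1, (x i).2)
        rw [h1]
      · change s(0, 1) = s((x j).1, (x j).2)
        rcases h2 with h2 | h2 <;> rw [h2]
        exact Sym2.eq_swap
      · change s(1, 1) = s((x k).1, (x k).2)
        rw [h3]
    · intro e
      obtain ⟨t, rfl⟩ := (g.trans σ.symm).symm.surjective e
      rw [Equiv.apply_symm_apply]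
      refine Eq.trans ?_ (hs.ofReal_toReal_length _)
      fin_cases t <;> rfl

end AbstractTropicalCurve

theorem mainTheorem11 (Γ : AbstractTropicalCurve) (hstable : Γ.IsStable) (hgenus : Γ.genus = 2) :
    (¬ (Γ.IsTheta ∧ Γ.IsEquilateral) →
      Γ.crossingNumber = 0 ∧ ∃ C, PlaneTropical.IsEmbedding C Γ) ∧
    (Γ.IsTheta ∧ Γ.IsEquilateral → Γ.crossingNumber = 1) := by
  constructor
  · intro h
    have key : ∃ C, PlaneTropical.IsEmbedding C Γ := by
      rcases hstable.isTheta_or_dumbbell hgenus with hT | ⟨a, b, c, ha, hb, hc, hΓ⟩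
      · exact hT.exists_isEmbedding hstable fun he => h ⟨hT, he⟩
      · exact PlaneTropical.exists_isEmbedding_dumbbell ha hb hc hΓ
    obtain ⟨C, hC⟩ := key
    exact ⟨hC.crossingNumber_eq_zero, C, hC⟩
  · rintro ⟨hT, he⟩
    exact le_antisymm (hT.crossingNumber_le_one hstable he)
      (PlaneTropical.one_le_crossingNumber hstable hT he)
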